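/- Let $V$ be a Euclidean space of dimension $r$ and $W\subset O(V)$ a finite reflection group of coincidental type, that is, of type $A_n$ ($n\ge 1$), $B_n$ ($n\ge 2$), $H_3$ or $I_2(m)$ ($m\ge 3$), whose reflection arrangement $\mathcal A$ (the set of reflecting hyperplanes of $W$) is essential, i.e. has intersection $\{0\}$. Let $\mathcal L$ be the set of flats of $\mathcal A$ (intersections of sets of hyperplanes of $\mathcal A$, including $V$), $\mathcal F$ the set of faces of $\mathcal A$, and let the support $\mathfrak s(F)$ of a face $F$ be the smallest flat containing $F$; $\dim F:=\dim\mathfrak s(F)$. The real Tits algebra $\mathbb R\mathcal F$ is the semigroup algebra of $\mathcal F$ under the Tits product: $FG$ lies on the same side of a hyperplane $H\in\mathcal A$ as $F$ if $F\not\subset H$, and as $G$ if $F\subset H$. Fix a chamber $c_1$, let $S$ be the set of reflections in the walls of $c_1$, let $\ell$ be the length function of $(W,S)$, and put $\mathrm{Des}(w)=\{s\in S:\ell(ws)<\ell(w)\}$ and $Y_T=\sum_{w:\,\mathrm{Des}(w)\subseteq T}w\in\mathbb RW$ for $T\subseteq S$. For $X\in\mathcal L$ let $\mathfrak u_X\in\mathbb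 R\mathcal F$ be the average of the faces with support $X$ (the uniform section), and define recursively $$\mathfrak e_X=\mathfrak u_X-\sum_{Y\in\mathcal L,\;Y\supsetneq X}\mathfrak u_X\,\mathfrak e_Y,\qquad \mathfrak e_k=\sum_{X\in\mathcal L,\;\dim X=k}\mathfrak e_X .$$ Let $\varphi:(\mathbb R\mathcal F)^W\to\mathbb RW$ be the linear map (Bidigare's isomorphism onto the opposite descent algebra) that sends the sum of the $W$-orbit of a face $F\subseteq c_1$ to $Y_T$, where $T=\{s\in S:sF\ne F\}$. Let $\mathsf s=\sum_{s\in S}Y_{\{s\}}$ be the Barr element. Then the number of one-dimensional faces of $\mathcal A$ contained in a flat $X$ depends only on $\dim X$; writing $\sigma_k$ for this number when $\dim X=k$, one has $\sigma_0<\sigma_1<\dots<\sigma_r$. For every $0\le k\le r$ put $$\mathsf s^{(k)}=\prod_{0\le j\le r,\;j\ne k}\frac{\mathsf s-\sigma_j}{\sigma_k-\sigma_j}\in\mathbb RW .$$ The image of right multiplication by $\mathsf s^{(k)}$ on $\mathbb RW$ is the $\sigma_k$-eigenspace of right multiplication by $\mathsf s$, the element $\mathfrak e_k$ is $W$-invariant,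 and $$\mathsf s^{(k)}=\varphi(\mathfrak e_k).$$ -/

import Mathlib

/-! Real reflection arrangements, the Tits algebra of faces, the flat idempotents of the uniform
section, Solomon's elements `Y_T`, and the Barr element. -/

noncomputable section

namespace ReflArr

open Module

variable {V : Type*} [NormedAddCommGroup V] [InnerProductSpace ℝ V]

/-! ### The arrangement -/

/-- The orthogonal reflection of `V` across the hyperplane `α^⊥` (used for `α ≠ 0`). -/
def refl (α : V) : V ≃ₗᵢ[ℝ] V := (ℝ ∙ α)ᗮ.reflection

/-- The unit vectors `α` such that the reflection across `α^⊥` belongs to `W`. Every hyperplane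
of the reflection arrangement is `α^⊥` for exactly two such vectors, `α` and `-α`; they
correspond to the two open half-spaces of that hyperplane. -/
@[ext]
structure UnitNormal (W : Subgroup (V ≃ₗᵢ[ℝ] V)) where
  vec : V
  norm_eq : ‖vec‖ = 1
  refl_mem : refl vec ∈ W

/-- `W` is generated by the reflections it contains, and its reflection arrangement is essential
(the intersection of all reflecting hyperplanes is `0`). -/
structure IsEssentialReflectionGroup (W : Subgroup (V ≃ₗᵢ[ℝ] V)) : Prop where
  generated : W = Subgroup.closure {g | g ∈ W ∧ ∃ α : V, α ≠ 0 ∧ g = refl α}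
  essential : ∀ x : V, (∀ α : UnitNormal W, inner ℝ α.vec x = 0) → x = 0

/-- The hyperplane orthogonal to a unit normal. -/
def UnitNormal.hyperplane {W : Subgroup (V ≃ₗᵢ[ℝ] V)} (α : UnitNormal W) : Submodule ℝ V :=
  (ℝ ∙ α.vec)ᗮ

theorem UnitNormal.mem_hyperplane {W : Subgroup (V ≃ₗᵢ[ℝ] V)} (α : UnitNormal W) (x : V) :
    x ∈ α.hyperplane ↔ inner ℝ α.vec x = 0 :=
  Submodule.mem_orthogonal_singleton_iff_inner_right

/-- The reflection arrangement of `W`, a set of hyperplanes. -/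
def arrangement (W : Subgroup (V ≃ₗᵢ[ℝ] V)) : Set (Submodule ℝ V) :=
  Set.range (UnitNormal.hyperplane (W := W))

/-- A flat is an intersection of a set of hyperplanes of the arrangement (the empty intersection
is `V`). -/
@[ext]
structure Flat (W : Subgroup (V ≃ₗᵢ[ℝ] V)) where
  space : Submodule ℝ V
  exists_eq_sInf : ∃ B : Set (Submodule ℝ V), B ⊆ arrangement W ∧ space = sInf B

/-! ### Finiteness -/

theorem refl_apply {β : V} (hβ : ‖β‖ = 1) (x : V) :
    refl β x = x - (2 * inner ℝ β x) • β := by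
  unfold refl
  rw [Submodule.reflection_orthogonal_apply, Submodule.reflection_singleton_apply, hβ]
  simp only [RCLike.ofReal_real_eq_id, id, one_pow, div_one, neg_sub, two_smul, two_mul, add_smul]

instance (W : Subgroup (V ≃ₗᵢ[ℝ] V)) [Finite W] : Finite (UnitNormal W) := by
  have key : ∀ α β : UnitNormal W, refl α.vec = refl β.vec → α.vec = β.vec ∨ α.vec = -β.vec := by
    intro α β h1
    have h2 : refl β.vec α.vec = -α.vec := by
      rw [← h1]; exact Submodule.reflection_orthogonalComplement_singleton_eq_neg _
    rw [refl_apply β.norm_eq] at h2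
    have h3 : α.vec = (inner ℝ β.vec α.vec : ℝ) • β.vec := by
      have : (2 : ℝ) • α.vec = (2 : ℝ) • ((inner ℝ β.vec α.vec : ℝ) • β.vec) := by
        rw [smul_smul, two_smul]
        have h4 := sub_eq_iff_eq_add.mp h2
        nth_rewrite 1 [h4]
        abel
      exact smul_right_injective V (two_ne_zero) this
    have h5 : |(inner ℝ β.vec α.vec : ℝ)| = 1 := by
      have := congrArg norm h3
      rw [norm_smul, α.norm_eq, β.norm_eq, mul_one] at this
      exact this.symm
    rcases eq_or_eq_neg_of_abs_eq h5 with h | h <;> rw [h] at h3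
    · left; simpa using h3
    · right; simpa using h3
  have hfin : (Set.univ : Set (UnitNormal W)).Finite := by
    refine Set.Finite.of_finite_fibers (fun α : UnitNormal W => (⟨refl α.vec, α.refl_mem⟩ : W))
      (Set.toFinite _) ?_
    rintro _ ⟨β, -, rfl⟩
    have hinj : Function.Injective (UnitNormal.vec (W := W)) := fun a b h => UnitNormal.ext h
    refine (((Set.finite_singleton (-β.vec)).insert β.vec).preimage hinj.injOn).subset ?_
    rintro α ⟨-, hα⟩
    exact key α β (congrArg Subtype.val hα)
  exact Set.finite_univ_iff.1 hfin

instance (W : Subgroup (V ≃ₗᵢ[ℝ] V)) [Finite W] : Finite (Flat W) := by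
  have hA : (arrangement W).Finite := Set.finite_range _
  have : Finite {B : Set (Submodule ℝ V) // B ⊆ arrangement W} := hA.finite_subsets.to_subtype
  refine Finite.of_surjective
    (fun B : {B : Set (Submodule ℝ V) // B ⊆ arrangement W} =>
      (⟨sInf B.1, B.1, B.2, rfl⟩ : Flat W)) ?_
  rintro ⟨X, B, hB, rfl⟩
  exact ⟨⟨B, hB⟩, rfl⟩

/-! ### Faces and the Tits product -/

/-- A face of the arrangement, encoded by its sign vector `ε`: for each unit normal `α`, the value
`ε α` is the sign of `⟪α, x⟫` at the points `x` of the relative interior of the face. Only sign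
vectors of points of `V` occur. (The signs at `α` and `-α` are automatically opposite.) -/
@[ext]
structure Face (W : Subgroup (V ≃ₗᵢ[ℝ] V)) where
  sign : UnitNormal W → SignType
  realizable : ∃ x : V, ∀ α, sign α = SignType.sign (inner ℝ α.vec x : ℝ)

variable {W : Subgroup (V ≃ₗᵢ[ℝ] V)}

namespace Face

/-- The face as a closed subset of `V`: the intersection of the closed half-spaces (where the sign
is `±1`) and hyperplanes (where the sign is `0`) prescribed by the sign vector. -/
def carrier (F : Face W) : Set V :=
  {x | ∀ α, SignType.sign (inner ℝ α.vec x : ℝ) = 0 ∨ SignType.sign (inner ℝ α.vec x : ℝ) = F.sign α}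

/-- The support of a face: the intersection of the hyperplanes that contain it. -/
def support (F : Face W) : Submodule ℝ V :=
  sInf {H | ∃ α : UnitNormal W, F.sign α = 0 ∧ H = α.hyperplane}

/-- The dimension of a face. -/
def dim (F : Face W) : ℕ := finrank ℝ F.support

/-- A chamber is a face of maximal dimension, i.e. with support `V`. -/
def IsChamber (F : Face W) : Prop := F.support = ⊤

/-- The support of a face is the smallest flat that contains the face. -/
theorem support_isLeast (F : Face W) :
    IsLeast {X : Submodule ℝ V | (∃ B : Set (Submodule ℝ V), B ⊆ arrangement W ∧ X = sInf B) ∧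
      F.carrier ⊆ X} F.support := by
  refine ⟨⟨⟨_, ?_, rfl⟩, ?_⟩, ?_⟩
  · rintro H ⟨α, -, rfl⟩
    exact ⟨α, rfl⟩
  · intro x hx
    refine (Submodule.mem_sInf).2 ?_
    rintro H ⟨α, hα, rfl⟩
    rw [UnitNormal.mem_hyperplane]
    rcases hx α with h | h
    · exact sign_eq_zero_iff.1 h
    · rw [hα] at h; exact sign_eq_zero_iff.1 h
  · rintro X ⟨⟨B, hB, rfl⟩, hF⟩
    refine le_sInf fun H hH => sInf_le ?_
    obtain ⟨α, rfl⟩ := hB hH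
    obtain ⟨x, hx⟩ := F.realizable
    have hxF : x ∈ F.carrier := fun β => Or.inr (hx β).symm
    have := (Submodule.mem_sInf).1 (hF hxF) _ hH
    rw [UnitNormal.mem_hyperplane] at this
    exact ⟨α, by rw [hx, this, sign_zero], rfl⟩

instance [Finite W] : Finite (Face W) :=
  Finite.of_injective (Face.sign (W := W)) fun _ _ h => Face.ext h

/-- The Tits product of sign vectors: the sign of `F`, unless it is `0`, and then that of `G`. -/
def titsSign (F G : UnitNormal W → SignType) : UnitNormal W → SignType :=
  fun α => if F α = 0 then G α else F α

theorem sign_add_small (a b t : ℝ) (ht : 0 < t) (h : a ≠ 0 → t * |b| < |a|) :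
    SignType.sign (a + t * b) =
      if SignType.sign a = 0 then SignType.sign b else SignType.sign a := by
  by_cases ha : a = 0
  · simp [ha, sign_mul, ht]
  · have h1 := h ha
    rw [if_neg (by simpa using ha)]
    have h2 : |t * b| < |a| := by rwa [abs_mul, abs_of_pos ht]
    rcases lt_or_gt_of_ne ha with ha | ha
    · rw [abs_of_neg ha] at h2
      rw [sign_neg ha, sign_neg (by linarith [le_abs_self (t * b)])]
    · rw [abs_of_pos ha] at h2
      rw [sign_pos ha, sign_pos (by linarith [neg_abs_le (t * b)])]

/-- Moving a small distance from a point `x` towards `y`: the Tits product of two realizable sign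
vectors is realizable. -/
theorem titsSign_realizable [Finite W] (F G : Face W) :
    ∃ x : V, ∀ α, titsSign F.sign G.sign α = SignType.sign (inner ℝ α.vec x : ℝ) := by
  obtain ⟨x, hx⟩ := F.realizable
  obtain ⟨y, hy⟩ := G.realizable
  have key : ∀ α : UnitNormal W, ∀ᶠ t : ℝ in nhdsWithin 0 (Set.Ioi 0),
      (inner ℝ α.vec x : ℝ) ≠ 0 → t * |(inner ℝ α.vec y : ℝ)| < |(inner ℝ α.vec x : ℝ)| := by
    intro α
    by_cases h0 : (inner ℝ α.vec x : ℝ) = 0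
    · exact Filter.Eventually.of_forall fun t h => absurd h0 h
    · have hc : Filter.Tendsto (fun t : ℝ => t * |(inner ℝ α.vec y : ℝ)|)
          (nhdsWithin 0 (Set.Ioi 0)) (nhds (0 * |(inner ℝ α.vec y : ℝ)|)) :=
        ((continuous_id.mul continuous_const).tendsto 0).mono_left nhdsWithin_le_nhds
      rw [zero_mul] at hc
      exact (hc.eventually (gt_mem_nhds (abs_pos.2 h0))).mono fun t h _ => h
  obtain ⟨t, ht, ht0⟩ := ((Filter.eventually_all.2 key).and self_mem_nhdsWithin).exists
  refine ⟨x + t • y, fun α => ?_⟩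
  rw [inner_add_right, real_inner_smul_right, sign_add_small _ _ t ht0 (ht α)]
  simp only [titsSign, hx, hy]

/-- The semigroup of faces under the Tits product; the unit is the face `{0}` of an essential
arrangement, whose signs are all `0`. -/
instance [Finite W] : Monoid (Face W) where
  mul F G := ⟨titsSign F.sign G.sign, titsSign_realizable F G⟩
  one := ⟨fun _ => 0, 0, fun α => by simp⟩
  mul_assoc F G H := by
    apply Face.ext
    funext α
    change (if (if F.sign α = 0 then G.sign α else F.sign α) = 0 then H.sign α
      else (if F.sign α = 0 then G.sign α else F.sign α)) =
      (if F.sign α = 0 then (if G.sign α = 0 then H.sign α else G.sign α) else F.sign α)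
    by_cases h : F.sign α = 0 <;> simp [h]
  one_mul F := by
    apply Face.ext
    funext α
    change (if (0 : SignType) = 0 then F.sign α else 0) = F.sign α
    simp
  mul_one F := by
    apply Face.ext
    funext α
    change (if F.sign α = 0 then (0 : SignType) else F.sign α) = F.sign α
    split_ifs with h
    · exact h.symm
    · rfl

end Face

/-! ### The action of `W` -/

theorem refl_map (g : V ≃ₗᵢ[ℝ] V) {α : V} (hα : ‖α‖ = 1) : refl (g α) = g * refl α * g⁻¹ := by
  ext x
  have h : refl (g α) x = x - (2 * inner ℝ (g α) x) • g α :=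
    refl_apply (by rw [g.norm_map, hα]) x
  rw [h]
  change _ = g (refl α (g.symm x))
  rw [refl_apply hα, map_sub, map_smul, g.apply_symm_apply]
  congr 3
  conv_lhs => rw [← g.apply_symm_apply x]
  rw [g.inner_map_map]

instance : MulAction W (UnitNormal W) where
  smul w α := ⟨w.1 α.vec, by rw [LinearIsometryEquiv.norm_map, α.norm_eq], by
    rw [refl_map _ α.norm_eq]; exact W.mul_mem (W.mul_mem w.2 α.refl_mem) (W.inv_mem w.2)⟩
  one_smul _ := rfl
  mul_smul _ _ _ := rfl

/-- `W` permutes the faces: the point `x` has sign vector `F` iff `w x` has sign vector `w • F`. -/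
instance : MulAction W (Face W) where
  smul w F := ⟨fun α => F.sign (w⁻¹ • α), by
    obtain ⟨x, hx⟩ := F.realizable
    refine ⟨w.1 x, fun α => ?_⟩
    rw [hx]
    congr 1
    change inner ℝ (w.1.symm α.vec) x = _
    rw [← w.1.inner_map_map, w.1.apply_symm_apply]⟩
  one_smul F := Face.ext (funext fun α => by
    change F.sign ((1 : W)⁻¹ • α) = F.sign α
    rw [inv_one, one_smul])
  mul_smul v w F := Face.ext (funext fun α => by
    change F.sign ((v * w)⁻¹ • α) = F.sign (w⁻¹ • v⁻¹ • α)
    rw [mul_inv_rev, mul_smul])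

/-! ### The uniform section and the Eulerian idempotents -/

section Tits

variable [Finite W]

/-- The uniform section of the support map: the average of the faces with support `X`. -/
def uniformSection (X : Flat W) : MonoidAlgebra ℝ (Face W) :=
  ((Nat.card {F : Face W // F.support = X.space} : ℝ)⁻¹) •
    ∑ F ∈ (Set.toFinite {F : Face W | F.support = X.space}).toFinset, MonoidAlgebra.single F 1

/-- The flat idempotents of the uniform section, by the recursion
`e_X = u_X - ∑_{Y < X} u_X e_Y` in the lattice of flats ordered by reverse inclusion; thus `Y` runs
over the flats that properly contain `X` as subspaces. -/
def flatIdempotent [FiniteDimensional ℝ V] (X : Flat W) : MonoidAlgebra ℝ (Face W) :=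
  uniformSection X - ∑ Y ∈ (Set.toFinite {Y : Flat W | X.space < Y.space}).toFinset.attach,
    uniformSection X * flatIdempotent Y.1
termination_by finrank ℝ V - finrank ℝ X.space
decreasing_by
  have h : X.space < Y.1.space :=
    (Set.Finite.mem_toFinset (Set.toFinite {Y : Flat W | X.space < Y.space})).1 Y.2
  have h1 := Submodule.finrank_lt_finrank_of_lt h
  have h2 := Submodule.finrank_le Y.1.space
  omega

/-- The recursion, without the bookkeeping of the termination argument. -/
theorem flatIdempotent_eq [FiniteDimensional ℝ V] (X : Flat W) :
    flatIdempotent X = uniformSection X -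
      ∑ Y ∈ (Set.toFinite {Y : Flat W | X.space < Y.space}).toFinset,
        uniformSection X * flatIdempotent Y := by
  rw [flatIdempotent]
  congr 1
  exact Finset.sum_attach _ (fun Y => uniformSection X * flatIdempotent Y)

variable (W) in
/-- The Eulerian idempotent `e_k`: the sum of the flat idempotents over the flats of dimension
`k`. -/
def eulerianIdempotent [FiniteDimensional ℝ V] (k : ℕ) : MonoidAlgebra ℝ (Face W) :=
  ∑ X ∈ (Set.toFinite {X : Flat W | finrank ℝ X.space = k}).toFinset, flatIdempotent X

end Tits

/-! ### Simple reflections, descents and the elements `Y_T` -/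

/-- A unit normal whose hyperplane is a wall of `C`, i.e. is the support of a face contained
in `C`. -/
def IsWall (C : Face W) (α : UnitNormal W) : Prop :=
  ∃ F : Face W, F.carrier ⊆ C.carrier ∧ F.support = α.hyperplane

/-- The Coxeter generators `S` determined by a chamber `C`: the reflections in its walls. -/
def simpleReflections (C : Face W) : Set W :=
  {s | ∃ α : UnitNormal W, IsWall C α ∧ s.1 = refl α.vec}

/-- The length of `w` as a word in the Coxeter generators. -/
def length (C : Face W) (w : W) : ℕ :=
  sInf {n | ∃ l : List W, (∀ s ∈ l, s ∈ simpleReflections C) ∧ l.prod = w ∧ l.length = n}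

/-- The (right) descent set of `w`. -/
def descentSet (C : Face W) (w : W) : Set W :=
  {s | s ∈ simpleReflections C ∧ length C (w * s) < length C w}

/-- The element `Y_T = ∑_{Des(w) ⊆ T} w` of the descent algebra. -/
def elementY [Finite W] (C : Face W) (T : Set W) : MonoidAlgebra ℝ W :=
  ∑ w ∈ (Set.toFinite {w : W | descentSet C w ⊆ T}).toFinset, MonoidAlgebra.single w 1

/-- The Barr element `∑_{s ∈ S} Y_{{s}}`. -/
def barrElement [Finite W] (C : Face W) : MonoidAlgebra ℝ W :=
  ∑ s ∈ (Set.toFinite (simpleReflections C)).toFinset, elementY C {s}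

/-! ### Bidigare's map -/

/-- The `W`-invariants of the Tits algebra: coefficients are constant on the `W`-orbits of
faces. -/
def invariants (W : Subgroup (V ≃ₗᵢ[ℝ] V)) [Finite W] :
    Submodule ℝ (MonoidAlgebra ℝ (Face W)) where
  carrier := {u | ∀ (w : W) (F : Face W), u.coeff (w • F) = u.coeff F}
  add_mem' hu hv w F := by
    have h1 := hu w F
    have h2 := hv w F
    simp only [MonoidAlgebra.coeff_add, Finsupp.add_apply, h1, h2]
  zero_mem' w F := by simp
  smul_mem' c u hu w F := by
    have h1 := hu w F
    simp only [MonoidAlgebra.coeff_smul, Finsupp.smul_apply, h1]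

/-- The type of a face `F` contained in the fundamental chamber `C`: the set of `s ∈ S` that move
`F`. -/
def faceType (C F : Face W) : Set W := {s | s ∈ simpleReflections C ∧ s • F ≠ F}

/-- Bidigare's map from the `W`-invariants of the Tits algebra to the group algebra. Each orbit of
faces has exactly one member contained in the fundamental chamber `C`; if that member is `F`, the
sum of the orbit is sent to `Y_T`, where `T` is the type of `F`. So an invariant `u` with
coefficients `u_F` is sent to the sum of `u_F Y_{T(F)}` over the faces `F` contained in `C`. -/
def bidigare [Finite W] (C : Face W) : invariants W →ₗ[ℝ] MonoidAlgebra ℝ W where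
  toFun u := ∑ F ∈ (Set.toFinite {F : Face W | F.carrier ⊆ C.carrier}).toFinset,
    u.1.coeff F • elementY C (faceType C F)
  map_add' u v := by
    simp only [Submodule.coe_add, MonoidAlgebra.coeff_add, Finsupp.add_apply, add_smul,
      Finset.sum_add_distrib]
  map_smul' c u := by
    simp only [Submodule.coe_smul, MonoidAlgebra.coeff_smul, Finsupp.smul_apply, smul_eq_mul,
      mul_smul, Finset.smul_sum, RingHom.id_apply]

/-! ### Ray counts and the projectors -/

/-- The number of one-dimensional faces contained in the flat `X`, i.e. of the one-dimensional
faces of the restriction of the arrangement to `X`. -/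
def rayCount (X : Flat W) : ℕ := Nat.card {F : Face W // F.dim = 1 ∧ F.carrier ⊆ X.space}

variable (W) in
/-- `σ_k`: the (smallest) number of one-dimensional faces in a flat of dimension `k`. -/
def sigma (k : ℕ) : ℕ := sInf {n | ∃ X : Flat W, finrank ℝ X.space = k ∧ rayCount X = n}

/-- The Lagrange interpolation element
`s^(k) = ∏_{j ≠ k} (s - σ_j) / (σ_k - σ_j)`, with `0 ≤ j ≤ r = dim V`, in the Barr element `s`. -/
def barrProjector [Finite W] (C : Face W) (k : ℕ) : MonoidAlgebra ℝ W :=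
  Polynomial.aeval (barrElement C)
    (Lagrange.basis (Finset.range (finrank ℝ V + 1)) (fun j => (sigma W j : ℝ)) k)

/-! ### Coincidental type -/

/-- The Coxeter system `(W, S)`, with `S` determined by the chamber `C`, has Coxeter matrix `M`. -/
def HasCoxeterMatrix (C : Face W) {B : Type*} (M : CoxeterMatrix B) : Prop :=
  ∃ e : B ≃ simpleReflections C, ∀ i j, orderOf ((e i : W) * (e j : W)) = M i j

/-- `W` is of coincidental type: `A_n` (`n ≥ 1`), `B_n` (`n ≥ 2`), `H_3` or `I_2(m)` (`m ≥ 3`).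
Mathlib's `CoxeterMatrix.I m` is the matrix of `I_2(m + 2)`. -/
def IsCoincidental (W : Subgroup (V ≃ₗᵢ[ℝ] V)) : Prop :=
  ∃ C : Face W, C.IsChamber ∧
    ((∃ n, 1 ≤ n ∧ HasCoxeterMatrix C (CoxeterMatrix.A n)) ∨
      (∃ n, 2 ≤ n ∧ HasCoxeterMatrix C (CoxeterMatrix.B n)) ∨
      HasCoxeterMatrix C CoxeterMatrix.H₃ ∨
      (∃ m, 3 ≤ m ∧ HasCoxeterMatrix C (CoxeterMatrix.I (m - 2))))

end ReflArr

end

set_option linter.unusedSectionVars false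

noncomputable section

namespace ReflArr

open Module

variable {V : Type*} [NormedAddCommGroup V] [InnerProductSpace ℝ V]
variable {W : Subgroup (V ≃ₗᵢ[ℝ] V)}

/-! ### Unit normals and sign vectors -/

/-! The theorem comes down to one computation in the Tits algebra. Let ρ be the sum of all
one-dimensional faces (`raySum`), e_X the flat idempotents and u_X the uniform section. The key
identity is ρ e_X = σ_{dim X} e_X for every flat X. Since the e_X sum to 1 (`sum_flatIdempotent`),
every polynomial P satisfies P(ρ) = ∑ P(σ_{dim X}) e_X. As the σ_k are distinct, the Lagrange basis
polynomial at σ_k singles out the flats of dimension k, so its value at ρ is the Eulerian idempotent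
(`HasUniformRays.aeval_raySum_basis`). This also gives invariance, because ρ is invariant.

The passage to the group algebra rests on W acting simply transitively on chambers. Bidigare's φ(u)
is the unique element with φ(u)·C = uC (`chamberMap_bidigare`), and u(a·C) = (a φ(u))·C for
invariant u. Hence φ reverses products and commutes with polynomials in one element
(`bidigare_aeval`). It sends ρ to the Barr element, since the rays of C are the faces of type {s}.
The eigenspace statement then follows because (x - σ_k) L_k vanishes at the Barr element and
L_k(σ_k) = 1.

For the key identity, a face not contained in X annihilates e_X
(`single_mul_flatIdempotent_eq_zero`), and e_X is a right multiple of u_X. So it suffices that the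
rays inside X multiply u_X by a scalar. This holds when all faces G with support X have equally many
factorizations G = F K with F a ray in X and K of support X (`rayFactorizations`); double counting
shows that the common number is the number of rays in X.

Coincidental type enters only in `HasUniformRays`: the number of factorizations depends on dim G
alone. Up to W, G is the face of a chamber given by a set I of simple normals. In types A and B the
normals are multiples of e_i - e_j, or of e_i ± e_j and e_i, and an order isomorphism I ≃ J
transports coordinates so that one restricted arrangement goes to the other and the face of I to the
face of J (`isTransport_of_tail`). In rank at most three the only case with content is dimension two
in rank three: a chamber of a plane arrangement has as many factorizations as the plane has chambers
(`rayFactorizations_face_pair`), and in H_3 all planes of the arrangement are conjugate. -/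

theorem refl_neg (v : V) : refl (-v) = refl v := by
  unfold refl
  congr 2
  rw [← neg_one_smul ℝ v, Submodule.span_singleton_smul_eq (isUnit_one.neg)]

namespace UnitNormal

instance : Neg (UnitNormal W) :=
  ⟨fun α => ⟨-α.vec, by rw [norm_neg, α.norm_eq], by rw [refl_neg]; exact α.refl_mem⟩⟩

@[simp] theorem neg_vec (α : UnitNormal W) : (-α).vec = -α.vec := rfl

@[simp] theorem smul_vec (w : W) (α : UnitNormal W) : (w • α).vec = w.1 α.vec := rfl

theorem neg_neg' (α : UnitNormal W) : -(-α) = α := UnitNormal.ext (neg_neg _)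

theorem smul_neg' (w : W) (α : UnitNormal W) : w • (-α) = -(w • α) :=
  UnitNormal.ext (map_neg w.1 _)

theorem inner_self (α : UnitNormal W) : inner ℝ α.vec α.vec = (1 : ℝ) := by
  rw [real_inner_self_eq_norm_sq, α.norm_eq, one_pow]

theorem vec_ne_zero (α : UnitNormal W) : α.vec ≠ 0 := by
  intro h
  have := α.norm_eq
  rw [h, norm_zero] at this
  exact zero_ne_one this

/-- The reflection attached to a unit normal, as an element of the group. -/
def s (α : UnitNormal W) : W := ⟨refl α.vec, α.refl_mem⟩

theorem s_apply (α : UnitNormal W) (x : V) :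
    α.s.1 x = x - (2 * inner ℝ α.vec x) • α.vec := refl_apply α.norm_eq x

theorem s_smul_self (α : UnitNormal W) : α.s • α = -α := by
  apply UnitNormal.ext
  rw [smul_vec, s_apply, α.inner_self, neg_vec, mul_one, two_smul]
  abel

theorem s_mul_self (α : UnitNormal W) : α.s * α.s = 1 := by
  apply Subtype.ext
  apply LinearIsometryEquiv.ext
  intro x
  exact Submodule.reflection_reflection (ℝ ∙ α.vec)ᗮ x

theorem s_inv (α : UnitNormal W) : α.s⁻¹ = α.s :=
  inv_eq_of_mul_eq_one_right α.s_mul_self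

theorem s_neg (α : UnitNormal W) : (-α).s = α.s := Subtype.ext (refl_neg _)

theorem s_smul (w : W) (α : UnitNormal W) : (w • α).s = w * α.s * w⁻¹ :=
  Subtype.ext (refl_map w.1 α.norm_eq)

/-- Two unit normals with the same reflection are equal up to sign. -/
theorem eq_or_eq_neg_of_s_eq {α β : UnitNormal W} (h : α.s = β.s) : α = β ∨ α = -β := by
  have h1 : α.s • α = β.s • α := by rw [h]
  rw [s_smul_self] at h1
  have h2 := congrArg UnitNormal.vec h1
  rw [smul_vec, s_apply, neg_vec] at h2
  have h3 : α.vec = (inner ℝ β.vec α.vec : ℝ) • β.vec := by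
    have : (2 : ℝ) • α.vec = (2 : ℝ) • ((inner ℝ β.vec α.vec : ℝ) • β.vec) := by
      rw [smul_smul, two_smul]
      have h4 := sub_eq_iff_eq_add.mp h2.symm
      nth_rewrite 1 [h4]
      abel
    exact smul_right_injective V (two_ne_zero) this
  have h5 : |(inner ℝ β.vec α.vec : ℝ)| = 1 := by
    have := congrArg norm h3
    rw [norm_smul, α.norm_eq, β.norm_eq, mul_one] at this
    exact this.symm
  rcases eq_or_eq_neg_of_abs_eq h5 with h | h <;> rw [h] at h3
  · left; exact UnitNormal.ext (by simpa using h3)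
  · right; exact UnitNormal.ext (by simpa using h3)

theorem inner_smul_left (w : W) (α : UnitNormal W) (x : V) :
    inner ℝ (w • α).vec x = (inner ℝ α.vec (w⁻¹.1 x) : ℝ) := by
  change _ = inner ℝ α.vec (w.1.symm x)
  rw [← w.1.inner_map_map α.vec, w.1.apply_symm_apply, smul_vec]

theorem eq_of_vec_eq_smul {α β : UnitNormal W} {c : ℝ} (hc : 0 ≤ c)
    (h : α.vec = c • β.vec) : α = β := by
  have := congrArg norm h
  rw [norm_smul, α.norm_eq, β.norm_eq, mul_one, Real.norm_eq_abs, abs_of_nonneg hc] at this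
  rw [← this, one_smul] at h
  exact UnitNormal.ext h

end UnitNormal

/-! ### Faces as sign vectors: action, supports and Tits product. -/

namespace Face

/-- The face whose relative interior contains the point `x`. -/
def ofPoint (W : Subgroup (V ≃ₗᵢ[ℝ] V)) (x : V) : Face W :=
  ⟨fun α => SignType.sign (inner ℝ α.vec x : ℝ), x, fun _ => rfl⟩

theorem ofPoint_sign (x : V) (α : UnitNormal W) :
    (ofPoint W x).sign α = SignType.sign (inner ℝ α.vec x : ℝ) := rfl

theorem exists_eq_ofPoint (F : Face W) : ∃ x, F = ofPoint W x := by
  obtain ⟨x, hx⟩ := F.realizable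
  exact ⟨x, Face.ext (funext hx)⟩

theorem sign_neg (F : Face W) (α : UnitNormal W) : F.sign (-α) = -F.sign α := by
  obtain ⟨x, rfl⟩ := F.exists_eq_ofPoint
  rw [ofPoint_sign, ofPoint_sign, UnitNormal.neg_vec, inner_neg_left, Left.sign_neg]

theorem smul_sign (w : W) (F : Face W) (α : UnitNormal W) :
    (w • F).sign α = F.sign (w⁻¹ • α) := rfl

theorem smul_sign_smul (w : W) (F : Face W) (α : UnitNormal W) :
    (w • F).sign (w • α) = F.sign α := by
  rw [smul_sign, inv_smul_smul]

theorem smul_ofPoint (w : W) (x : V) : w • ofPoint W x = ofPoint W (w.1 x) := by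
  apply Face.ext
  funext α
  rw [smul_sign, ofPoint_sign, ofPoint_sign, UnitNormal.inner_smul_left, inv_inv]

theorem mem_support {F : Face W} {x : V} :
    x ∈ F.support ↔ ∀ α, F.sign α = 0 → inner ℝ α.vec x = (0 : ℝ) := by
  unfold support
  rw [Submodule.mem_sInf]
  constructor
  · intro h α hα
    exact (α.mem_hyperplane x).1 (h _ ⟨α, hα, rfl⟩)
  · rintro h _ ⟨α, hα, rfl⟩
    exact (α.mem_hyperplane x).2 (h α hα)

theorem mem_support_ofPoint (x : V) : x ∈ (ofPoint W x).support :=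
  mem_support.2 fun _ h => sign_eq_zero_iff.1 h

/-- A relative interior point of `F` lies in `F.support` and on exactly those hyperplanes where the
sign of `F` vanishes, so it detects every hyperplane that contains the support. -/
theorem support_le_iff_sign {F G : Face W} :
    F.support ≤ G.support ↔ ∀ α, G.sign α = 0 → F.sign α = 0 := by
  constructor
  · intro h α hα
    obtain ⟨x, rfl⟩ := F.exists_eq_ofPoint
    exact sign_eq_zero_iff.2 (mem_support.1 (h (mem_support_ofPoint x)) α hα)
  · intro h x hx
    exact mem_support.2 fun α hα => mem_support.1 hx α (h α hα)

theorem support_eq_iff_sign {F G : Face W} :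
    F.support = G.support ↔ ∀ α, F.sign α = 0 ↔ G.sign α = 0 := by
  rw [le_antisymm_iff, support_le_iff_sign, support_le_iff_sign]
  exact ⟨fun h α => ⟨h.2 α, h.1 α⟩, fun h => ⟨fun α => (h α).2, fun α => (h α).1⟩⟩

theorem isChamber_iff {F : Face W} : F.IsChamber ↔ ∀ α, F.sign α ≠ 0 := by
  constructor
  · intro h α hα
    have h1 : α.vec ∈ F.support := by rw [h]; trivial
    have := mem_support.1 h1 α hα
    rw [α.inner_self] at this
    exact one_ne_zero this
  · intro h
    refine eq_top_iff.2 fun x _ => mem_support.2 fun α hα => absurd hα (h α)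

/-- The flat spanned by a face. -/
def flat (F : Face W) : Flat W := ⟨F.support, F.support_isLeast.1.1⟩

theorem flat_space (F : Face W) : F.flat.space = F.support := rfl

theorem carrier_subset_flat_iff {F : Face W} {X : Flat W} :
    F.carrier ⊆ X.space ↔ F.support ≤ X.space := by
  constructor
  · intro h
    exact F.support_isLeast.2 ⟨X.exists_eq_sInf, h⟩
  · intro h
    exact fun x hx => h (F.support_isLeast.1.2 hx)

theorem map_support (w : W) (F : Face W) :
    (w • F).support = F.support.map (w.1.toLinearEquiv : V →ₗ[ℝ] V) := by
  ext x
  rw [Submodule.mem_map_equiv, mem_support, mem_support]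
  constructor
  · intro h α hα
    have := h (w • α) (by rw [smul_sign_smul, hα])
    rw [UnitNormal.inner_smul_left] at this
    exact this
  · intro h α hα
    have := h (w⁻¹ • α) hα
    rw [UnitNormal.inner_smul_left, inv_inv] at this
    rw [← this]
    congr 1
    exact (w.1.apply_symm_apply x).symm

theorem dim_smul (w : W) (F : Face W) : (w • F).dim = F.dim := by
  unfold dim
  rw [map_support]
  exact LinearEquiv.finrank_map_eq _ _

theorem smul_support_le_iff (w : W) {F G : Face W} :
    (w • F).support ≤ (w • G).support ↔ F.support ≤ G.support := by
  rw [map_support, map_support]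
  exact Submodule.map_le_map_iff_of_injective w.1.injective _ _

theorem smul_support_eq_iff (w : W) {F G : Face W} :
    (w • F).support = (w • G).support ↔ F.support = G.support := by
  rw [le_antisymm_iff, le_antisymm_iff, smul_support_le_iff, smul_support_le_iff]

section Finite

variable [Finite W]

theorem mul_sign (F G : Face W) (α : UnitNormal W) :
    (F * G).sign α = if F.sign α = 0 then G.sign α else F.sign α := rfl

theorem smul_mul' (w : W) (F G : Face W) : w • (F * G) = (w • F) * (w • G) := rfl

theorem mul_eq_left_iff {F G : Face W} : F * G = F ↔ G.support ≤ F.support := by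
  rw [support_le_iff_sign]
  constructor
  · intro h α hα
    have := congrArg (fun K : Face W => K.sign α) h
    simp only [mul_sign, hα, if_true] at this
    exact this
  · intro h
    apply Face.ext
    funext α
    rw [mul_sign]
    split_ifs with h1
    · rw [h α h1, h1]
    · rfl

theorem mul_eq_right_iff {F G : Face W} :
    F * G = G ↔ ∀ α, F.sign α ≠ 0 → F.sign α = G.sign α := by
  constructor
  · intro h α hα
    have := congrArg (fun K : Face W => K.sign α) h
    simp only [mul_sign, hα, if_false] at this
    exact this
  · intro h
    apply Face.ext
    funext α
    rw [mul_sign]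
    split_ifs with h1
    · rfl
    · exact h α h1

/-- Replaces the geometric face relation by an equation in the semigroup, the form in which
"contained in the chamber" is used from here on. -/
theorem carrier_subset_iff {F G : Face W} : F.carrier ⊆ G.carrier ↔ F * G = G := by
  rw [mul_eq_right_iff]
  constructor
  · intro h α hα
    obtain ⟨x, rfl⟩ := F.exists_eq_ofPoint
    have : x ∈ G.carrier := h fun β => Or.inr rfl
    rcases this α with h1 | h1
    · exact absurd h1 hα
    · exact h1
  · intro h x hx α
    by_cases h0 : F.sign α = 0
    · rcases hx α with h1 | h1
      · exact Or.inl h1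
      · exact Or.inl (h1.trans h0)
    · rcases hx α with h1 | h1
      · exact Or.inl h1
      · exact Or.inr (h1.trans (h α h0))

theorem left_support_le_mul (F G : Face W) : F.support ≤ (F * G).support := by
  rw [support_le_iff_sign]
  intro α hα
  rw [mul_sign] at hα
  split_ifs at hα with h
  · exact h
  · exact hα

theorem right_support_le_mul (F G : Face W) : G.support ≤ (F * G).support := by
  rw [support_le_iff_sign]
  intro α hα
  rw [mul_sign] at hα
  split_ifs at hα with h
  · exact hα
  · exact absurd hα h

theorem mul_support_le {F G H : Face W} (hF : F.support ≤ H.support) (hG : G.support ≤ H.support) :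
    (F * G).support ≤ H.support := by
  rw [support_le_iff_sign] at *
  intro α hα
  rw [mul_sign, hF α hα, if_pos rfl, hG α hα]

end Finite

end Face

/-- Every flat is the support of some face: a point of the flat that avoids all hyperplanes not
containing the flat. -/
theorem Flat.exists_face [Finite W] (X : Flat W) : ∃ F : Face W, F.support = X.space := by
  have h : (⊤ : Submodule ℝ X.space) ∉
      Set.range (fun α : {α : UnitNormal W // ¬ X.space ≤ α.hyperplane} =>
        α.1.hyperplane.comap X.space.subtype) := by
    rintro ⟨α, hα⟩
    apply α.2
    intro x hx
    have : (⟨x, hx⟩ : X.space) ∈ (⊤ : Submodule ℝ X.space) := trivial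
    rw [← hα] at this
    exact this
  have hfin : (Set.range (fun α : {α : UnitNormal W // ¬ X.space ≤ α.hyperplane} =>
        α.1.hyperplane.comap X.space.subtype)).Finite := Set.finite_range _
  -- A real vector space is not a finite union of proper subspaces.
  have h2 : ⋃ p ∈ hfin.toFinset, (p : Set X.space) ≠ Set.univ :=
    Subspace.biUnion_ne_univ_of_top_notMem (by simpa only [Set.Finite.mem_toFinset] using h)
  obtain ⟨x, hx⟩ := (Set.ne_univ_iff_exists_notMem _).1 h2
  have hx' : ∀ α : UnitNormal W, inner ℝ α.vec x.1 = (0 : ℝ) → X.space ≤ α.hyperplane := by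
    intro α h0
    by_contra hc
    apply hx
    simp only [Set.mem_iUnion]
    exact ⟨_, hfin.mem_toFinset.2 ⟨⟨α, hc⟩, rfl⟩, (α.mem_hyperplane _).2 h0⟩
  refine ⟨Face.ofPoint W x.1, le_antisymm ?_ ?_⟩
  · obtain ⟨B, hB, hX⟩ := X.exists_eq_sInf
    refine le_of_le_of_eq (le_sInf fun H hH => ?_) hX.symm
    obtain ⟨α, rfl⟩ := hB hH
    refine sInf_le ⟨α, ?_, rfl⟩
    have h3 : x.1 ∈ sInf B := hX ▸ x.2
    exact sign_eq_zero_iff.2 ((α.mem_hyperplane _).1 ((Submodule.mem_sInf.1 h3) _ hH))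
  · intro y hy
    exact Face.mem_support.2 fun α hα =>
      (α.mem_hyperplane y).1 (hx' α (sign_eq_zero_iff.1 hα) hy)

/-! ### Simple systems -/

/-- Vectors in an open half-space with pairwise non-positive inner products are linearly
independent. -/
theorem linearIndependent_of_obtuse {ι : Type*} [Fintype ι] (v : ι → V) (p : V)
    (hp : ∀ i, 0 < (inner ℝ (v i) p : ℝ)) (hv : ∀ i j, i ≠ j → (inner ℝ (v i) (v j) : ℝ) ≤ 0) :
    LinearIndependent ℝ v := by
  rw [Fintype.linearIndependent_iff]
  intro c hc
  have h1 : ∑ i, (c i)⁺ • v i = ∑ i, (c i)⁻ • v i := by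
    rw [← sub_eq_zero, ← Finset.sum_sub_distrib, ← hc]
    refine Finset.sum_congr rfl fun i _ => ?_
    rw [← sub_smul, posPart_sub_negPart]
  -- One factor is rewritten with negative parts. Positive and negative parts have disjoint
  -- supports, so only products of distinct vectors survive, and those are non-positive.
  have h2 : (inner ℝ (∑ i, (c i)⁺ • v i) (∑ i, (c i)⁺ • v i) : ℝ) ≤ 0 := by
    nth_rewrite 2 [h1]
    rw [sum_inner]
    refine Finset.sum_nonpos fun i _ => ?_
    rw [inner_sum]
    refine Finset.sum_nonpos fun j _ => ?_
    rw [real_inner_smul_left, real_inner_smul_right, ← mul_assoc]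
    by_cases hij : i = j
    · subst hij
      rcases le_total 0 (c i) with h | h
      · rw [negPart_of_nonneg h, mul_zero, zero_mul]
      · rw [posPart_of_nonpos h, zero_mul, zero_mul]
    · exact mul_nonpos_of_nonneg_of_nonpos
        (mul_nonneg (posPart_nonneg _) (negPart_nonneg _)) (hv i j hij)
  have h3 : ∑ i, (c i)⁺ • v i = 0 := by
    rw [← inner_self_eq_zero (𝕜 := ℝ)]
    exact le_antisymm h2 real_inner_self_nonneg
  have key : ∀ d : ι → ℝ, (∀ i, 0 ≤ d i) → ∑ i, d i • v i = 0 → ∀ i, d i = 0 := by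
    intro d hd h0 i
    have h4 : ∑ i, d i * (inner ℝ (v i) p : ℝ) = 0 := by
      have := congrArg (fun x => (inner ℝ x p : ℝ)) h0
      simpa only [sum_inner, real_inner_smul_left, inner_zero_left] using this
    have h5 := (Finset.sum_eq_zero_iff_of_nonneg
      (fun i _ => mul_nonneg (hd i) (hp i).le)).1 h4 i (Finset.mem_univ i)
    exact (mul_eq_zero.1 h5).resolve_right (hp i).ne'
  intro i
  rw [← posPart_sub_negPart (c i), key _ (fun i => posPart_nonneg _) h3 i,
    key _ (fun i => negPart_nonneg _) (h1.symm.trans h3) i, sub_zero]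

/-- A family of unit normals, positive on the chamber `C`, is a simple system if it is linearly
independent, obtuse, and every positive unit normal is a non-negative combination of it. -/
structure IsSimpleSystem (C : Face W) {ι : Type*} [Fintype ι] (α : ι → UnitNormal W) : Prop where
  pos : ∀ i, C.sign (α i) = 1
  inner_nonpos : ∀ i j, i ≠ j → (inner ℝ (α i).vec (α j).vec : ℝ) ≤ 0
  linInd : LinearIndependent ℝ fun i => (α i).vec
  cone : ∀ β, C.sign β = 1 → ∃ c : ι → ℝ, (∀ i, 0 ≤ c i) ∧ β.vec = ∑ i, c i • (α i).vec

theorem IsSimpleSystem.reindex {C : Face W} {ι κ : Type*} [Fintype ι] [Fintype κ]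
    {α : ι → UnitNormal W} (h : IsSimpleSystem C α) (e : κ ≃ ι) :
    IsSimpleSystem C (fun k => α (e k)) where
  pos k := h.pos _
  inner_nonpos i j hij := h.inner_nonpos _ _ fun h => hij (e.injective h)
  linInd := h.linInd.comp e e.injective
  cone β hβ := by
    obtain ⟨c, hc, h1⟩ := h.cone β hβ
    refine ⟨c ∘ e, fun i => hc _, ?_⟩
    rw [h1]
    exact (Equiv.sum_comp e fun i => c i • (α i).vec).symm

theorem Face.sign_eq_one_or {C : Face W} (hC : C.IsChamber) (β : UnitNormal W) :
    C.sign β = 1 ∨ C.sign β = -1 := by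
  have := Face.isChamber_iff.1 hC β
  rcases h : C.sign β with _ | _ | _
  · exact absurd h this
  · exact Or.inr rfl
  · exact Or.inl rfl

theorem Face.sign_eq_one_or_neg {C : Face W} (hC : C.IsChamber) (β : UnitNormal W) :
    C.sign β = 1 ∨ C.sign (-β) = 1 := by
  rcases Face.sign_eq_one_or hC β with h | h
  · exact Or.inl h
  · right; rw [Face.sign_neg, h]; rfl

theorem Face.ofPoint_sign_eq_one {p : V} {β : UnitNormal W} :
    (Face.ofPoint W p).sign β = 1 ↔ (0 : ℝ) < inner ℝ β.vec p := by
  rw [Face.ofPoint_sign, sign_eq_one_iff]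

/-- Take an inclusion-minimal set `T` of positive unit normals whose cone contains all positive unit
normals. Minimality forces pairwise obtuse angles, and obtuse vectors in an open half-space are
independent. -/
theorem exists_isSimpleSystem [Finite W] {C : Face W} (hC : C.IsChamber) :
    ∃ Δ : Finset (UnitNormal W), IsSimpleSystem C (fun γ : Δ => γ.1) := by
  classical
  obtain ⟨p, hp⟩ := C.exists_eq_ofPoint
  have hpos : ∀ β, C.sign β = 1 ↔ (0 : ℝ) < inner ℝ β.vec p := by
    intro β; rw [hp, Face.ofPoint_sign_eq_one]
  cases nonempty_fintype (UnitNormal W)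
  let P : Finset (UnitNormal W) → Prop := fun T =>
    (∀ β ∈ T, C.sign β = 1) ∧ ∀ β, C.sign β = 1 → ∃ c : UnitNormal W → ℝ,
      (∀ γ, 0 ≤ c γ) ∧ β.vec = ∑ γ ∈ T, c γ • γ.vec
  have hne : {T | P T}.Nonempty := by
    refine ⟨Finset.univ.filter fun β => C.sign β = 1, by simp, fun β hβ => ?_⟩
    refine ⟨fun γ => if γ = β then 1 else 0, fun γ => by dsimp only; split_ifs <;> norm_num, ?_⟩
    simp [ite_smul, Finset.sum_ite_eq', hβ]
  obtain ⟨T, hT⟩ := (Set.toFinite {T | P T}).exists_minimal hne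
  obtain ⟨hTpos, hTcone⟩ := hT.prop
  have hpT : ∀ β ∈ T, (0 : ℝ) < inner ℝ β.vec p := fun β hβ => (hpos β).1 (hTpos β hβ)
  -- no element of `T` is a combination of the others
  have hmin : ∀ β ∈ T, ∀ d : UnitNormal W → ℝ, (∀ γ, 0 ≤ d γ) →
      β.vec = ∑ γ ∈ T.erase β, d γ • γ.vec → False := by
    intro β hβ d hd h
    have : P (T.erase β) := by
      refine ⟨fun γ hγ => hTpos γ (Finset.mem_of_mem_erase hγ), fun δ hδ => ?_⟩
      obtain ⟨c, hc, h1⟩ := hTcone δ hδ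
      refine ⟨fun γ => c β * d γ + c γ, fun γ => add_nonneg (mul_nonneg (hc _) (hd _)) (hc _), ?_⟩
      rw [h1, ← Finset.add_sum_erase _ _ hβ, h, Finset.smul_sum, ← Finset.sum_add_distrib]
      refine Finset.sum_congr rfl fun γ _ => ?_
      rw [add_smul, smul_smul]
    exact Finset.notMem_erase β T (hT.le_of_le this (Finset.erase_subset _ _) hβ)
  -- Pairing with the interior point `p` of the chamber gives `0 < t`; dividing by `t` then
  -- contradicts minimality.
  have hcomb : ∀ β ∈ T, ∀ (t : ℝ) (d : UnitNormal W → ℝ), (∀ γ, 0 ≤ d γ) →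
      (∃ δ ∈ T.erase β, 0 < d δ) → t • β.vec = ∑ γ ∈ T.erase β, d γ • γ.vec → False := by
    rintro β hβ t d hd ⟨δ, hδ, hδ0⟩ h2
    have h6 := congrArg (fun x => (inner ℝ x p : ℝ)) h2
    simp only [sum_inner, real_inner_smul_left] at h6
    have h7 : 0 < ∑ γ ∈ T.erase β, d γ * (inner ℝ γ.vec p : ℝ) :=
      Finset.sum_pos' (fun γ hγ => mul_nonneg (hd γ) (hpT γ (Finset.mem_of_mem_erase hγ)).le)
        ⟨δ, hδ, mul_pos hδ0 (hpT δ (Finset.mem_of_mem_erase hδ))⟩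
    have h3 : 0 < t := by
      by_contra h8
      nlinarith [hpT β hβ]
    refine hmin β hβ (fun γ => t⁻¹ * d γ) (fun γ => mul_nonneg (inv_nonneg.2 h3.le) (hd γ)) ?_
    rw [← one_smul ℝ β.vec, ← inv_mul_cancel₀ h3.ne', mul_smul, h2, Finset.smul_sum]
    simp only [smul_smul]
  have hob : ∀ α ∈ T, ∀ β ∈ T, α ≠ β → (inner ℝ α.vec β.vec : ℝ) ≤ 0 := by
    intro α hα β hβ hαβ
    by_contra hlt
    push Not at hlt
    set t : ℝ := 2 * inner ℝ α.vec β.vec with ht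
    have ht0 : 0 < t := by rw [ht]; linarith
    have hs : (α.s • β).vec = β.vec - t • α.vec := α.s_apply β.vec
    -- At an acute angle, either β - tα or tα - β is positive and hence a non-negative combination
    -- of `T`. Moving terms across expresses a multiple of β, respectively of α, through the other
    -- elements.
    rcases Face.sign_eq_one_or_neg hC (α.s • β) with h | h
    · obtain ⟨c, hc, h1⟩ := hTcone _ h
      rw [hs, ← Finset.add_sum_erase _ _ hβ] at h1
      have hαm : α ∈ T.erase β := Finset.mem_erase.2 ⟨hαβ, hα⟩
      -- `(1 - c β) β = t α + ∑ c γ γ`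
      let d : UnitNormal W → ℝ := fun γ => (if γ = α then t else 0) + c γ
      have hd : ∀ γ, 0 ≤ d γ := fun γ =>
        add_nonneg (by split_ifs <;> linarith) (hc γ)
      have h2 : (1 - c β) • β.vec = ∑ γ ∈ T.erase β, d γ • γ.vec := by
        have : ∑ γ ∈ T.erase β, d γ • γ.vec =
            t • α.vec + ∑ γ ∈ T.erase β, c γ • γ.vec := by
          simp only [d, add_smul, Finset.sum_add_distrib, ite_smul, zero_smul]
          rw [Finset.sum_ite_eq', if_pos hαm]
        rw [this, sub_smul, one_smul, sub_eq_iff_eq_add]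
        rw [sub_eq_iff_eq_add] at h1
        refine h1.trans ?_
        abel
      exact hcomb β hβ _ d hd ⟨α, hαm, by simp only [d, if_true]; linarith [hc α]⟩ h2
    · obtain ⟨c, hc, h1⟩ := hTcone _ h
      rw [UnitNormal.neg_vec, hs, ← Finset.add_sum_erase _ _ hα] at h1
      have hβm : β ∈ T.erase α := Finset.mem_erase.2 ⟨hαβ.symm, hβ⟩
      let d : UnitNormal W → ℝ := fun γ => (if γ = β then 1 else 0) + c γ
      have hd : ∀ γ, 0 ≤ d γ := fun γ =>
        add_nonneg (by split_ifs <;> norm_num) (hc γ)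
      have h2 : (t - c α) • α.vec = ∑ γ ∈ T.erase α, d γ • γ.vec := by
        have : ∑ γ ∈ T.erase α, d γ • γ.vec =
            β.vec + ∑ γ ∈ T.erase α, c γ • γ.vec := by
          simp only [d, add_smul, Finset.sum_add_distrib, ite_smul, zero_smul, one_smul]
          rw [Finset.sum_ite_eq', if_pos hβm]
        rw [this, sub_smul, sub_eq_iff_eq_add]
        rw [neg_sub, sub_eq_iff_eq_add] at h1
        refine h1.trans ?_
        abel
      exact hcomb α hα _ d hd ⟨β, hβm, by simp only [d, if_true]; linarith [hc β]⟩ h2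
  have hob' : ∀ i j : T, i ≠ j → (inner ℝ i.1.vec j.1.vec : ℝ) ≤ 0 := fun i j hij =>
    hob i.1 i.2 j.1 j.2 fun h => hij (Subtype.ext h)
  refine ⟨T, fun i => hTpos i.1 i.2, hob',
    linearIndependent_of_obtuse _ p (fun i => hpT i.1 i.2) hob', fun β hβ => ?_⟩
  obtain ⟨c, hc, h⟩ := hTcone β hβ
  refine ⟨fun i => c i.1, fun i => hc _, ?_⟩
  rw [h, ← Finset.sum_coe_sort]

/-! ### Coordinates with respect to a simple system. -/

namespace IsSimpleSystem

variable {C : Face W} {ι : Type*} [Fintype ι] {α : ι → UnitNormal W}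

theorem injective (h : IsSimpleSystem C α) : Function.Injective α := fun i j hij =>
  h.linInd.injective (by simp only [hij])

theorem exists_pos_coeff {β : UnitNormal W} {i : ι}
    {c : ι → ℝ} (hc : ∀ i, 0 ≤ c i) (hβc : β.vec = ∑ i, c i • (α i).vec) (hne : β ≠ α i) :
    ∃ j, j ≠ i ∧ 0 < c j := by
  classical
  by_contra hcon
  push Not at hcon
  apply hne
  apply UnitNormal.eq_of_vec_eq_smul (hc i)
  rw [hβc]
  refine Finset.sum_eq_single i (fun j _ hj => ?_) (fun h => absurd (Finset.mem_univ i) h)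
  rw [le_antisymm (hcon j hj) (hc j), zero_smul]

/-- A simple reflection permutes the positive unit normals other than its own. -/
theorem s_smul_pos (h : IsSimpleSystem C α) (hC : C.IsChamber) (i : ι) {β : UnitNormal W}
    (hβ : C.sign β = 1) (hne : β ≠ α i) : C.sign ((α i).s • β) = 1 := by
  classical
  rcases Face.sign_eq_one_or_neg hC ((α i).s • β) with h1 | h1
  · exact h1
  · exfalso
    obtain ⟨c, hc, hβc⟩ := h.cone β hβ
    obtain ⟨d, hd, hβd⟩ := h.cone _ h1
    obtain ⟨j, hj, hcj⟩ := exists_pos_coeff hc hβc hne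
    rw [UnitNormal.neg_vec, UnitNormal.smul_vec, UnitNormal.s_apply] at hβd
    set t : ℝ := 2 * inner ℝ (α i).vec β.vec
    have h2 : ∑ k, (c k + d k - if k = i then t else 0) • (α k).vec = 0 := by
      simp only [sub_smul, add_smul, Finset.sum_sub_distrib, Finset.sum_add_distrib, ite_smul,
        zero_smul, Finset.sum_ite_eq', Finset.mem_univ, if_true]
      rw [← hβc, ← hβd]
      abel
    have h3 := (Fintype.linearIndependent_iff.1 h.linInd) _ h2 j
    rw [if_neg hj] at h3
    linarith [hd j]

/-- Coordinates of a point: its inner products with the simple normals. -/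
def coordMap (α : ι → UnitNormal W) : V →ₗ[ℝ] ι → ℝ :=
  LinearMap.pi fun i => (innerSL ℝ (α i).vec : V →L[ℝ] ℝ).toLinearMap

theorem inner_eq_sum {β : UnitNormal W} {c : ι → ℝ} (hβc : β.vec = ∑ i, c i • (α i).vec) (x : V) :
    (inner ℝ β.vec x : ℝ) = ∑ i, c i * inner ℝ (α i).vec x := by
  rw [hβc, sum_inner]
  simp only [real_inner_smul_left]

/-- Every unit normal is, up to sign, a combination of simple ones, so a point orthogonal to the
simple normals lies on all hyperplanes; essentiality makes it zero. -/
theorem coordMap_injective (h : IsSimpleSystem C α) (hC : C.IsChamber)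
    (hW : IsEssentialReflectionGroup W) : Function.Injective (coordMap α) := by
  rw [← LinearMap.ker_eq_bot, LinearMap.ker_eq_bot']
  intro x hx
  apply hW.essential
  have h0 : ∀ i, (inner ℝ (α i).vec x : ℝ) = 0 := fun i => congrFun hx i
  have key : ∀ β, C.sign β = 1 → (inner ℝ β.vec x : ℝ) = 0 := by
    intro β hβ
    obtain ⟨c, -, hβc⟩ := h.cone β hβ
    rw [inner_eq_sum hβc]
    exact Finset.sum_eq_zero fun i _ => by rw [h0, mul_zero]
  intro β
  rcases Face.sign_eq_one_or_neg hC β with h1 | h1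
  · exact key β h1
  · have := key _ h1
    rwa [UnitNormal.neg_vec, inner_neg_left, neg_eq_zero] at this

theorem card_eq_finrank [FiniteDimensional ℝ V] (h : IsSimpleSystem C α) (hC : C.IsChamber)
    (hW : IsEssentialReflectionGroup W) : finrank ℝ V = Fintype.card ι := by
  apply le_antisymm
  · have := LinearMap.finrank_le_finrank_of_injective (h.coordMap_injective hC hW)
    rwa [finrank_fintype_fun_eq_card] at this
  · exact h.linInd.fintype_card_le_finrank

/-- The coordinates as a linear equivalence. -/
def coord [FiniteDimensional ℝ V] (h : IsSimpleSystem C α) (hC : C.IsChamber)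
    (hW : IsEssentialReflectionGroup W) : V ≃ₗ[ℝ] ι → ℝ :=
  LinearMap.linearEquivOfInjective (coordMap α) (h.coordMap_injective hC hW)
    (by rw [finrank_fintype_fun_eq_card, h.card_eq_finrank hC hW])

theorem coord_apply [FiniteDimensional ℝ V] (h : IsSimpleSystem C α) (hC : C.IsChamber)
    (hW : IsEssentialReflectionGroup W) (x : V) (i : ι) :
    h.coord hC hW x i = inner ℝ (α i).vec x := rfl

theorem inner_coord_symm [FiniteDimensional ℝ V] (h : IsSimpleSystem C α) (hC : C.IsChamber)
    (hW : IsEssentialReflectionGroup W) (y : ι → ℝ) (i : ι) :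
    (inner ℝ (α i).vec ((h.coord hC hW).symm y) : ℝ) = y i := by
  rw [← h.coord_apply hC hW, LinearEquiv.apply_symm_apply]

/-! ### Generation by simple reflections, walls, length and descents. -/

section Generation

variable [Finite W]

/-- Every unit normal is conjugate to a simple one by a product of simple reflections. -/
theorem exists_smul_eq (h : IsSimpleSystem C α) (hC : C.IsChamber) (β : UnitNormal W) :
    ∃ w ∈ Subgroup.closure (Set.range fun i => (α i).s), ∃ i, w • β = α i := by
  obtain ⟨p, hp⟩ := C.exists_eq_ofPoint
  have hpos : ∀ β, C.sign β = 1 ↔ (0 : ℝ) < inner ℝ β.vec p := by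
    intro β; rw [hp, Face.ofPoint_sign_eq_one]
  set K := Subgroup.closure (Set.range fun i => (α i).s) with hK
  have hs : ∀ i, (α i).s ∈ K := fun i => Subgroup.subset_closure ⟨i, rfl⟩
  have key : ∀ β, C.sign β = 1 → ∃ w ∈ K, ∃ i, w • β = α i := by
    intro β hβ
    -- Among the positive normals in the orbit take the lowest with respect to `p`. If it is not
    -- simple, it has positive inner product with some simple normal, and that simple reflection
    -- lowers it while keeping it positive.
    obtain ⟨γ, ⟨hγ, w, hw, hwγ⟩, hmin⟩ := Set.exists_min_image
      {γ : UnitNormal W | C.sign γ = 1 ∧ ∃ w ∈ K, w • β = γ}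
      (fun γ => (inner ℝ γ.vec p : ℝ)) (Set.toFinite _) ⟨β, hβ, 1, K.one_mem, one_smul _ _⟩
    refine ⟨w, hw, ?_⟩
    by_contra hcon
    push Not at hcon
    obtain ⟨c, hc, hγc⟩ := h.cone γ hγ
    have h1 : (1 : ℝ) = ∑ i, c i * inner ℝ (α i).vec γ.vec := by
      rw [← γ.inner_self, inner_eq_sum hγc]
    obtain ⟨i, hi⟩ : ∃ i, (0 : ℝ) < inner ℝ (α i).vec γ.vec := by
      by_contra hneg
      push Not at hneg
      have : ∑ i, c i * (inner ℝ (α i).vec γ.vec : ℝ) ≤ 0 :=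
        Finset.sum_nonpos fun i _ => mul_nonpos_of_nonneg_of_nonpos (hc i) (hneg i)
      linarith
    have h2 : γ ≠ α i := fun h => hcon i (hwγ.trans h)
    have h3 := hmin ((α i).s • γ) ⟨h.s_smul_pos hC i hγ h2, (α i).s * w,
      K.mul_mem (hs i) hw, by rw [mul_smul, hwγ]⟩
    simp only [UnitNormal.smul_vec, UnitNormal.s_apply, inner_sub_left, real_inner_smul_left] at h3
    have := (hpos _).1 (h.pos i)
    nlinarith
  rcases Face.sign_eq_one_or_neg hC β with hβ | hβ
  · exact key β hβ
  · obtain ⟨w, hw, i, hi⟩ := key _ hβ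
    refine ⟨(α i).s * w, K.mul_mem (hs i) hw, i, ?_⟩
    rw [mul_smul, ← UnitNormal.neg_neg' β, UnitNormal.smul_neg' w, hi, UnitNormal.smul_neg',
      UnitNormal.s_smul_self, UnitNormal.neg_neg']

theorem closure_eq_top (h : IsSimpleSystem C α) (hC : C.IsChamber)
    (hW : IsEssentialReflectionGroup W) :
    Subgroup.closure (Set.range fun i => (α i).s) = ⊤ := by
  set K := Subgroup.closure (Set.range fun i => (α i).s) with hK
  have h1 : W ≤ K.map W.subtype := by
    conv_lhs => rw [hW.generated]
    rw [Subgroup.closure_le]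
    rintro g ⟨hg, v, hv, rfl⟩
    have hv' : refl (‖v‖⁻¹ • v) = refl v := by
      unfold refl
      congr 2
      exact Submodule.span_singleton_smul_eq (IsUnit.mk0 _ (inv_ne_zero (norm_ne_zero_iff.2 hv))) v
    let β : UnitNormal W := ⟨‖v‖⁻¹ • v, by
      rw [norm_smul, norm_inv, norm_norm, inv_mul_cancel₀ (norm_ne_zero_iff.2 hv)],
      by rw [hv']; exact hg⟩
    obtain ⟨w, hw, i, hi⟩ := h.exists_smul_eq hC β
    refine ⟨β.s, ?_, hv'⟩
    have h2 : β.s = w⁻¹ * (α i).s * w := by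
      rw [← hi, UnitNormal.s_smul]; group
    rw [h2]
    exact K.mul_mem (K.mul_mem (K.inv_mem hw) (Subgroup.subset_closure ⟨i, rfl⟩)) hw
  rw [eq_top_iff]
  intro w _
  obtain ⟨w', hw', h2⟩ := h1 w.2
  rwa [← Subtype.ext h2]

theorem exists_word (h : IsSimpleSystem C α) (hC : C.IsChamber)
    (hW : IsEssentialReflectionGroup W) (w : W) :
    ∃ l : List ι, (l.map fun i => (α i).s).prod = w := by
  have hw : w ∈ Subgroup.closure (Set.range fun i => (α i).s) := by
    rw [h.closure_eq_top hC hW]; trivial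
  induction hw using Subgroup.closure_induction with
  | mem x hx => obtain ⟨i, rfl⟩ := hx; exact ⟨[i], by simp⟩
  | one => exact ⟨[], rfl⟩
  | mul x y _ _ hx hy =>
    obtain ⟨l, rfl⟩ := hx
    obtain ⟨m, rfl⟩ := hy
    exact ⟨l ++ m, by simp⟩
  | inv x _ hx =>
    obtain ⟨l, rfl⟩ := hx
    refine ⟨l.reverse, ?_⟩
    rw [List.prod_inv_reverse, List.map_reverse, List.map_map]
    congr 3

/-- The exchange condition. -/
theorem exchange (h : IsSimpleSystem C α) (hC : C.IsChamber) (i : ι) (l : List ι)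
    (hl : C.sign ((l.map fun i => (α i).s).prod • α i) = -1) :
    ∃ l' : List ι, l'.length + 1 = l.length ∧
      (l.map fun i => (α i).s).prod * (α i).s = (l'.map fun i => (α i).s).prod := by
  induction l with
  | nil =>
    rw [List.map_nil, List.prod_nil, one_smul, h.pos] at hl
    exact absurd hl (by decide)
  | cons j t ih =>
    rw [List.map_cons, List.prod_cons] at hl ⊢
    rcases Face.sign_eq_one_or hC ((t.map fun i => (α i).s).prod • α i) with h1 | h1
    · have h2 : (t.map fun i => (α i).s).prod • α i = α j := by
        by_contra hne
        have := h.s_smul_pos hC j h1 hne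
        rw [← mul_smul, hl] at this
        exact absurd this (by decide)
      refine ⟨t, rfl, ?_⟩
      have h3 := UnitNormal.s_smul (t.map fun i => (α i).s).prod (α i)
      rw [h2] at h3
      rw [h3, mul_assoc, mul_assoc, mul_assoc, inv_mul_cancel_left, UnitNormal.s_mul_self, mul_one]
    · obtain ⟨l', hl', h2⟩ := ih h1
      refine ⟨j :: l', by simp [hl'], ?_⟩
      rw [List.map_cons, List.prod_cons, mul_assoc, h2]

/-- The walls of the chamber are the hyperplanes of the simple normals. -/
theorem isWall_simple [FiniteDimensional ℝ V] (h : IsSimpleSystem C α) (hC : C.IsChamber)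
    (hW : IsEssentialReflectionGroup W) (i : ι) : IsWall C (α i) := by
  classical
  set x : V := (h.coord hC hW).symm fun j => if j = i then 0 else 1 with hx
  have hxj : ∀ j, (inner ℝ (α j).vec x : ℝ) = if j = i then 0 else 1 := h.inner_coord_symm hC hW _
  have key : ∀ β, C.sign β = 1 → β ≠ α i → (0 : ℝ) < inner ℝ β.vec x := by
    intro β hβ hne
    obtain ⟨c, hc, hβc⟩ := h.cone β hβ
    obtain ⟨j, hj, hcj⟩ := exists_pos_coeff hc hβc hne
    rw [inner_eq_sum hβc]
    refine Finset.sum_pos' (fun k _ => ?_) ⟨j, Finset.mem_univ j, ?_⟩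
    · rw [hxj]; exact mul_nonneg (hc k) (by split_ifs <;> norm_num)
    · rw [hxj, if_neg hj, mul_one]; exact hcj
  have key2 : ∀ β, C.sign β = 1 → (Face.ofPoint W x).sign β = if β = α i then 0 else 1 := by
    intro β hβ
    split_ifs with h1
    · rw [h1, Face.ofPoint_sign, hxj, if_pos rfl, sign_zero]
    · exact Face.ofPoint_sign_eq_one.2 (key β hβ h1)
  refine ⟨Face.ofPoint W x, ?_, ?_⟩
  · rw [Face.carrier_subset_iff, Face.mul_eq_right_iff]
    intro β hβ0
    rcases Face.sign_eq_one_or_neg hC β with hβ | hβ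
    · rw [key2 β hβ] at hβ0 ⊢
      split_ifs at hβ0 ⊢ with h1
      · exact absurd rfl hβ0
      · exact hβ.symm
    · obtain ⟨γ, rfl⟩ : ∃ γ, β = -γ := ⟨-β, (UnitNormal.neg_neg' β).symm⟩
      rw [UnitNormal.neg_neg'] at hβ
      rw [Face.sign_neg, key2 _ hβ] at hβ0 ⊢
      rw [Face.sign_neg, hβ]
      split_ifs at hβ0 ⊢ with h1
      · exact absurd rfl hβ0
      · rfl
  · ext y
    rw [Face.mem_support, UnitNormal.mem_hyperplane]
    constructor
    · intro hy
      exact hy (α i) (by rw [key2 _ (h.pos i), if_pos rfl])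
    · intro hy β hβ0
      rcases Face.sign_eq_one_or_neg hC β with hβ | hβ
      · rw [key2 β hβ] at hβ0
        split_ifs at hβ0 with h1
        · rw [h1, hy]
      · have h0 : (Face.ofPoint W x).sign (-β) = 0 := by rw [Face.sign_neg, hβ0]; rfl
        rw [key2 _ hβ] at h0
        split_ifs at h0 with h1
        · rw [← h1, UnitNormal.neg_vec, inner_neg_left, neg_eq_zero] at hy
          exact hy

/-- Evaluate a positive wall normal, a non-negative combination of simple normals, at an interior
point of the wall. All terms are non-negative with sum zero, so some simple normal that occurs in it
vanishes there, hence on the whole hyperplane, and the two are proportional. -/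
theorem s_eq_of_isWall (h : IsSimpleSystem C α) (hC : C.IsChamber)
    {β : UnitNormal W} (hβ : IsWall C β) : ∃ i, β.s = (α i).s := by
  have key : ∀ β : UnitNormal W, C.sign β = 1 → IsWall C β → ∃ i, β.s = (α i).s := by
    rintro β hβ ⟨F, hF, hFs⟩
    rw [Face.carrier_subset_iff, Face.mul_eq_right_iff] at hF
    obtain ⟨x, rfl⟩ := F.exists_eq_ofPoint
    obtain ⟨c, hc, hβc⟩ := h.cone β hβ
    have hx : (inner ℝ β.vec x : ℝ) = 0 := by
      rw [← UnitNormal.mem_hyperplane, ← hFs]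
      exact Face.mem_support_ofPoint x
    have hnn : ∀ i, 0 ≤ (inner ℝ (α i).vec x : ℝ) := by
      intro i
      by_contra hlt
      push Not at hlt
      have h1 := hF (α i) (by rw [Face.ofPoint_sign, sign_neg hlt]; decide)
      rw [Face.ofPoint_sign, sign_neg hlt, h.pos] at h1
      exact absurd h1 (by decide)
    rw [inner_eq_sum hβc] at hx
    have hz := (Finset.sum_eq_zero_iff_of_nonneg
      (fun i _ => mul_nonneg (hc i) (hnn i))).1 hx
    obtain ⟨i, hi⟩ : ∃ i, c i ≠ 0 := by
      by_contra hcon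
      push Not at hcon
      exact β.vec_ne_zero (hβc.trans (Finset.sum_eq_zero fun i _ => by rw [hcon, zero_smul]))
    have hi0 := (mul_eq_zero.1 (hz i (Finset.mem_univ i))).resolve_left hi
    refine ⟨i, ?_⟩
    have hle : β.hyperplane ≤ (α i).hyperplane := by
      intro y hy
      rw [← hFs] at hy
      exact ((α i).mem_hyperplane y).2 (Face.mem_support.1 hy _ (sign_eq_zero_iff.2 hi0))
    have h2 : (α i).vec ∈ (ℝ ∙ β.vec) := by
      have h3 := Submodule.orthogonal_le hle
      unfold UnitNormal.hyperplane at h3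
      rw [Submodule.orthogonal_orthogonal, Submodule.orthogonal_orthogonal] at h3
      exact h3 (Submodule.mem_span_singleton_self _)
    obtain ⟨t, ht⟩ := Submodule.mem_span_singleton.1 h2
    rcases le_total 0 t with h0 | h0
    · rw [UnitNormal.eq_of_vec_eq_smul h0 ht.symm]
    · have : α i = -β := UnitNormal.eq_of_vec_eq_smul (c := -t) (by linarith)
        (by rw [← ht, UnitNormal.neg_vec, smul_neg, neg_smul, neg_neg])
      rw [this, UnitNormal.s_neg]
  rcases Face.sign_eq_one_or_neg hC β with h1 | h1
  · exact key β h1 hβ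
  · rw [← UnitNormal.s_neg]
    refine key _ h1 ?_
    obtain ⟨F, hF, hFs⟩ := hβ
    refine ⟨F, hF, hFs.trans ?_⟩
    ext y
    rw [UnitNormal.mem_hyperplane, UnitNormal.mem_hyperplane, UnitNormal.neg_vec, inner_neg_left,
      neg_eq_zero]

theorem simpleReflections_eq [FiniteDimensional ℝ V] (h : IsSimpleSystem C α) (hC : C.IsChamber)
    (hW : IsEssentialReflectionGroup W) : simpleReflections C = Set.range fun i => (α i).s := by
  ext s
  constructor
  · rintro ⟨β, hβ, hs⟩
    obtain ⟨i, hi⟩ := h.s_eq_of_isWall hC hβ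
    exact ⟨i, hi.symm.trans (Subtype.ext hs.symm)⟩
  · rintro ⟨i, rfl⟩
    exact ⟨α i, h.isWall_simple hC hW i, rfl⟩

theorem s_injective (h : IsSimpleSystem C α) : Function.Injective fun i => (α i).s := by
  intro i j hij
  rcases UnitNormal.eq_or_eq_neg_of_s_eq hij with h1 | h1
  · exact h.injective h1
  · have := h.pos i
    rw [h1, Face.sign_neg, h.pos] at this
    exact absurd this (by decide)

theorem length_le [FiniteDimensional ℝ V] (h : IsSimpleSystem C α) (hC : C.IsChamber)
    (hW : IsEssentialReflectionGroup W) (l : List ι) :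
    length C (l.map fun i => (α i).s).prod ≤ l.length := by
  refine Nat.sInf_le ⟨l.map fun i => (α i).s, ?_, rfl, by simp⟩
  intro s hs
  rw [h.simpleReflections_eq hC hW]
  obtain ⟨i, -, rfl⟩ := List.mem_map.1 hs
  exact ⟨i, rfl⟩

theorem exists_reduced [FiniteDimensional ℝ V] (h : IsSimpleSystem C α) (hC : C.IsChamber)
    (hW : IsEssentialReflectionGroup W) (w : W) :
    ∃ l : List ι, (l.map fun i => (α i).s).prod = w ∧ l.length = length C w := by
  have hne : {n | ∃ l : List W, (∀ s ∈ l, s ∈ simpleReflections C) ∧ l.prod = w ∧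
      l.length = n}.Nonempty := by
    obtain ⟨l, hl⟩ := h.exists_word hC hW w
    refine ⟨_, l.map fun i => (α i).s, ?_, hl, rfl⟩
    intro s hs
    rw [h.simpleReflections_eq hC hW]
    obtain ⟨i, -, rfl⟩ := List.mem_map.1 hs
    exact ⟨i, rfl⟩
  obtain ⟨l, hl, hw, hlen⟩ := Nat.sInf_mem hne
  rw [h.simpleReflections_eq hC hW] at hl
  obtain ⟨m, rfl⟩ : l ∈ Set.range (List.map fun i => (α i).s) := by rwa [Set.range_list_map]
  exact ⟨m, hw, by rw [← List.length_map]; exact hlen⟩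

/-- The exchange condition shortens a reduced word when the normal becomes negative. When it stays
positive, the same applied to `w * (α i).s` shows that the length goes up. -/
theorem length_lt_iff [FiniteDimensional ℝ V] (h : IsSimpleSystem C α) (hC : C.IsChamber)
    (hW : IsEssentialReflectionGroup W) (w : W) (i : ι) :
    length C (w * (α i).s) < length C w ↔ C.sign (w • α i) = -1 := by
  have key : ∀ w : W, C.sign (w • α i) = -1 → length C (w * (α i).s) < length C w := by
    intro w hw
    obtain ⟨l, rfl, hlen⟩ := h.exists_reduced hC hW w
    obtain ⟨l', hl', h1⟩ := h.exchange hC i l hw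
    rw [h1, ← hlen, ← hl']
    exact Nat.lt_succ_of_le (h.length_le hC hW l')
  refine ⟨fun hlt => ?_, key w⟩
  rcases Face.sign_eq_one_or hC (w • α i) with h1 | h1
  · have h2 := key (w * (α i).s) (by
      rw [mul_smul, UnitNormal.s_smul_self, UnitNormal.smul_neg', Face.sign_neg, h1])
    rw [mul_assoc, UnitNormal.s_mul_self, mul_one] at h2
    exact absurd hlt (lt_asymm h2)
  · exact h1

/-- The last letter of a non-empty reduced word is a descent, so `w` makes a simple normal negative;
an element that fixes the chamber cannot do that. -/
theorem eq_one_of_smul_eq [FiniteDimensional ℝ V] (h : IsSimpleSystem C α) (hC : C.IsChamber)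
    (hW : IsEssentialReflectionGroup W) {w : W} (hw : w • C = C) : w = 1 := by
  obtain ⟨l, rfl, hlen⟩ := h.exists_reduced hC hW w
  rcases List.eq_nil_or_concat' l with rfl | ⟨t, i, rfl⟩
  · rfl
  · exfalso
    have h1 := (h.length_lt_iff hC hW ((t ++ [i]).map fun i => (α i).s).prod i).1 (by
      rw [← hlen]
      simp only [List.map_append, List.map_cons, List.map_nil, List.prod_append, List.prod_cons,
        List.prod_nil, mul_one, mul_assoc, UnitNormal.s_mul_self, List.length_append,
        List.length_cons, List.length_nil]
      exact Nat.lt_succ_of_le (h.length_le hC hW t))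
    conv_lhs at h1 => rw [← hw]
    rw [Face.smul_sign_smul, h.pos] at h1
    exact absurd h1 (by decide)

end Generation

end IsSimpleSystem

/-! ### Faces of the fundamental chamber and their parametrization by sets of simple normals. -/

namespace IsSimpleSystem

variable {C : Face W} {ι : Type*} [Fintype ι] {α : ι → UnitNormal W}

section Faces

variable [Finite W]

/-- Every point can be moved into the closed fundamental chamber. -/
theorem exists_smul_mul_eq (h : IsSimpleSystem C α) (hC : C.IsChamber) (F : Face W) :
    ∃ w : W, (w • F) * C = C := by
  obtain ⟨p, hp⟩ := C.exists_eq_ofPoint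
  obtain ⟨q, rfl⟩ := F.exists_eq_ofPoint
  -- At the maximum no simple coordinate is negative, since reflecting in it would increase the
  -- pairing with `p`.
  obtain ⟨w, hw⟩ := Finite.exists_max fun w : W => (inner ℝ (w.1 q) p : ℝ)
  have hnn : ∀ i, 0 ≤ (inner ℝ (α i).vec (w.1 q) : ℝ) := by
    intro i
    have h1 := hw ((α i).s * w)
    change inner ℝ ((α i).s.1 (w.1 q)) p ≤ _ at h1
    rw [UnitNormal.s_apply, inner_sub_left, real_inner_smul_left] at h1
    have h2 : (0 : ℝ) < inner ℝ (α i).vec p := by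
      have := h.pos i
      rwa [hp, Face.ofPoint_sign_eq_one] at this
    by_contra hlt
    push Not at hlt
    nlinarith
  refine ⟨w, ?_⟩
  rw [Face.smul_ofPoint, Face.mul_eq_right_iff]
  have key : ∀ β, C.sign β = 1 → 0 ≤ (inner ℝ β.vec (w.1 q) : ℝ) := by
    intro β hβ
    obtain ⟨c, hc, hβc⟩ := h.cone β hβ
    rw [inner_eq_sum hβc]
    exact Finset.sum_nonneg fun i _ => mul_nonneg (hc i) (hnn i)
  intro β hβ0
  rcases Face.sign_eq_one_or hC β with hβ | hβ
  · rw [hβ, Face.ofPoint_sign_eq_one]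
    refine lt_of_le_of_ne (key β hβ) fun h0 => hβ0 ?_
    rw [Face.ofPoint_sign, ← h0, sign_zero]
  · rw [hβ, Face.ofPoint_sign, sign_eq_neg_one_iff]
    have h1 := key (-β) (by rw [Face.sign_neg, hβ]; rfl)
    rw [UnitNormal.neg_vec, inner_neg_left] at h1
    refine lt_of_le_of_ne (by linarith) fun h0 => hβ0 ?_
    rw [Face.ofPoint_sign, h0, sign_zero]

theorem exists_smul_eq_chamber (h : IsSimpleSystem C α) (hC : C.IsChamber) {D : Face W}
    (hD : D.IsChamber) : ∃ w : W, w • C = D := by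
  obtain ⟨w, hw⟩ := h.exists_smul_mul_eq hC D
  have h1 : (w • D) * C = w • D := by
    rw [Face.mul_eq_left_iff, Face.map_support, hD, Submodule.map_top,
      LinearMap.range_eq_top.2 w.1.toLinearEquiv.surjective]
    exact le_top
  exact ⟨w⁻¹, by rw [← hw, h1, inv_smul_smul]⟩

/-- The face of the fundamental chamber on which exactly the simple normals in `I` are positive. -/
def face [FiniteDimensional ℝ V] (h : IsSimpleSystem C α) (hC : C.IsChamber)
    (hW : IsEssentialReflectionGroup W) (I : Set ι) : Face W :=
  Face.ofPoint W ((h.coord hC hW).symm (I.indicator 1))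

theorem sign_nonneg_of_le (h : IsSimpleSystem C α) {F : Face W} (hF : F * C = C) (i : ι) :
    F.sign (α i) = 0 ∨ F.sign (α i) = 1 := by
  by_cases h0 : F.sign (α i) = 0
  · exact Or.inl h0
  · exact Or.inr ((Face.mul_eq_right_iff.1 hF _ h0).trans (h.pos i))

theorem inner_nonneg_of_le (h : IsSimpleSystem C α) {x : V}
    (hF : Face.ofPoint W x * C = C) (i : ι) : 0 ≤ (inner ℝ (α i).vec x : ℝ) := by
  rcases h.sign_nonneg_of_le hF i with h1 | h1
  · exact (sign_eq_zero_iff.1 h1).ge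
  · exact (Face.ofPoint_sign_eq_one.1 h1).le

/-- The value of a face of the fundamental chamber at a positive normal vanishes iff it vanishes
at all simple normals that occur in it. -/
theorem sign_eq_zero_iff_of_le (h : IsSimpleSystem C α) {F : Face W} (hF : F * C = C)
    {β : UnitNormal W} {c : ι → ℝ} (hc : ∀ i, 0 ≤ c i) (hβc : β.vec = ∑ i, c i • (α i).vec) :
    F.sign β = 0 ↔ ∀ i, c i ≠ 0 → F.sign (α i) = 0 := by
  obtain ⟨x, rfl⟩ := F.exists_eq_ofPoint
  have hnn := h.inner_nonneg_of_le hF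
  rw [Face.ofPoint_sign, sign_eq_zero_iff, inner_eq_sum hβc,
    Finset.sum_eq_zero_iff_of_nonneg fun i _ => mul_nonneg (hc i) (hnn i)]
  constructor
  · intro h1 i hi
    rw [Face.ofPoint_sign, sign_eq_zero_iff]
    exact (mul_eq_zero.1 (h1 i (Finset.mem_univ i))).resolve_left hi
  · intro h1 i _
    by_cases hi : c i = 0
    · rw [hi, zero_mul]
    · rw [sign_eq_zero_iff.1 (h1 i hi), mul_zero]

/-- On the closed chamber a non-negative combination of simple normals vanishes only termwise, so
zeros at simple normals determine all zeros. -/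
theorem support_le_iff_of_le (h : IsSimpleSystem C α) (hC : C.IsChamber) {F G : Face W}
    (hF : F * C = C) (hG : G * C = C) :
    F.support ≤ G.support ↔ ∀ i, G.sign (α i) = 0 → F.sign (α i) = 0 := by
  rw [Face.support_le_iff_sign]
  refine ⟨fun h1 i => h1 _, fun h1 => ?_⟩
  have key : ∀ β, C.sign β = 1 → G.sign β = 0 → F.sign β = 0 := by
    intro β hβ h0
    obtain ⟨c, hc, hβc⟩ := h.cone β hβ
    rw [h.sign_eq_zero_iff_of_le hF hc hβc]
    rw [h.sign_eq_zero_iff_of_le hG hc hβc] at h0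
    exact fun i hi => h1 i (h0 i hi)
  intro β h0
  rcases Face.sign_eq_one_or_neg hC β with hβ | hβ
  · exact key β hβ h0
  · have h2 := key (-β) hβ (by rw [Face.sign_neg, h0]; rfl)
    rw [← UnitNormal.neg_neg' β, Face.sign_neg, h2]
    rfl

theorem eq_of_le (h : IsSimpleSystem C α) (hC : C.IsChamber) {F G : Face W}
    (hF : F * C = C) (hG : G * C = C)
    (h1 : ∀ i, F.sign (α i) = 0 ↔ G.sign (α i) = 0) : F = G := by
  have h2 : F.support = G.support :=
    le_antisymm ((h.support_le_iff_of_le hC hF hG).2 fun i => (h1 i).2)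
      ((h.support_le_iff_of_le hC hG hF).2 fun i => (h1 i).1)
  rw [Face.support_eq_iff_sign] at h2
  apply Face.ext
  funext β
  by_cases h0 : F.sign β = 0
  · rw [h0, (h2 β).1 h0]
  · rw [Face.mul_eq_right_iff.1 hF β h0, Face.mul_eq_right_iff.1 hG β (mt (h2 β).2 h0)]

/-- Whether a face is contained in the fundamental chamber is seen on the simple normals. -/
theorem le_of_inner_nonneg (h : IsSimpleSystem C α) (hC : C.IsChamber) {x : V}
    (hx : ∀ i, 0 ≤ (inner ℝ (α i).vec x : ℝ)) : Face.ofPoint W x * C = C := by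
  rw [Face.mul_eq_right_iff]
  have key : ∀ β, C.sign β = 1 → 0 ≤ (inner ℝ β.vec x : ℝ) := by
    intro β hβ
    obtain ⟨c, hc, hβc⟩ := h.cone β hβ
    rw [inner_eq_sum hβc]
    exact Finset.sum_nonneg fun i _ => mul_nonneg (hc i) (hx i)
  intro β hβ0
  rcases Face.sign_eq_one_or hC β with hβ | hβ
  · rw [hβ, Face.ofPoint_sign_eq_one]
    refine lt_of_le_of_ne (key β hβ) fun h0 => hβ0 ?_
    rw [Face.ofPoint_sign, ← h0, sign_zero]
  · rw [hβ, Face.ofPoint_sign, sign_eq_neg_one_iff]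
    have h1 := key (-β) (by rw [Face.sign_neg, hβ]; rfl)
    rw [UnitNormal.neg_vec, inner_neg_left] at h1
    refine lt_of_le_of_ne (by linarith) fun h0 => hβ0 ?_
    rw [Face.ofPoint_sign, h0, sign_zero]

variable [FiniteDimensional ℝ V]

theorem face_le (h : IsSimpleSystem C α) (hC : C.IsChamber)
    (hW : IsEssentialReflectionGroup W) (I : Set ι) : h.face hC hW I * C = C := by
  apply h.le_of_inner_nonneg hC
  intro i
  rw [h.inner_coord_symm hC hW]
  exact Set.indicator_nonneg (fun _ _ => zero_le_one) i

theorem face_sign_eq_zero_iff (h : IsSimpleSystem C α) (hC : C.IsChamber)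
    (hW : IsEssentialReflectionGroup W) (I : Set ι) (i : ι) :
    (h.face hC hW I).sign (α i) = 0 ↔ i ∉ I := by
  rw [face, Face.ofPoint_sign, sign_eq_zero_iff, h.inner_coord_symm hC hW]
  simp

theorem eq_face_of_le (h : IsSimpleSystem C α) (hC : C.IsChamber)
    (hW : IsEssentialReflectionGroup W) {F : Face W} (hF : F * C = C) :
    F = h.face hC hW {i | F.sign (α i) ≠ 0} := by
  apply h.eq_of_le hC hF (h.face_le hC hW _)
  intro i
  rw [h.face_sign_eq_zero_iff hC hW, Set.mem_ofPred_eq, not_not]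

theorem face_injective (h : IsSimpleSystem C α) (hC : C.IsChamber)
    (hW : IsEssentialReflectionGroup W) : Function.Injective (h.face hC hW) := by
  intro I J hIJ
  ext i
  have := h.face_sign_eq_zero_iff hC hW I i
  rw [hIJ, h.face_sign_eq_zero_iff hC hW] at this
  exact not_iff_not.1 this.symm

theorem face_support_le_iff (h : IsSimpleSystem C α) (hC : C.IsChamber)
    (hW : IsEssentialReflectionGroup W) {I J : Set ι} :
    (h.face hC hW I).support ≤ (h.face hC hW J).support ↔ I ⊆ J := by
  rw [h.support_le_iff_of_le hC (h.face_le hC hW I) (h.face_le hC hW J)]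
  simp only [h.face_sign_eq_zero_iff hC hW]
  exact ⟨fun h1 i => not_imp_not.1 (h1 i), fun h1 i => not_imp_not.2 (@h1 i)⟩

theorem mem_face_support (h : IsSimpleSystem C α) (hC : C.IsChamber)
    (hW : IsEssentialReflectionGroup W) (I : Set ι) (x : V) :
    x ∈ (h.face hC hW I).support ↔ ∀ i, i ∉ I → (inner ℝ (α i).vec x : ℝ) = 0 := by
  rw [Face.mem_support]
  constructor
  · intro h1 i hi
    exact h1 _ ((h.face_sign_eq_zero_iff hC hW I i).2 hi)
  · intro h1
    have key : ∀ β, C.sign β = 1 → (h.face hC hW I).sign β = 0 → (inner ℝ β.vec x : ℝ) = 0 := by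
      intro β hβ h0
      obtain ⟨c, hc, hβc⟩ := h.cone β hβ
      rw [h.sign_eq_zero_iff_of_le (h.face_le hC hW I) hc hβc] at h0
      rw [inner_eq_sum hβc]
      refine Finset.sum_eq_zero fun i _ => ?_
      by_cases hi : c i = 0
      · rw [hi, zero_mul]
      · rw [h1 i ((h.face_sign_eq_zero_iff hC hW I i).1 (h0 i hi)), mul_zero]
    intro β h0
    rcases Face.sign_eq_one_or_neg hC β with hβ | hβ
    · exact key β hβ h0
    · have h2 := key (-β) hβ (by rw [Face.sign_neg, h0]; rfl)
      rwa [UnitNormal.neg_vec, inner_neg_left, neg_eq_zero] at h2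

/-- In simple coordinates the support is the coordinate subspace spanned by `I`. -/
theorem face_dim (h : IsSimpleSystem C α) (hC : C.IsChamber)
    (hW : IsEssentialReflectionGroup W) (I : Set ι) : (h.face hC hW I).dim = I.ncard := by
  classical
  have h1 : (h.face hC hW I).support.map (h.coord hC hW : V →ₗ[ℝ] ι → ℝ) =
      Pi.spanSubset ℝ I := by
    ext y
    rw [Submodule.mem_map_equiv, h.mem_face_support hC hW, Pi.mem_spanSubset_iff]
    simp only [h.inner_coord_symm hC hW]
  have h2 := LinearEquiv.finrank_map_eq (h.coord hC hW) (h.face hC hW I).support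
  unfold Face.dim
  rw [← h2, h1, Pi.dim_spanSubset]

theorem exists_smul_eq_face (h : IsSimpleSystem C α) (hC : C.IsChamber)
    (hW : IsEssentialReflectionGroup W) (F : Face W) :
    ∃ (w : W) (I : Set ι), w • h.face hC hW I = F := by
  obtain ⟨w, hw⟩ := h.exists_smul_mul_eq hC F
  exact ⟨w⁻¹, _, by rw [← h.eq_face_of_le hC hW hw, inv_smul_smul]⟩

end Faces

end IsSimpleSystem

/-! ### Bidigare's theorem -/

section Invariants

variable [Finite W]

/-- The action of a group element on the semigroup of faces. -/
def faceHom (w : W) : Face W →* Face W where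
  toFun F := w • F
  map_one' := rfl
  map_mul' _ _ := rfl

/-- The action of a group element on the Tits algebra. -/
def titsHom (w : W) : MonoidAlgebra ℝ (Face W) →ₐ[ℝ] MonoidAlgebra ℝ (Face W) :=
  MonoidAlgebra.mapDomainAlgHom ℝ ℝ (faceHom w)

theorem titsHom_single (w : W) (F : Face W) (r : ℝ) :
    titsHom w (MonoidAlgebra.single F r) = MonoidAlgebra.single (w • F) r := by
  exact MonoidAlgebra.mapDomain_single (f := fun F : Face W => w • F)

theorem titsHom_coeff_smul (w : W) (u : MonoidAlgebra ℝ (Face W)) (F : Face W) :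
    (titsHom w u).coeff (w • F) = u.coeff F :=
  Finsupp.mapDomain_apply (f := fun F : Face W => w • F) (MulAction.injective w) u.coeff F

theorem mem_invariants_iff {u : MonoidAlgebra ℝ (Face W)} :
    u ∈ invariants W ↔ ∀ w : W, titsHom w u = u := by
  constructor
  · intro h w
    apply MonoidAlgebra.ext
    ext F
    rw [← smul_inv_smul w F, titsHom_coeff_smul, h w]
  · intro h w F
    conv_lhs => rw [← h w]
    exact titsHom_coeff_smul w u F

theorem aeval_mem_invariants {u : MonoidAlgebra ℝ (Face W)} (hu : u ∈ invariants W)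
    (P : Polynomial ℝ) : Polynomial.aeval u P ∈ invariants W := by
  rw [mem_invariants_iff] at *
  intro w
  rw [← Polynomial.aeval_algHom_apply, hu]

/-- The map from the group algebra to the span of the chambers, `w ↦ w C`. -/
def chamberMap (C : Face W) : MonoidAlgebra ℝ W →ₗ[ℝ] MonoidAlgebra ℝ (Face W) :=
  MonoidAlgebra.mapDomainLinearMap ℝ ℝ fun w : W => w • C

theorem chamberMap_single (C : Face W) (w : W) (r : ℝ) :
    chamberMap C (MonoidAlgebra.single w r) = MonoidAlgebra.single (w • C) r :=
  MonoidAlgebra.mapDomainLinearMap_single ..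

end Invariants

/-! ### Bidigare's map as the action on the fundamental chamber. -/

namespace IsSimpleSystem

variable {C : Face W} {ι : Type*} [Fintype ι] {α : ι → UnitNormal W}
variable [Finite W] [FiniteDimensional ℝ V]

theorem smul_injective (h : IsSimpleSystem C α) (hC : C.IsChamber)
    (hW : IsEssentialReflectionGroup W) : Function.Injective fun w : W => w • C := by
  intro v w hvw
  have : (w⁻¹ * v) • C = C := by
    rw [mul_smul]
    exact inv_smul_eq_iff.2 hvw
  exact (inv_mul_eq_one.1 (h.eq_one_of_smul_eq hC hW this)).symm

theorem chamberMap_injective (h : IsSimpleSystem C α) (hC : C.IsChamber)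
    (hW : IsEssentialReflectionGroup W) : Function.Injective (chamberMap C) :=
  MonoidAlgebra.mapDomain_injective (h.smul_injective hC hW)

theorem _root_.ReflArr.UnitNormal.s_smul_eq_iff {β : UnitNormal W} {F : Face W} :
    β.s • F = F ↔ F.sign β = 0 := by
  obtain ⟨x, rfl⟩ := F.exists_eq_ofPoint
  constructor
  · intro h1
    have h2 := Face.smul_sign_smul β.s (Face.ofPoint W x) β
    rw [h1, UnitNormal.s_smul_self, Face.sign_neg] at h2
    rcases h3 : (Face.ofPoint W x).sign β with _ | _ | _
    · rfl
    · rw [h3] at h2; exact absurd h2 (by decide)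
    · rw [h3] at h2; exact absurd h2 (by decide)
  · intro h1
    rw [Face.ofPoint_sign, sign_eq_zero_iff] at h1
    rw [Face.smul_ofPoint, UnitNormal.s_apply, h1, mul_zero, zero_smul, sub_zero]

/-- A positive normal vanishing on `F` is a combination of the simple normals vanishing on `F`, so
it is enough to test these. Normals not vanishing on `F` already have the sign of `C`. -/
theorem mul_smul_eq_iff (h : IsSimpleSystem C α) (hC : C.IsChamber) {F : Face W}
    (hF : F * C = C) (w : W) :
    (w • F) * C = w • C ↔ ∀ i, F.sign (α i) = 0 → C.sign (w • α i) = 1 := by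
  constructor
  · intro h1 i hi
    have h2 := congrArg (fun K : Face W => K.sign (w • α i)) h1
    simpa only [Face.mul_sign, Face.smul_sign_smul, hi, if_true, h.pos] using h2
  · intro h1
    obtain ⟨p, hp⟩ := C.exists_eq_ofPoint
    have key : ∀ β, C.sign β = 1 → F.sign β = 0 → C.sign (w • β) = 1 := by
      intro β hβ h0
      obtain ⟨c, hc, hβc⟩ := h.cone β hβ
      rw [h.sign_eq_zero_iff_of_le hF hc hβc] at h0
      obtain ⟨i, hi⟩ : ∃ i, c i ≠ 0 := by
        by_contra hcon
        push Not at hcon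
        exact β.vec_ne_zero (hβc.trans (Finset.sum_eq_zero fun i _ => by rw [hcon, zero_smul]))
      have hpos : ∀ i, c i ≠ 0 → 0 < (inner ℝ (w • α i).vec p : ℝ) := by
        intro i hi
        have := h1 i (h0 i hi)
        rwa [hp, Face.ofPoint_sign_eq_one] at this
      rw [hp, Face.ofPoint_sign_eq_one, UnitNormal.inner_smul_left, inner_eq_sum hβc]
      simp only [UnitNormal.inner_smul_left] at hpos
      refine Finset.sum_pos' (fun j _ => ?_) ⟨i, Finset.mem_univ i, ?_⟩
      · by_cases hj : c j = 0
        · rw [hj, zero_mul]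
        · exact mul_nonneg (hc j) (hpos j hj).le
      · exact mul_pos (lt_of_le_of_ne (hc i) hi.symm) (hpos i hi)
    apply Face.ext
    funext γ
    obtain ⟨β, rfl⟩ : ∃ β, γ = w • β := ⟨w⁻¹ • γ, (smul_inv_smul w γ).symm⟩
    rw [Face.mul_sign, Face.smul_sign_smul, Face.smul_sign_smul]
    split_ifs with h0
    · rcases Face.sign_eq_one_or_neg hC β with hβ | hβ
      · rw [hβ, key β hβ h0]
      · obtain ⟨δ, rfl⟩ : ∃ δ, β = -δ := ⟨-β, (UnitNormal.neg_neg' β).symm⟩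
        rw [UnitNormal.neg_neg'] at hβ
        have h0' : F.sign δ = 0 := by
          rw [Face.sign_neg] at h0
          rcases h3 : F.sign δ with _ | _ | _
          · rfl
          · rw [h3] at h0; exact absurd h0 (by decide)
          · rw [h3] at h0; exact absurd h0 (by decide)
        rw [UnitNormal.smul_neg', Face.sign_neg, Face.sign_neg, hβ, key δ hβ h0']
    · exact Face.mul_eq_right_iff.1 hF β h0

/-- The simple reflections outside the type of `F` fix `F`, which means that their normals vanish on
`F`; a descent is a simple normal made negative. Together with `mul_smul_eq_iff` this links
Solomon's `Y_T` to Tits products. -/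
theorem descentSet_subset_iff (h : IsSimpleSystem C α) (hC : C.IsChamber)
    (hW : IsEssentialReflectionGroup W) (w : W) (F : Face W) :
    descentSet C w ⊆ faceType C F ↔ ∀ i, F.sign (α i) = 0 → C.sign (w • α i) = 1 := by
  have hS := h.simpleReflections_eq hC hW
  constructor
  · intro h1 i hi
    rcases Face.sign_eq_one_or hC (w • α i) with h2 | h2
    · exact h2
    · have h3 : (α i).s ∈ descentSet C w :=
        ⟨by rw [hS]; exact ⟨i, rfl⟩, (h.length_lt_iff hC hW w i).2 h2⟩
      exact absurd (UnitNormal.s_smul_eq_iff.2 hi) (h1 h3).2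
  · rintro h1 s ⟨hs, hlt⟩
    have hs' := hs
    rw [hS] at hs'
    obtain ⟨i, rfl⟩ := hs'
    refine ⟨hs, fun h2 => ?_⟩
    have h3 := h1 i (UnitNormal.s_smul_eq_iff.1 h2)
    rw [(h.length_lt_iff hC hW w i).1 hlt] at h3
    exact absurd h3 (by decide)

/-- Bidigare's map records the action of an invariant element on the fundamental chamber. -/
theorem chamberMap_bidigare (h : IsSimpleSystem C α) (hC : C.IsChamber)
    (hW : IsEssentialReflectionGroup W) (u : invariants W) :
    chamberMap C (bidigare C u) = u.1 * MonoidAlgebra.single C 1 := by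
  classical
  cases nonempty_fintype (Face W)
  cases nonempty_fintype W
  have hu : u.1 = ∑ F : Face W, MonoidAlgebra.single F (u.1.coeff F) := by
    conv_lhs => rw [← MonoidAlgebra.sum_coeff_single u.1]
    exact Finsupp.sum_fintype _ _ fun _ => MonoidAlgebra.single_zero _
  have h1 : u.1 * MonoidAlgebra.single C 1 =
      ∑ F : Face W, MonoidAlgebra.single (F * C) (u.1.coeff F) := by
    conv_lhs => rw [hu]
    rw [Finset.sum_mul]
    simp only [MonoidAlgebra.single_mul_single, mul_one]
  rw [h1]
  change chamberMap C (∑ F ∈ (Set.toFinite {F : Face W | F.carrier ⊆ C.carrier}).toFinset,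
    u.1.coeff F • elementY C (faceType C F)) = _
  simp only [elementY, map_sum, chamberMap_single, MonoidAlgebra.smul_single,
    Finset.smul_sum, smul_eq_mul, mul_one]
  rw [Finset.sum_sigma']
  -- Every face is w • F for exactly one pair with F in the chamber and Des(w) inside the type of F.
  -- The element w is recovered from (w • F) * C = w • C by simple transitivity.
  refine Finset.sum_bij (fun x _ => x.2 • x.1) (fun _ _ => Finset.mem_univ _) ?_ ?_ ?_
  · rintro ⟨F, v⟩ hF ⟨G, w⟩ hG hFG
    simp only [Finset.mem_sigma, Set.Finite.mem_toFinset, Set.mem_ofPred_eq,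
      Face.carrier_subset_iff, h.descentSet_subset_iff hC hW] at hF hG
    have e1 := (h.mul_smul_eq_iff hC hF.1 v).2 hF.2
    have e2 := (h.mul_smul_eq_iff hC hG.1 w).2 hG.2
    dsimp only at hFG
    rw [hFG, e2] at e1
    have e3 : w = v := h.smul_injective hC hW e1
    subst e3
    rw [MulAction.injective w hFG]
  · intro F _
    obtain ⟨w, hw⟩ := h.exists_smul_eq_chamber hC (D := F * C) (by
      have := Face.right_support_le_mul F C
      rw [hC] at this
      exact top_le_iff.1 this)
    have hFw : (w⁻¹ • F) * C = C := by
      apply MulAction.injective w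
      dsimp only
      rw [Face.smul_mul', smul_inv_smul, hw, ← mul_assoc, Face.mul_eq_left_iff.2 le_rfl]
    refine ⟨⟨w⁻¹ • F, w⟩, ?_, smul_inv_smul w F⟩
    simp only [Finset.mem_sigma, Set.Finite.mem_toFinset, Set.mem_ofPred_eq,
      Face.carrier_subset_iff, h.descentSet_subset_iff hC hW]
    refine ⟨hFw, (h.mul_smul_eq_iff hC hFw w).1 ?_⟩
    rw [smul_inv_smul, hw]
  · rintro ⟨F, w⟩ hF
    simp only [Finset.mem_sigma, Set.Finite.mem_toFinset, Set.mem_ofPred_eq,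
      Face.carrier_subset_iff, h.descentSet_subset_iff hC hW] at hF
    rw [(h.mul_smul_eq_iff hC hF.1 w).2 hF.2, u.2 w F]

/-- The chamber map is equivariant and `W` acts by algebra automorphisms fixing `u`, so the case `a
= 1`, which is `chamberMap_bidigare`, spreads to all `a`. The factor lands on the right, whence
Bidigare's map reverses products. -/
theorem mul_chamberMap (h : IsSimpleSystem C α) (hC : C.IsChamber)
    (hW : IsEssentialReflectionGroup W) (u : invariants W) (a : MonoidAlgebra ℝ W) :
    u.1 * chamberMap C a = chamberMap C (a * bidigare C u) := by
  have hl : ∀ (w : W) (b : MonoidAlgebra ℝ W),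
      chamberMap C (MonoidAlgebra.single w 1 * b) = titsHom w (chamberMap C b) := by
    intro w b
    induction b using MonoidAlgebra.induction_linear with
    | zero => simp
    | add x y hx hy => rw [mul_add, map_add, map_add, map_add, hx, hy]
    | single m r =>
      rw [MonoidAlgebra.single_mul_single, one_mul, chamberMap_single, chamberMap_single,
        titsHom_single, mul_smul]
  induction a using MonoidAlgebra.induction_linear with
  | zero => simp
  | add x y hx hy => rw [map_add, mul_add, add_mul, map_add, hx, hy]
  | single w r =>
    have hr : MonoidAlgebra.single w r = r • (MonoidAlgebra.single w 1 : MonoidAlgebra ℝ W) := by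
      rw [MonoidAlgebra.smul_single, smul_eq_mul, mul_one]
    rw [hr, map_smul, mul_smul_comm, smul_mul_assoc, map_smul, hl, h.chamberMap_bidigare hC hW,
      map_mul, titsHom_single, mem_invariants_iff.1 u.2 w, chamberMap_single]

/-- The reversal of products is harmless here because the powers of a single element commute. -/
theorem aeval_mul_chamberMap (h : IsSimpleSystem C α) (hC : C.IsChamber)
    (hW : IsEssentialReflectionGroup W) (u : invariants W) (P : Polynomial ℝ)
    (a : MonoidAlgebra ℝ W) : Polynomial.aeval u.1 P * chamberMap C a =
      chamberMap C (a * Polynomial.aeval (bidigare C u) P) := by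
  induction P using Polynomial.induction_on generalizing a with
  | C r =>
    rw [Polynomial.aeval_C, Polynomial.aeval_C, Algebra.algebraMap_eq_smul_one,
      Algebra.algebraMap_eq_smul_one, smul_mul_assoc, one_mul, mul_smul_comm, mul_one, map_smul]
  | add p q hp hq => rw [map_add, add_mul, hp, hq, ← map_add, ← mul_add, ← map_add]
  | monomial n r ih =>
    have e : Polynomial.C r * Polynomial.X ^ (n + 1) =
        Polynomial.C r * Polynomial.X ^ n * Polynomial.X := by rw [pow_succ, mul_assoc]
    have e1 : Polynomial.aeval (bidigare C u) (Polynomial.C r * Polynomial.X ^ (n + 1)) =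
        bidigare C u * Polynomial.aeval (bidigare C u) (Polynomial.C r * Polynomial.X ^ n) := by
      rw [e, mul_comm, map_mul, Polynomial.aeval_X]
    rw [e1, e, map_mul, Polynomial.aeval_X, mul_assoc, h.mul_chamberMap hC hW, ih, mul_assoc]

/-- Bidigare's map is compatible with polynomials in an invariant element. -/
theorem bidigare_aeval (h : IsSimpleSystem C α) (hC : C.IsChamber)
    (hW : IsEssentialReflectionGroup W) (u : invariants W) (P : Polynomial ℝ) :
    bidigare C ⟨Polynomial.aeval u.1 P, aeval_mem_invariants u.2 P⟩ =
      Polynomial.aeval (bidigare C u) P := by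
  apply h.chamberMap_injective hC hW
  have h1 := h.aeval_mul_chamberMap hC hW u P 1
  rw [one_mul] at h1
  rw [h.chamberMap_bidigare hC hW, ← h1, MonoidAlgebra.one_def, chamberMap_single, one_smul]

end IsSimpleSystem

/-! ### Flat idempotents and the sum of the rays -/

section Tits

variable [Finite W]

open MonoidAlgebra (single)

/-- The faces with support `X`. -/
def facesWithSupport (X : Flat W) : Finset (Face W) :=
  (Set.toFinite {F : Face W | F.support = X.space}).toFinset

theorem mem_facesWithSupport {X : Flat W} {F : Face W} :
    F ∈ facesWithSupport X ↔ F.support = X.space := by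
  rw [facesWithSupport, Set.Finite.mem_toFinset, Set.mem_ofPred_eq]

theorem card_facesWithSupport_ne_zero (X : Flat W) : ((facesWithSupport X).card : ℝ) ≠ 0 := by
  obtain ⟨F, hF⟩ := X.exists_face
  exact Nat.cast_ne_zero.2 (Finset.card_ne_zero_of_mem (mem_facesWithSupport.2 hF))

theorem uniformSection_eq (X : Flat W) :
    uniformSection X = ((facesWithSupport X).card : ℝ)⁻¹ • ∑ F ∈ facesWithSupport X, single F 1 := by
  unfold uniformSection
  congr 3
  rw [Nat.subtype_card (p := fun F : Face W => F.support = X.space) (facesWithSupport X)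
    fun F => mem_facesWithSupport]

/-- The flats properly containing `X`. -/
def flatsAbove (X : Flat W) : Finset (Flat W) :=
  (Set.toFinite {Y : Flat W | X.space < Y.space}).toFinset

theorem mem_flatsAbove {X Y : Flat W} : Y ∈ flatsAbove X ↔ X.space < Y.space := by
  rw [flatsAbove, Set.Finite.mem_toFinset, Set.mem_ofPred_eq]

/-- The number of ways to write `G` as a product of a ray in its support and a face with the
same support. -/
def rayFactorizations (G : Face W) : ℕ :=
  Nat.card {p : Face W × Face W // (p.1.dim = 1 ∧ p.1.support ≤ G.support) ∧
    p.2.support = G.support ∧ p.1 * p.2 = G}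

/-- The one-dimensional faces contained in `X`. -/
def raysIn (X : Flat W) : Finset (Face W) :=
  (Set.toFinite {F : Face W | F.dim = 1 ∧ F.support ≤ X.space}).toFinset

theorem mem_raysIn {X : Flat W} {F : Face W} :
    F ∈ raysIn X ↔ F.dim = 1 ∧ F.support ≤ X.space := by
  rw [raysIn, Set.Finite.mem_toFinset, Set.mem_ofPred_eq]

theorem rayCount_eq_card (X : Flat W) : rayCount X = (raysIn X).card := by
  unfold rayCount
  refine Nat.subtype_card _ fun F => ?_
  rw [mem_raysIn, Face.carrier_subset_flat_iff]

variable (W) in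
/-- The sum of all one-dimensional faces. -/
def raySum : MonoidAlgebra ℝ (Face W) :=
  ∑ F ∈ (Set.toFinite {F : Face W | F.dim = 1}).toFinset, single F 1

theorem mul_mem_facesWithSupport {X : Flat W} {F G : Face W} (hF : F.support ≤ X.space)
    (hG : G.support = X.space) : (F * G).support = X.space := by
  rw [← hG] at hF ⊢
  exact le_antisymm (Face.mul_support_le hF le_rfl) (Face.right_support_le_mul F G)

theorem rayFactorizations_eq [DecidableEq (Face W)] {X : Flat W} {G : Face W}
    (hG : G.support = X.space) : rayFactorizations G =
      ((raysIn X ×ˢ facesWithSupport X).filter fun p => p.1 * p.2 = G).card := by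
  refine Nat.subtype_card _ fun p => ?_
  rw [Finset.mem_filter, Finset.mem_product, mem_raysIn, mem_facesWithSupport, hG, and_assoc]

/-- Count pairs (ray in `X`, face with support `X`) by their product, again a face with support `X`:
the number of rays times the number of faces equals `m` times the number of faces, which is not
zero. -/
theorem rayCount_eq_rayFactorizations {X : Flat W} {m : ℕ}
    (hm : ∀ G : Face W, G.support = X.space → rayFactorizations G = m) : rayCount X = m := by
  classical
  have h1 := Finset.card_eq_sum_card_fiberwise (f := fun p : Face W × Face W => p.1 * p.2)
    (s := raysIn X ×ˢ facesWithSupport X) (t := facesWithSupport X) (by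
      intro p hp
      rw [Finset.mem_coe, Finset.mem_product, mem_raysIn, mem_facesWithSupport] at hp
      exact mem_facesWithSupport.2 (mul_mem_facesWithSupport hp.1.2 hp.2))
  have h2 : ∀ G ∈ facesWithSupport X,
      ((raysIn X ×ˢ facesWithSupport X).filter fun p => p.1 * p.2 = G).card = m := by
    intro G hG
    rw [← rayFactorizations_eq (mem_facesWithSupport.1 hG), hm G (mem_facesWithSupport.1 hG)]
  rw [Finset.sum_congr rfl h2, Finset.card_product, Finset.sum_const, smul_eq_mul, mul_comm] at h1
  rw [rayCount_eq_card]
  exact Nat.eq_of_mul_eq_mul_left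
    (Nat.pos_of_ne_zero (Nat.cast_ne_zero.1 (card_facesWithSupport_ne_zero X))) h1

/-- Expanding the product and grouping by its value, each face with support `X` is hit `m` times. -/
theorem sum_rays_mul_uniformSection {X : Flat W} {m : ℕ}
    (hm : ∀ G : Face W, G.support = X.space → rayFactorizations G = m) :
    (∑ F ∈ raysIn X, single F 1) * uniformSection X = (m : ℝ) • uniformSection X := by
  classical
  rw [uniformSection_eq, mul_smul_comm, smul_comm]
  congr 1
  rw [Finset.sum_mul_sum, ← Finset.sum_product']
  simp only [MonoidAlgebra.single_mul_single, mul_one]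
  rw [← Finset.sum_fiberwise_of_maps_to (g := fun p : Face W × Face W => p.1 * p.2)
    (t := facesWithSupport X)]
  · rw [Finset.smul_sum]
    refine Finset.sum_congr rfl fun G hG => ?_
    rw [Finset.sum_congr rfl (g := fun _ => single G 1)]
    · rw [Finset.sum_const, ← rayFactorizations_eq (mem_facesWithSupport.1 hG),
        hm G (mem_facesWithSupport.1 hG), Nat.cast_smul_eq_nsmul]
    · intro p hp
      rw [(Finset.mem_filter.1 hp).2]
  · intro p hp
    rw [Finset.mem_product, mem_raysIn, mem_facesWithSupport] at hp
    exact mem_facesWithSupport.2 (mul_mem_facesWithSupport hp.1.2 hp.2)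

variable [FiniteDimensional ℝ V]

theorem flatIdempotent_eq_mul (X : Flat W) :
    flatIdempotent X = uniformSection X * (1 - ∑ Y ∈ flatsAbove X, flatIdempotent Y) := by
  rw [mul_sub, mul_one, Finset.mul_sum, flatIdempotent_eq]
  rfl

theorem single_mul_uniformSection {X : Flat W} {K : Face W} (hK : K.support = X.space) :
    single K 1 * uniformSection X = single K 1 := by
  rw [uniformSection_eq, mul_smul_comm, Finset.mul_sum,
    Finset.sum_congr rfl (g := fun _ => single K (1 : ℝ))]
  · rw [Finset.sum_const, ← Nat.cast_smul_eq_nsmul ℝ, smul_smul,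
      inv_mul_cancel₀ (card_facesWithSupport_ne_zero X), one_smul]
  · intro G hG
    rw [MonoidAlgebra.single_mul_single, mul_one, Face.mul_eq_left_iff.2]
    rw [hK, mem_facesWithSupport.1 hG]

/-- The recursion multiplied by a face with support `X`, which absorbs the uniform section on its
right. -/
theorem single_mul_sum_flatIdempotent {X : Flat W} {K : Face W} (hK : K.support = X.space) :
    single K 1 * flatIdempotent X + ∑ Y ∈ flatsAbove X, single K 1 * flatIdempotent Y =
      single K 1 := by
  rw [flatIdempotent_eq_mul, ← mul_assoc, single_mul_uniformSection hK, mul_sub, mul_one,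
    Finset.mul_sum, sub_add_cancel]

/-- A face not contained in `X` annihilates the flat idempotent of `X`. -/
theorem single_mul_flatIdempotent_eq_zero (X : Flat W) (F : Face W)
    (hF : ¬ F.support ≤ X.space) : single F 1 * flatIdempotent X = 0 := by
  classical
  induction hn : finrank ℝ V - finrank ℝ X.space using Nat.strong_induction_on
    generalizing X F with
  | _ n ih =>
  -- The product K = F G has support strictly larger than X. By induction on codimension K
  -- annihilates e_Y unless Y contains K, and the remaining e_Y multiply K to K, so K is cancelled
  -- by the bracket.
  have key : ∀ G ∈ facesWithSupport X, single F 1 * single G 1 *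
      (1 - ∑ Y ∈ flatsAbove X, flatIdempotent Y) = 0 := by
    intro G hG
    rw [mem_facesWithSupport] at hG
    rw [MonoidAlgebra.single_mul_single, mul_one]
    set K := F * G
    have hXK : X.space < K.flat.space := by
      refine lt_of_le_of_ne ?_ fun h => hF ?_
      · rw [← hG]; exact Face.right_support_le_mul F G
      · rw [h]; exact Face.left_support_le_mul F G
    have h1 : ∀ Y ∈ flatsAbove X, Y ∉ insert K.flat (flatsAbove K.flat) →
        single K (1 : ℝ) * flatIdempotent Y = 0 := by
      intro Y hY hYK
      rw [mem_flatsAbove] at hY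
      have h2 := Submodule.finrank_lt_finrank_of_lt hY
      have h3 := Submodule.finrank_le Y.space
      refine ih _ (by omega) Y K (fun hle => hYK ?_) rfl
      rw [Finset.mem_insert, mem_flatsAbove]
      rcases eq_or_lt_of_le hle with h | h
      · exact Or.inl (Flat.ext h.symm)
      · exact Or.inr h
    have hsub : insert K.flat (flatsAbove K.flat) ⊆ flatsAbove X := by
      intro Y hY
      rw [mem_flatsAbove]
      rcases Finset.mem_insert.1 hY with rfl | hY
      · exact hXK
      · exact hXK.trans (mem_flatsAbove.1 hY)
    rw [mul_sub, mul_one, Finset.mul_sum, ← Finset.sum_subset hsub h1, Finset.sum_insert,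
      single_mul_sum_flatIdempotent (Face.flat_space K).symm, sub_self]
    rw [mem_flatsAbove]
    exact lt_irrefl _
  rw [flatIdempotent_eq_mul, ← mul_assoc, uniformSection_eq, mul_smul_comm, smul_mul_assoc,
    Finset.mul_sum, Finset.sum_mul, Finset.sum_eq_zero key, smul_zero]

/-- The unit face has the smallest flat as its support, so all flats occur when
`single_mul_sum_flatIdempotent` is applied to it. -/
theorem sum_flatIdempotent [Fintype (Flat W)] : ∑ X : Flat W, flatIdempotent X = 1 := by
  classical
  have h1 : ∀ X : Flat W, (1 : Face W).flat.space ≤ X.space := by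
    intro X
    obtain ⟨F, hF⟩ := X.exists_face
    rw [← hF, Face.flat_space, Face.support_le_iff_sign]
    exact fun α _ => rfl
  have h2 : (Finset.univ : Finset (Flat W)) = insert (1 : Face W).flat (flatsAbove (1 : Face W).flat) := by
    symm
    rw [Finset.eq_univ_iff_forall]
    intro X
    rw [Finset.mem_insert, mem_flatsAbove]
    rcases eq_or_lt_of_le (h1 X) with h | h
    · exact Or.inl (Flat.ext h.symm)
    · exact Or.inr h
  have h3 := single_mul_sum_flatIdempotent (K := (1 : Face W)) (Face.flat_space 1).symm
  rw [← MonoidAlgebra.one_def, one_mul] at h3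
  simp only [one_mul] at h3
  rw [h2, Finset.sum_insert, h3]
  rw [mem_flatsAbove]
  exact lt_irrefl _

/-- If all faces with support `X` have equally many ray factorizations, then the flat idempotent
of `X` is an eigenvector of the sum of the rays. -/
theorem raySum_mul_flatIdempotent {X : Flat W} {m : ℕ}
    (hm : ∀ G : Face W, G.support = X.space → rayFactorizations G = m) :
    raySum W * flatIdempotent X = (m : ℝ) • flatIdempotent X := by
  have h1 : raySum W * flatIdempotent X =
      (∑ F ∈ raysIn X, single F 1) * flatIdempotent X := by
    rw [raySum, Finset.sum_mul, Finset.sum_mul]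
    symm
    refine Finset.sum_subset (fun F hF => ?_) fun F hF hFX => ?_
    · rw [Set.Finite.mem_toFinset]
      exact (mem_raysIn.1 hF).1
    · rw [Set.Finite.mem_toFinset] at hF
      exact single_mul_flatIdempotent_eq_zero X F fun h => hFX (mem_raysIn.2 ⟨hF, h⟩)
  rw [h1, flatIdempotent_eq_mul, ← mul_assoc, sum_rays_mul_uniformSection hm, smul_mul_assoc]

theorem aeval_mul_of_mul_eq_smul {A : Type*} [Ring A] [Algebra ℝ A] {a b : A} {r : ℝ}
    (h : a * b = r • b) (P : Polynomial ℝ) : Polynomial.aeval a P * b = P.eval r • b := by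
  induction P using Polynomial.induction_on with
  | C r =>
    rw [Polynomial.aeval_C, Polynomial.eval_C, Algebra.algebraMap_eq_smul_one, smul_mul_assoc,
      one_mul]
  | add p q hp hq => rw [map_add, add_mul, hp, hq, Polynomial.eval_add, add_smul]
  | monomial n s ih =>
    have e : Polynomial.C s * Polynomial.X ^ (n + 1) =
        Polynomial.C s * Polynomial.X ^ n * Polynomial.X := by rw [pow_succ, mul_assoc]
    rw [e, map_mul, Polynomial.aeval_X, mul_assoc, h, mul_smul_comm, ih, smul_smul,
      Polynomial.eval_mul_X, mul_comm]

theorem mul_aeval_of_mul_eq_smul {A : Type*} [Ring A] [Algebra ℝ A] {a b : A} {r : ℝ}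
    (h : b * a = r • b) (P : Polynomial ℝ) : b * Polynomial.aeval a P = P.eval r • b := by
  induction P using Polynomial.induction_on with
  | C r =>
    rw [Polynomial.aeval_C, Polynomial.eval_C, Algebra.algebraMap_eq_smul_one, mul_smul_comm,
      mul_one]
  | add p q hp hq => rw [map_add, mul_add, hp, hq, Polynomial.eval_add, add_smul]
  | monomial n s ih =>
    have e : Polynomial.C s * Polynomial.X ^ (n + 1) =
        Polynomial.C s * Polynomial.X ^ n * Polynomial.X := by rw [pow_succ, mul_assoc]
    rw [e, map_mul, Polynomial.aeval_X, ← mul_assoc, ih, smul_mul_assoc, h, smul_smul,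
      Polynomial.eval_mul_X]

/-- The number of ray factorizations of a face depends only on its dimension. -/
def HasUniformRays (W : Subgroup (V ≃ₗᵢ[ℝ] V)) [Finite W] : Prop :=
  ∀ F G : Face W, F.dim = G.dim → rayFactorizations F = rayFactorizations G

namespace HasUniformRays

theorem rayCount_eq (hu : HasUniformRays W) {X : Flat W} {G : Face W}
    (h : G.dim = finrank ℝ X.space) : rayCount X = rayFactorizations G :=
  rayCount_eq_rayFactorizations fun F hF => hu F G (by rw [h, ← hF]; rfl)

theorem rayCount_eq_of_finrank_eq (hu : HasUniformRays W) {X Y : Flat W}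
    (h : finrank ℝ X.space = finrank ℝ Y.space) : rayCount X = rayCount Y := by
  obtain ⟨F, hF⟩ := Y.exists_face
  have hd : F.dim = finrank ℝ Y.space := by rw [← hF]; rfl
  rw [hu.rayCount_eq (hd.trans h.symm), hu.rayCount_eq hd]

theorem sigma_eq (hu : HasUniformRays W) (X : Flat W) :
    sigma W (finrank ℝ X.space) = rayCount X := by
  have : {n | ∃ Y : Flat W, finrank ℝ Y.space = finrank ℝ X.space ∧ rayCount Y = n} =
      {rayCount X} := by
    ext n
    rw [Set.mem_ofPred_eq, Set.mem_singleton_iff]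
    constructor
    · rintro ⟨Y, hY, rfl⟩
      exact hu.rayCount_eq_of_finrank_eq hY
    · rintro rfl
      exact ⟨X, rfl, rfl⟩
  rw [sigma, this, csInf_singleton]

theorem raySum_mul (hu : HasUniformRays W) (X : Flat W) :
    raySum W * flatIdempotent X = (sigma W (finrank ℝ X.space) : ℝ) • flatIdempotent X := by
  rw [hu.sigma_eq]
  refine raySum_mul_flatIdempotent fun G hG => ?_
  rw [hu.rayCount_eq (G := G)]
  rw [← hG]; rfl

/-- The Eulerian idempotents are the Lagrange projectors of the sum of the rays. -/
theorem aeval_raySum_basis (hu : HasUniformRays W) {k : ℕ}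
    (hσ : Set.InjOn (sigma W) (Set.Iic (finrank ℝ V))) :
    Polynomial.aeval (raySum W) (Lagrange.basis (Finset.range (finrank ℝ V + 1))
      (fun j => (sigma W j : ℝ)) k) = eulerianIdempotent W k := by
  classical
  cases nonempty_fintype (Flat W)
  rw [← mul_one (Polynomial.aeval _ _), ← sum_flatIdempotent (W := W), Finset.mul_sum,
    eulerianIdempotent, Finset.sum_congr rfl fun X _ =>
      aeval_mul_of_mul_eq_smul (hu.raySum_mul X) _]
  symm
  have hnode : ∀ X : Flat W, finrank ℝ X.space ∈ Finset.range (finrank ℝ V + 1) := fun X =>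
    Finset.mem_range.2 (Nat.lt_succ_of_le (Submodule.finrank_le X.space))
  rw [← Finset.sum_subset (Finset.subset_univ
    (Set.toFinite {X : Flat W | finrank ℝ X.space = k}).toFinset)]
  · refine Finset.sum_congr rfl fun X hX => ?_
    rw [Set.Finite.mem_toFinset, Set.mem_ofPred_eq] at hX
    have := Lagrange.eval_basis_self (s := Finset.range (finrank ℝ V + 1))
      (v := fun j => (sigma W j : ℝ)) (i := k) (by
        intro i hi j hj hij
        rw [Finset.mem_coe, Finset.mem_range, Nat.lt_succ_iff] at hi hj
        exact hσ hi hj (Nat.cast_injective hij)) (by rw [← hX]; exact hnode X)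
    rw [hX, this, one_smul]
  · intro X _ hX
    rw [Set.Finite.mem_toFinset, Set.mem_ofPred_eq] at hX
    have := Lagrange.eval_basis_of_ne (s := Finset.range (finrank ℝ V + 1))
      (v := fun j => (sigma W j : ℝ)) (i := k) (Ne.symm hX) (hnode X)
    rw [this, zero_smul]

end HasUniformRays

theorem raySum_coeff (F : Face W) [Decidable (F.dim = 1)] :
    (raySum W).coeff F = if F.dim = 1 then 1 else 0 := by
  classical
  rw [raySum, MonoidAlgebra.coeff_sum, Finsupp.finsetSum_apply]
  simp only [MonoidAlgebra.coeff_single, Finsupp.single_apply]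
  rw [Finset.sum_ite_eq']
  simp only [Set.Finite.mem_toFinset, Set.mem_ofPred_eq]

theorem raySum_mem_invariants : raySum W ∈ invariants W := by
  classical
  intro w F
  rw [raySum_coeff, raySum_coeff, Face.dim_smul]

end Tits

/-! ### The Barr element as image of the rays; growth of the ray counts. -/

namespace IsSimpleSystem

variable {C : Face W} {ι : Type*} [Fintype ι] {α : ι → UnitNormal W}
variable [Finite W] [FiniteDimensional ℝ V]

theorem exists_eq_face_singleton (h : IsSimpleSystem C α) (hC : C.IsChamber)
    (hW : IsEssentialReflectionGroup W) {F : Face W} (hF : F * C = C) (h1 : F.dim = 1) :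
    ∃ i, F = h.face hC hW {i} := by
  have h2 := h.eq_face_of_le hC hW hF
  rw [h2, h.face_dim hC hW, Set.ncard_eq_one] at h1
  obtain ⟨i, hi⟩ := h1
  exact ⟨i, by rw [h2, hi]⟩

theorem faceType_face (h : IsSimpleSystem C α) (hC : C.IsChamber)
    (hW : IsEssentialReflectionGroup W) (i : ι) :
    faceType C (h.face hC hW {i}) = {(α i).s} := by
  ext s
  rw [Set.mem_singleton_iff]
  constructor
  · rintro ⟨hs, hne⟩
    rw [h.simpleReflections_eq hC hW] at hs
    obtain ⟨j, rfl⟩ := hs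
    dsimp only at hne ⊢
    rw [ne_eq, UnitNormal.s_smul_eq_iff, h.face_sign_eq_zero_iff hC hW, not_not,
      Set.mem_singleton_iff] at hne
    rw [hne]
  · rintro rfl
    refine ⟨by rw [h.simpleReflections_eq hC hW]; exact ⟨i, rfl⟩, ?_⟩
    rw [ne_eq, UnitNormal.s_smul_eq_iff, h.face_sign_eq_zero_iff hC hW, not_not]
    exact Set.mem_singleton i

/-- The Barr element is the image of the sum of the rays. -/
theorem bidigare_raySum (h : IsSimpleSystem C α) (hC : C.IsChamber)
    (hW : IsEssentialReflectionGroup W) :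
    bidigare C ⟨raySum W, raySum_mem_invariants⟩ = barrElement C := by
  classical
  change ∑ F ∈ (Set.toFinite {F : Face W | F.carrier ⊆ C.carrier}).toFinset,
    (raySum W).coeff F • elementY C (faceType C F) = _
  simp only [raySum_coeff, ite_smul, one_smul, zero_smul]
  rw [← Finset.sum_filter, barrElement]
  trans ∑ i, elementY C {(α i).s}
  · symm
    refine Finset.sum_nbij (fun i => h.face hC hW {i}) ?_ ?_ ?_ ?_
    · intro i _
      simp only [Finset.mem_filter, Set.Finite.mem_toFinset, Set.mem_ofPred_eq]
      rw [Face.carrier_subset_iff, h.face_dim hC hW, Set.ncard_singleton]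
      exact ⟨h.face_le hC hW _, rfl⟩
    · intro i _ j _ hij
      exact Set.singleton_injective (h.face_injective hC hW hij)
    · intro F hF
      rw [Finset.mem_coe, Finset.mem_filter, Set.Finite.mem_toFinset, Set.mem_ofPred_eq,
        Face.carrier_subset_iff] at hF
      obtain ⟨i, hi⟩ := h.exists_eq_face_singleton hC hW hF.1 hF.2
      exact ⟨i, by simp, hi.symm⟩
    · intro i _
      rw [h.faceType_face hC hW]
  · refine Finset.sum_nbij (fun i => (α i).s) ?_ ?_ ?_ ?_
    · intro i _
      rw [Set.Finite.mem_toFinset, h.simpleReflections_eq hC hW]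
      exact ⟨i, rfl⟩
    · exact fun i _ j _ hij => h.s_injective hij
    · intro s hs
      rw [Finset.mem_coe, Set.Finite.mem_toFinset, h.simpleReflections_eq hC hW] at hs
      obtain ⟨i, hi⟩ := hs
      exact ⟨i, by simp, hi⟩
    · exact fun _ _ => rfl

/-- By uniformity the counts may be compared on nested flats spanned by faces of the chamber.
Dropping one element `i` of `I` loses at least the ray of the chamber at `i`. -/
theorem sigma_strictMonoOn (h : IsSimpleSystem C α) (hC : C.IsChamber)
    (hW : IsEssentialReflectionGroup W) (hu : HasUniformRays W) :
    StrictMonoOn (sigma W) (Set.Iic (finrank ℝ V)) := by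
  have hface : ∀ I : Set ι, sigma W I.ncard = (raysIn (h.face hC hW I).flat).card := by
    intro I
    rw [← rayCount_eq_card, ← hu.sigma_eq, ← h.face_dim hC hW]
    rfl
  refine strictMonoOn_of_lt_add_one Set.ordConnected_Iic fun k _ _ hk => ?_
  rw [Set.mem_Iic, h.card_eq_finrank hC hW, ← Nat.card_eq_fintype_card, ← Set.ncard_univ] at hk
  obtain ⟨I, -, hI⟩ := Set.exists_subset_card_eq hk
  obtain ⟨i, hi⟩ : I.Nonempty := Set.nonempty_of_ncard_ne_zero (by omega)
  have hJ : (I \ {i}).ncard = k := by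
    rw [Set.ncard_sdiff_singleton_of_mem hi, hI, Nat.add_sub_cancel]
  rw [← hI, ← hJ, hface, hface]
  apply Finset.card_lt_card
  rw [Finset.ssubset_iff_of_subset]
  · refine ⟨h.face hC hW {i}, ?_, ?_⟩
    · rw [mem_raysIn, h.face_dim hC hW, Set.ncard_singleton, Face.flat_space,
        h.face_support_le_iff hC hW, Set.singleton_subset_iff]
      exact ⟨rfl, hi⟩
    · rw [mem_raysIn, Face.flat_space, h.face_support_le_iff hC hW, Set.singleton_subset_iff]
      exact fun h1 => h1.2.2 rfl
  · intro F hF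
    rw [mem_raysIn] at hF ⊢
    exact ⟨hF.1, hF.2.trans ((h.face_support_le_iff hC hW).2 Set.sdiff_subset)⟩

end IsSimpleSystem

/-! ### Transfer to the group algebra, assuming uniform rays. -/

namespace HasUniformRays

variable [FiniteDimensional ℝ V] [Finite W]

theorem eulerianIdempotent_mem_invariants (hu : HasUniformRays W)
    (hσ : Set.InjOn (sigma W) (Set.Iic (finrank ℝ V))) (k : ℕ) :
    eulerianIdempotent W k ∈ invariants W := by
  rw [← hu.aeval_raySum_basis hσ]
  exact aeval_mem_invariants raySum_mem_invariants _

theorem barrProjector_eq (hu : HasUniformRays W) (hW : IsEssentialReflectionGroup W) {C : Face W}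
    (hC : C.IsChamber) (hσ : Set.InjOn (sigma W) (Set.Iic (finrank ℝ V))) (k : ℕ) :
    barrProjector C k = bidigare C
      ⟨eulerianIdempotent W k, hu.eulerianIdempotent_mem_invariants hσ k⟩ := by
  obtain ⟨Δ, h⟩ := exists_isSimpleSystem hC
  rw [barrProjector, ← h.bidigare_raySum hC hW, ← h.bidigare_aeval hC hW]
  congr 1
  exact Subtype.ext (hu.aeval_raySum_basis hσ)

theorem aeval_sub_mul_eulerianIdempotent (hu : HasUniformRays W) (k : ℕ) :
    Polynomial.aeval (raySum W) (Polynomial.X - Polynomial.C (sigma W k : ℝ)) *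
      eulerianIdempotent W k = 0 := by
  rw [eulerianIdempotent, Finset.mul_sum]
  refine Finset.sum_eq_zero fun X hX => ?_
  rw [Set.Finite.mem_toFinset, Set.mem_ofPred_eq] at hX
  rw [aeval_mul_of_mul_eq_smul (hu.raySum_mul X), hX, Polynomial.eval_sub, Polynomial.eval_X,
    Polynomial.eval_C, sub_self, zero_smul]

/-- The polynomial (x - σ_k) L_k kills the sum of the rays, hence also its image, the Barr element.
-/
theorem barrProjector_mul (hu : HasUniformRays W) (hW : IsEssentialReflectionGroup W) {C : Face W}
    (hC : C.IsChamber) (hσ : Set.InjOn (sigma W) (Set.Iic (finrank ℝ V))) (k : ℕ) :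
    barrProjector C k * barrElement C = (sigma W k : ℝ) • barrProjector C k := by
  obtain ⟨Δ, h⟩ := exists_isSimpleSystem hC
  obtain ⟨L, hL⟩ : ∃ L : Polynomial ℝ, L = Lagrange.basis (Finset.range (finrank ℝ V + 1))
    (fun j => (sigma W j : ℝ)) k := ⟨_, rfl⟩
  have hzero : Polynomial.aeval (raySum W) ((Polynomial.X - Polynomial.C (sigma W k : ℝ)) * L) =
      0 := by
    rw [map_mul, hL, hu.aeval_raySum_basis hσ, hu.aeval_sub_mul_eulerianIdempotent]
  have h1 := h.bidigare_aeval hC hW ⟨raySum W, raySum_mem_invariants⟩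
    ((Polynomial.X - Polynomial.C (sigma W k : ℝ)) * L)
  have h2 : (⟨_, aeval_mem_invariants raySum_mem_invariants
      ((Polynomial.X - Polynomial.C (sigma W k : ℝ)) * L)⟩ : invariants W) = 0 :=
    Subtype.ext hzero
  rw [h2, map_zero, h.bidigare_raySum hC hW, mul_comm, map_mul, map_sub, Polynomial.aeval_X,
    Polynomial.aeval_C, mul_sub, ← Algebra.commutes, ← Algebra.smul_def, hL] at h1
  exact sub_eq_zero.1 h1.symm

/-- One inclusion is `barrProjector_mul`. Conversely, on a σ_k-eigenvector the projector acts as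
L_k(σ_k) = 1, so the eigenvector is its own image. -/
theorem range_barrProjector (hu : HasUniformRays W) (hW : IsEssentialReflectionGroup W)
    {C : Face W} (hC : C.IsChamber) (hσ : Set.InjOn (sigma W) (Set.Iic (finrank ℝ V))) {k : ℕ}
    (hk : k ≤ finrank ℝ V) : LinearMap.range (LinearMap.mulRight ℝ (barrProjector C k)) =
      Module.End.eigenspace (LinearMap.mulRight ℝ (barrElement C)) (sigma W k : ℝ) := by
  have hinj : Set.InjOn (fun j => (sigma W j : ℝ)) (Finset.range (finrank ℝ V + 1)) := by
    intro i hi j hj hij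
    rw [Finset.mem_coe, Finset.mem_range, Nat.lt_succ_iff] at hi hj
    exact hσ hi hj (Nat.cast_injective hij)
  have hLk := Lagrange.eval_basis_self hinj (Finset.mem_range.2 (Nat.lt_succ_of_le hk))
  ext x
  rw [Module.End.mem_eigenspace_iff, LinearMap.mem_range, LinearMap.mulRight_apply]
  constructor
  · rintro ⟨y, rfl⟩
    rw [LinearMap.mulRight_apply, mul_assoc, hu.barrProjector_mul hW hC hσ, mul_smul_comm]
  · intro hx
    refine ⟨x, ?_⟩
    rw [LinearMap.mulRight_apply, barrProjector, mul_aeval_of_mul_eq_smul hx, hLk, one_smul]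

theorem barrProjector_spec (hu : HasUniformRays W) (hW : IsEssentialReflectionGroup W)
    (C : Face W) (hC : C.IsChamber) :
    (∀ X : Flat W, rayCount X = sigma W (finrank ℝ X.space)) ∧
    StrictMonoOn (sigma W) (Set.Iic (finrank ℝ V)) ∧
    ∀ k : ℕ, k ≤ finrank ℝ V →
      LinearMap.range (LinearMap.mulRight ℝ (barrProjector C k)) =
        Module.End.eigenspace (LinearMap.mulRight ℝ (barrElement C)) (sigma W k : ℝ) ∧
      ∃ hk : eulerianIdempotent W k ∈ invariants W,
        barrProjector C k = bidigare C ⟨eulerianIdempotent W k, hk⟩ := by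
  obtain ⟨Δ, h⟩ := exists_isSimpleSystem hC
  have hσ := (h.sigma_strictMonoOn hC hW hu)
  exact ⟨fun X => (hu.sigma_eq X).symm, hσ, fun k hk =>
    ⟨hu.range_barrProjector hW hC hσ.injOn hk, _, hu.barrProjector_eq hW hC hσ.injOn k⟩⟩

end HasUniformRays

/-! ### Linear maps between flats -/

/-- A linear map is compatible with the arrangement on the subspace `X` if it pulls every unit
normal back to a multiple of a unit normal. -/
def IsFlatMap (W : Subgroup (V ≃ₗᵢ[ℝ] V)) (X : Submodule ℝ V) (g : V →ₗ[ℝ] V) : Prop :=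
  ∀ β : UnitNormal W, ∃ (γ : UnitNormal W) (t : ℝ), ∀ x ∈ X,
    (inner ℝ β.vec (g x) : ℝ) = t * inner ℝ γ.vec x

namespace Face

theorem support_ofPoint_le {G : Face W} {x : V} (hx : x ∈ G.support) :
    (ofPoint W x).support ≤ G.support :=
  support_le_iff_sign.2 fun α hα => sign_eq_zero_iff.2 (mem_support.1 hx α hα)

/-- The image of a face under a linear map. -/
def push (g : V →ₗ[ℝ] V) (F : Face W) : Face W := ofPoint W (g F.exists_eq_ofPoint.choose)

theorem exists_push_sign {G : Face W} {g : V →ₗ[ℝ] V} (hg : IsFlatMap W G.support g)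
    (β : UnitNormal W) : ∃ (γ : UnitNormal W) (t : ℝ),
      (∀ x ∈ G.support, (inner ℝ β.vec (g x) : ℝ) = t * inner ℝ γ.vec x) ∧
      ∀ F : Face W, F.support ≤ G.support → (push g F).sign β = SignType.sign t * F.sign γ := by
  obtain ⟨γ, t, h⟩ := hg β
  refine ⟨γ, t, h, fun F hF => ?_⟩
  have h1 := F.exists_eq_ofPoint.choose_spec
  set x := F.exists_eq_ofPoint.choose with hx
  have h2 : x ∈ F.support := by
    have := mem_support_ofPoint (W := W) x
    rwa [← h1] at this
  rw [push, ← hx, ofPoint_sign, h x (hF h2), sign_mul]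
  conv_rhs => rw [h1]
  rw [ofPoint_sign]

/-- Independence of the point chosen in `push`: each sign of the image depends only on one sign of
the face. -/
theorem push_ofPoint {G : Face W} {g : V →ₗ[ℝ] V} (hg : IsFlatMap W G.support g) {x : V}
    (hx : x ∈ G.support) : push g (ofPoint W x) = ofPoint W (g x) := by
  apply Face.ext
  funext β
  obtain ⟨γ, t, h, h1⟩ := exists_push_sign hg β
  rw [h1 _ (support_ofPoint_le hx), ofPoint_sign, ofPoint_sign, h x hx, sign_mul]

/-- Each sign of an image is a fixed sign times one sign of the face, and multiplying by a fixed
sign, zero included, respects the Tits product of signs. -/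
theorem push_mul [Finite W] {G : Face W} {g : V →ₗ[ℝ] V} (hg : IsFlatMap W G.support g)
    {F K : Face W} (hF : F.support ≤ G.support) (hK : K.support ≤ G.support) :
    push g (F * K) = push g F * push g K := by
  apply Face.ext
  funext β
  obtain ⟨γ, t, -, h1⟩ := exists_push_sign hg β
  rw [h1 _ (mul_support_le hF hK), mul_sign, mul_sign, h1 _ hF, h1 _ hK]
  generalize SignType.sign t = a
  generalize F.sign γ = b
  generalize K.sign γ = c
  revert a b c
  decide

theorem map_mem_push_support {G : Face W} {g : V →ₗ[ℝ] V} (hg : IsFlatMap W G.support g)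
    {F : Face W} (hF : F.support ≤ G.support) {x : V} (hx : x ∈ F.support) :
    g x ∈ (push g F).support := by
  rw [mem_support]
  intro β hβ
  obtain ⟨γ, t, h, h1⟩ := exists_push_sign hg β
  rw [h1 _ hF, mul_eq_zero, sign_eq_zero_iff] at hβ
  rw [h x (hF hx)]
  rcases hβ with h0 | h0
  · rw [h0, zero_mul]
  · rw [mem_support.1 hx γ h0, mul_zero]

end Face

/-- A pair of mutually inverse linear maps between the supports of `G` and `G'` that identify the
restricted arrangements and take the face `G` to the face `G'`. -/
structure IsFaceEquiv (G G' : Face W) (g g' : V →ₗ[ℝ] V) : Prop where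
  isFlatMap : IsFlatMap W G.support g
  isFlatMap' : IsFlatMap W G'.support g'
  map_mem : ∀ x ∈ G.support, g x ∈ G'.support
  map_mem' : ∀ x ∈ G'.support, g' x ∈ G.support
  left_inv : ∀ x ∈ G.support, g' (g x) = x
  right_inv : ∀ x ∈ G'.support, g (g' x) = x
  push_eq : G.push g = G'

namespace IsFaceEquiv

variable {G G' : Face W} {g g' : V →ₗ[ℝ] V}

theorem exists_point (F : Face W) : ∃ x ∈ F.support, F = Face.ofPoint W x := by
  obtain ⟨x, rfl⟩ := F.exists_eq_ofPoint
  exact ⟨x, Face.mem_support_ofPoint x, rfl⟩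

theorem push_push (h : IsFaceEquiv G G' g g') {F : Face W} (hF : F.support ≤ G.support) :
    (F.push g).push g' = F := by
  obtain ⟨x, hx, rfl⟩ := exists_point F
  have hx' := hF hx
  rw [Face.push_ofPoint h.isFlatMap hx', Face.push_ofPoint h.isFlatMap' (h.map_mem x hx'),
    h.left_inv x hx']

theorem symm (h : IsFaceEquiv G G' g g') : IsFaceEquiv G' G g' g where
  isFlatMap := h.isFlatMap'
  isFlatMap' := h.isFlatMap
  map_mem := h.map_mem'
  map_mem' := h.map_mem
  left_inv := h.right_inv
  right_inv := h.left_inv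
  push_eq := by
    conv_lhs => rw [← h.push_eq]
    exact h.push_push le_rfl

theorem push_support_le (h : IsFaceEquiv G G' g g') {F : Face W} (hF : F.support ≤ G.support) :
    (F.push g).support ≤ G'.support := by
  obtain ⟨x, hx, rfl⟩ := exists_point F
  rw [Face.push_ofPoint h.isFlatMap (hF hx)]
  exact Face.support_ofPoint_le (h.map_mem x (hF hx))

theorem dim_le [FiniteDimensional ℝ V] (h : IsFaceEquiv G G' g g') {F : Face W}
    (hF : F.support ≤ G.support) : F.dim ≤ (F.push g).dim := by
  have h1 : ∀ x ∈ F.support, g x ∈ (F.push g).support := fun x hx =>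
    Face.map_mem_push_support h.isFlatMap hF hx
  refine LinearMap.finrank_le_finrank_of_injective (f := g.restrict h1) fun x y hxy => ?_
  have h2 : g x.1 = g y.1 := congrArg Subtype.val hxy
  apply Subtype.ext
  rw [← h.left_inv x.1 (hF x.2), h2, h.left_inv y.1 (hF y.2)]

theorem dim_push [FiniteDimensional ℝ V] (h : IsFaceEquiv G G' g g') {F : Face W}
    (hF : F.support ≤ G.support) : (F.push g).dim = F.dim := by
  apply le_antisymm _ (h.dim_le hF)
  have := h.symm.dim_le (h.push_support_le hF)
  rwa [h.push_push hF] at this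

variable [Finite W] [FiniteDimensional ℝ V]

theorem push_factorization (h : IsFaceEquiv G G' g g') {p : Face W × Face W}
    (hp : (p.1.dim = 1 ∧ p.1.support ≤ G.support) ∧ p.2.support = G.support ∧ p.1 * p.2 = G) :
    ((p.1.push g).dim = 1 ∧ (p.1.push g).support ≤ G'.support) ∧
      (p.2.push g).support = G'.support ∧ p.1.push g * p.2.push g = G' := by
  obtain ⟨⟨h1, h2⟩, h3, h4⟩ := hp
  refine ⟨⟨by rw [h.dim_push h2, h1], h.push_support_le h2⟩, ?_, ?_⟩
  · apply le_antisymm (h.push_support_le h3.le)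
    rw [← h.push_eq, ← Face.mul_eq_left_iff, ← Face.push_mul h.isFlatMap h3.le le_rfl,
      Face.mul_eq_left_iff.2 h3.ge]
  · rw [← Face.push_mul h.isFlatMap h2 h3.le, h4, h.push_eq]

theorem rayFactorizations_eq (h : IsFaceEquiv G G' g g') :
    rayFactorizations G = rayFactorizations G' := by
  refine Nat.card_congr
    { toFun := fun p => ⟨(p.1.1.push g, p.1.2.push g), h.push_factorization p.2⟩
      invFun := fun p => ⟨(p.1.1.push g', p.1.2.push g'), h.symm.push_factorization p.2⟩
      left_inv := ?_
      right_inv := ?_ }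
  · rintro ⟨⟨F, K⟩, h1, h2, h3⟩
    exact Subtype.ext (Prod.ext (h.push_push h1.2) (h.push_push h2.le))
  · rintro ⟨⟨F, K⟩, h1, h2, h3⟩
    exact Subtype.ext (Prod.ext (h.symm.push_push h1.2) (h.symm.push_push h2.le))

end IsFaceEquiv

theorem rayFactorizations_smul [Finite W] [FiniteDimensional ℝ V] (w : W) (G : Face W) :
    rayFactorizations (w • G) = rayFactorizations G := by
  have hflat : ∀ (v : W) (X : Submodule ℝ V),
      IsFlatMap W X (v.1.toLinearEquiv : V →ₗ[ℝ] V) := by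
    intro v X β
    refine ⟨v⁻¹ • β, 1, fun x _ => ?_⟩
    rw [one_mul, UnitNormal.inner_smul_left, inv_inv]
    rfl
  have hmem : ∀ (v : W) (K : Face W), ∀ x ∈ K.support, v.1 x ∈ (v • K).support := by
    intro v K x hx
    rw [Face.map_support]
    exact Submodule.mem_map_of_mem hx
  have h : IsFaceEquiv G (w • G) (w.1.toLinearEquiv : V →ₗ[ℝ] V)
      (w⁻¹.1.toLinearEquiv : V →ₗ[ℝ] V) :=
    { isFlatMap := hflat w _
      isFlatMap' := hflat w⁻¹ _
      map_mem := hmem w G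
      map_mem' := fun x hx => by
        have := hmem w⁻¹ (w • G) x hx
        rwa [inv_smul_smul] at this
      left_inv := fun x _ => w.1.symm_apply_apply x
      right_inv := fun x _ => w.1.apply_symm_apply x
      push_eq := by
        obtain ⟨x, hx, hG⟩ := IsFaceEquiv.exists_point G
        conv_lhs => rw [hG]
        conv_rhs => rw [hG]
        rw [Face.push_ofPoint (hflat w _) hx, Face.smul_ofPoint]
        rfl }
  exact h.rayFactorizations_eq.symm

/-! ### Transport of coordinates between faces of the chamber. -/

namespace IsSimpleSystem

variable {C : Face W} {ι : Type*} [Fintype ι] {α : ι → UnitNormal W}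

/-- Transport of coordinates along `I ≃ J` is compatible with the arrangement; here the simple
normals are rescaled by `μ`. -/
def IsTransport (α : ι → UnitNormal W) (μ : ι → ℝ) {I J : Set ι} (e : I ≃ J) : Prop :=
  ∀ β : UnitNormal W, ∃ (γ : UnitNormal W) (t : ℝ), ∀ x y : V,
    (∀ i ∉ I, (inner ℝ (α i).vec x : ℝ) = 0) → (∀ j ∉ J, (inner ℝ (α j).vec y : ℝ) = 0) →
    (∀ i : I, μ (e i) * (inner ℝ (α (e i)).vec y : ℝ) = μ i * inner ℝ (α i).vec x) →
    (inner ℝ β.vec y : ℝ) = t * inner ℝ γ.vec x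

variable [FiniteDimensional ℝ V]

open Classical in
/-- The linear map that transports coordinates along `I ≃ J`. -/
def transport (h : IsSimpleSystem C α) (hC : C.IsChamber) (hW : IsEssentialReflectionGroup W)
    (μ : ι → ℝ) {I J : Set ι} (e : I ≃ J) : V →ₗ[ℝ] V :=
  (h.coord hC hW).symm.toLinearMap ∘ₗ LinearMap.pi fun j =>
    if hj : j ∈ J then (μ j)⁻¹ • μ (e.symm ⟨j, hj⟩) •
      (LinearMap.proj (e.symm ⟨j, hj⟩ : ι) ∘ₗ (h.coord hC hW).toLinearMap)
    else 0

theorem inner_transport (h : IsSimpleSystem C α) (hC : C.IsChamber)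
    (hW : IsEssentialReflectionGroup W) {μ : ι → ℝ} (hμ : ∀ i, 0 < μ i) {I J : Set ι} (e : I ≃ J)
    (x : V) (i : I) : μ (e i) * (inner ℝ (α (e i)).vec (h.transport hC hW μ e x) : ℝ) =
      μ i * inner ℝ (α i).vec x := by
  rw [transport, LinearMap.comp_apply, LinearEquiv.coe_toLinearMap, h.inner_coord_symm hC hW,
    LinearMap.pi_apply, dif_pos (e i).2]
  simp only [Subtype.coe_eta, Equiv.symm_apply_apply, LinearMap.smul_apply, LinearMap.comp_apply,
    LinearEquiv.coe_toLinearMap, LinearMap.proj_apply, smul_eq_mul, h.coord_apply hC hW]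
  rw [mul_inv_cancel_left₀ (hμ _).ne']

theorem inner_transport_of_notMem (h : IsSimpleSystem C α) (hC : C.IsChamber)
    (hW : IsEssentialReflectionGroup W) (μ : ι → ℝ) {I J : Set ι} (e : I ≃ J)
    (x : V) {j : ι} (hj : j ∉ J) :
    (inner ℝ (α j).vec (h.transport hC hW μ e x) : ℝ) = 0 := by
  rw [transport, LinearMap.comp_apply, LinearEquiv.coe_toLinearMap, h.inner_coord_symm hC hW,
    LinearMap.pi_apply, dif_neg hj, LinearMap.zero_apply]

variable [Finite W]

/-- The transports along `e` and `e.symm` are inverse on the two supports, so they form an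
`IsFaceEquiv`. -/
theorem rayFactorizations_face_eq (h : IsSimpleSystem C α) (hC : C.IsChamber)
    (hW : IsEssentialReflectionGroup W) {μ : ι → ℝ} (hμ : ∀ i, 0 < μ i) {I J : Set ι} (e : I ≃ J)
    (he : IsTransport α μ e) (he' : IsTransport α μ e.symm) :
    rayFactorizations (h.face hC hW I) = rayFactorizations (h.face hC hW J) := by
  have hmem : ∀ {I J : Set ι} (e : I ≃ J) (x : V),
      h.transport hC hW μ e x ∈ (h.face hC hW J).support := by
    intro I J e x
    rw [h.mem_face_support hC hW]
    exact fun i hi => h.inner_transport_of_notMem hC hW μ e x hi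
  have hflat : ∀ {I J : Set ι} (e : I ≃ J), IsTransport α μ e →
      IsFlatMap W (h.face hC hW I).support (h.transport hC hW μ e) := by
    intro I J e he β
    obtain ⟨γ, t, h1⟩ := he β
    refine ⟨γ, t, fun x hx => h1 x _ ((h.mem_face_support hC hW I x).1 hx) ?_ ?_⟩
    · exact fun j hj => h.inner_transport_of_notMem hC hW μ e x hj
    · exact fun i => h.inner_transport hC hW hμ e x i
  have hinv : ∀ {I J : Set ι} (e : I ≃ J), ∀ x ∈ (h.face hC hW I).support,
      h.transport hC hW μ e.symm (h.transport hC hW μ e x) = x := by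
    intro I J e x hx
    apply (h.coord hC hW).injective
    funext i
    rw [h.coord_apply hC hW, h.coord_apply hC hW]
    by_cases hi : i ∈ I
    · have h1 := h.inner_transport hC hW hμ e.symm (h.transport hC hW μ e x) (e ⟨i, hi⟩)
      rw [Equiv.symm_apply_apply, h.inner_transport hC hW hμ e x] at h1
      exact mul_left_cancel₀ (hμ i).ne' h1
    · rw [h.inner_transport_of_notMem hC hW μ e.symm _ hi,
        (h.mem_face_support hC hW I x).1 hx i hi]
  have hE : IsFaceEquiv (h.face hC hW I) (h.face hC hW J) (h.transport hC hW μ e)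
      (h.transport hC hW μ e.symm) :=
    { isFlatMap := hflat e he
      isFlatMap' := hflat e.symm he'
      map_mem := fun x _ => hmem e x
      map_mem' := fun x _ => hmem e.symm x
      left_inv := hinv e
      right_inv := hinv e.symm
      push_eq := by
        have h0 := Face.mem_support_ofPoint (W := W) ((h.coord hC hW).symm (I.indicator 1))
        conv_lhs => rw [face]
        rw [Face.push_ofPoint (hflat e he) h0]
        -- Because of the scaling by `μ`, the image of the indicator of `I` need not be the
        -- indicator of `J`. Its coordinates are positive on `J` and zero elsewhere, so it lies in
        -- the same face.
        have hval : ∀ i : I, 0 < (inner ℝ (α (e i)).vec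
            (h.transport hC hW μ e ((h.coord hC hW).symm (I.indicator 1))) : ℝ) := by
          intro i
          have h1 := h.inner_transport hC hW hμ e ((h.coord hC hW).symm (I.indicator 1)) i
          rw [h.inner_coord_symm hC hW, Set.indicator_of_mem i.2, Pi.one_apply, mul_one] at h1
          exact pos_of_mul_pos_right (h1 ▸ hμ i) (hμ _).le
        have hle := h.le_of_inner_nonneg hC
          (x := h.transport hC hW μ e ((h.coord hC hW).symm (I.indicator 1))) (by
            intro j
            by_cases hj : j ∈ J
            · have := hval (e.symm ⟨j, hj⟩)
              rw [Equiv.apply_symm_apply] at this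
              exact this.le
            · rw [h.inner_transport_of_notMem hC hW μ e _ hj])
        refine h.eq_of_le hC hle (h.face_le hC hW J) fun j => ?_
        rw [h.face_sign_eq_zero_iff hC hW, Face.ofPoint_sign, sign_eq_zero_iff]
        constructor
        · intro h1 hj
          have := hval (e.symm ⟨j, hj⟩)
          rw [Equiv.apply_symm_apply] at this
          exact this.ne' h1
        · exact fun hj => h.inner_transport_of_notMem hC hW μ e _ hj }
  exact hE.rayFactorizations_eq

/-- It suffices to compare the faces of the fundamental chamber. -/
theorem hasUniformRays (h : IsSimpleSystem C α) (hC : C.IsChamber)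
    (hW : IsEssentialReflectionGroup W)
    (h1 : ∀ I J : Set ι, I.ncard = J.ncard →
      rayFactorizations (h.face hC hW I) = rayFactorizations (h.face hC hW J)) :
    HasUniformRays W := by
  intro F G hFG
  obtain ⟨v, I, rfl⟩ := h.exists_smul_eq_face hC hW F
  obtain ⟨w, J, rfl⟩ := h.exists_smul_eq_face hC hW G
  rw [Face.dim_smul, Face.dim_smul, h.face_dim hC hW, h.face_dim hC hW] at hFG
  rw [rayFactorizations_smul, rayFactorizations_smul, h1 I J hFG]

end IsSimpleSystem

/-! ### Groups of rank at most three -/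

namespace Face

/-- The face opposite to `F`. -/
def opp (F : Face W) : Face W :=
  ⟨fun α => -F.sign α, by
    obtain ⟨x, hx⟩ := F.realizable
    exact ⟨-x, fun α => by rw [hx, inner_neg_right, Left.sign_neg]⟩⟩

theorem opp_sign (F : Face W) (α : UnitNormal W) : F.opp.sign α = -F.sign α := rfl

theorem opp_opp (F : Face W) : F.opp.opp = F :=
  Face.ext (funext fun _ => neg_neg _)

theorem opp_support (F : Face W) : F.opp.support = F.support := by
  rw [support_eq_iff_sign]
  intro α
  rw [opp_sign]
  generalize F.sign α = a
  revert a
  decide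

end Face

/-- Half of the faces with a given support lie on the positive side of a hyperplane not containing
it. -/
theorem two_mul_card_filter_sign [Finite W] {X : Flat W} {β : UnitNormal W}
    (h : ∀ K ∈ facesWithSupport X, K.sign β ≠ 0) :
    2 * ((facesWithSupport X).filter fun K => K.sign β = 1).card = (facesWithSupport X).card := by
  classical
  rw [← Finset.card_filter_add_card_filter_not (s := facesWithSupport X) fun K => K.sign β = 1,
    two_mul]
  congr 1
  have hopp : ∀ K ∈ facesWithSupport X, K.opp ∈ facesWithSupport X := fun K hK => by
    rw [mem_facesWithSupport, Face.opp_support]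
    exact mem_facesWithSupport.1 hK
  refine Finset.card_nbij' Face.opp Face.opp ?_ ?_ (fun K _ => K.opp_opp) fun K _ => K.opp_opp
  · intro K hK
    rw [Finset.mem_coe, Finset.mem_filter] at hK ⊢
    refine ⟨hopp K hK.1, ?_⟩
    rw [Face.opp_sign, hK.2]
    decide
  · intro K hK
    rw [Finset.mem_coe, Finset.mem_filter] at hK ⊢
    refine ⟨hopp K hK.1, ?_⟩
    have h1 := h K hK.1
    have h2 := hK.2
    rw [Face.opp_sign]
    generalize K.sign β = a at h1 h2
    revert a
    decide

namespace IsSimpleSystem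

variable {C : Face W} {ι : Type*} [Fintype ι] {α : ι → UnitNormal W}
variable [FiniteDimensional ℝ V] [Finite W]

/-- For a two-dimensional flat every chamber has as many ray factorizations as the flat has
chambers. -/
theorem rayFactorizations_face_pair (h : IsSimpleSystem C α) (hC : C.IsChamber)
    (hW : IsEssentialReflectionGroup W) {i j : ι} (hij : i ≠ j) :
    rayFactorizations (h.face hC hW {i, j}) =
      (facesWithSupport (h.face hC hW {i, j}).flat).card := by
  classical
  set G := h.face hC hW {i, j} with hG
  have hGC : G * C = C := h.face_le hC hW _
  -- multiplication by a ray of `G`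
  have key : ∀ k l : ι, k ≠ l → ({k, l} : Set ι) = {i, j} → ∀ K ∈ facesWithSupport G.flat,
      (h.face hC hW {k} * K = G ↔ K.sign (α l) = 1) := by
    intro k l hkl hkl' K hK
    rw [mem_facesWithSupport, Face.flat_space] at hK
    have hKs := Face.support_eq_iff_sign.1 hK
    have hl : l ∈ ({i, j} : Set ι) := by rw [← hkl']; simp
    have hGl : G.sign (α l) = 1 :=
      (h.sign_nonneg_of_le hGC l).resolve_left fun h0 =>
        (h.face_sign_eq_zero_iff hC hW _ l).1 h0 hl
    have hkl0 : (h.face hC hW {k}).sign (α l) = 0 :=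
      (h.face_sign_eq_zero_iff hC hW _ l).2 (by simpa using hkl.symm)
    constructor
    · intro h1
      have h2 := congrArg (fun F : Face W => F.sign (α l)) h1
      simpa only [Face.mul_sign, hkl0, if_true, hGl] using h2
    · intro h1
      have hsign : ∀ m, (h.face hC hW {k} * K).sign (α m) = if m ∈ ({i, j} : Set ι) then 1 else 0 := by
        intro m
        rw [Face.mul_sign]
        simp only [h.face_sign_eq_zero_iff hC hW]
        by_cases hmk : m = k
        · subst hmk
          have : m ∈ ({i, j} : Set ι) := by rw [← hkl']; simp
          rw [if_neg (by simp), if_pos this]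
          exact (h.sign_nonneg_of_le (h.face_le hC hW _) m).resolve_left fun h0 =>
            (h.face_sign_eq_zero_iff hC hW _ m).1 h0 rfl
        · rw [if_pos (by simpa using hmk)]
          split_ifs with hm
          · rw [← hkl'] at hm
            rw [hm.resolve_left hmk, h1]
          · exact (hKs _).2 ((h.face_sign_eq_zero_iff hC hW _ m).2 hm)
      have hle : h.face hC hW {k} * K * C = C := by
        obtain ⟨x, hx⟩ := (h.face hC hW {k} * K).exists_eq_ofPoint
        rw [hx]
        apply h.le_of_inner_nonneg hC
        intro m
        have h2 := hsign m
        rw [hx, Face.ofPoint_sign] at h2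
        split_ifs at h2
        · exact (sign_eq_one_iff.1 h2).le
        · exact (sign_eq_zero_iff.1 h2).ge
      refine h.eq_of_le hC hle hGC fun m => ?_
      rw [hsign, h.face_sign_eq_zero_iff hC hW]
      split_ifs with hm <;> simp [hm]
  -- A ray of `G` completes exactly the faces on the correct side of the other wall, which are half
  -- of all by opposition; the two rays together account for all.
  have hcard : ∀ k l : ι, k ≠ l → ({k, l} : Set ι) = {i, j} →
      2 * ∑ K ∈ facesWithSupport G.flat, (if h.face hC hW {k} * K = G then 1 else 0) =
        (facesWithSupport G.flat).card := by
    intro k l hkl hkl'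
    have hl : l ∈ ({i, j} : Set ι) := by rw [← hkl']; simp
    rw [← two_mul_card_filter_sign (X := G.flat) (β := α l), Finset.card_filter]
    · congr 1
      refine Finset.sum_congr rfl fun K hK => ?_
      simp only [key k l hkl hkl' K hK]
    · intro K hK h0
      rw [mem_facesWithSupport, Face.flat_space] at hK
      exact (h.face_sign_eq_zero_iff hC hW _ l).1 ((Face.support_eq_iff_sign.1 hK _).1 h0) hl
  have hne : h.face hC hW {i} ≠ h.face hC hW {j} := fun h1 =>
    hij (Set.singleton_injective (h.face_injective hC hW h1))
  have hray : ∀ k ∈ ({i, j} : Set ι), h.face hC hW {k} ∈ raysIn G.flat := by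
    intro k hk
    rw [mem_raysIn, h.face_dim hC hW, Set.ncard_singleton, Face.flat_space,
      h.face_support_le_iff hC hW, Set.singleton_subset_iff]
    exact ⟨rfl, hk⟩
  rw [ReflArr.rayFactorizations_eq (Face.flat_space G).symm, Finset.card_filter, Finset.sum_product,
    ← Finset.sum_subset (s₁ := {h.face hC hW {i}, h.face hC hW {j}}), Finset.sum_pair hne]
  · have e1 := hcard i j hij rfl
    have e2 := hcard j i hij.symm (Set.pair_comm j i)
    dsimp only
    omega
  · intro F hF
    rcases Finset.mem_insert.1 hF with rfl | hF
    · exact hray i (by simp)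
    · rw [Finset.mem_singleton.1 hF]
      exact hray j (by simp)
  -- A left factor of `G` is a face of `G`, so the only rays that occur are the two rays of the
  -- chamber in this plane.
  · intro F hF hF'
    refine Finset.sum_eq_zero fun K _ => if_neg fun hFK => hF' ?_
    rw [mem_raysIn] at hF
    have hFG : F * G = G := by
      rw [← hFK, ← mul_assoc, Face.mul_eq_left_iff.2 le_rfl]
    have hFC : F * C = C := by
      rw [← hGC, ← mul_assoc, hFG]
    obtain ⟨k, rfl⟩ := h.exists_eq_face_singleton hC hW hFC hF.1
    have hk := hF.2
    rw [Face.flat_space, h.face_support_le_iff hC hW, Set.singleton_subset_iff] at hk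
    rcases hk with rfl | hk
    · exact Finset.mem_insert_self _ _
    · rw [Set.mem_singleton_iff.1 hk]
      exact Finset.mem_insert_of_mem (Finset.mem_singleton_self _)

/-- On a line spanned by a ray of the chamber only one simple coordinate is non-zero, so every
normal restricts to a multiple of it and transport is always compatible. -/
theorem rayFactorizations_face_singleton (h : IsSimpleSystem C α) (hC : C.IsChamber)
    (hW : IsEssentialReflectionGroup W) (i j : ι) :
    rayFactorizations (h.face hC hW {i}) = rayFactorizations (h.face hC hW {j}) := by
  have key : ∀ {i j : ι} (e : ({i} : Set ι) ≃ ({j} : Set ι)),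
      IsTransport α (fun _ => 1) e := by
    intro i j e β
    have h0 : ∃ c : ι → ℝ, β.vec = ∑ k, c k • (α k).vec := by
      rcases Face.sign_eq_one_or_neg hC β with hβ | hβ
      · obtain ⟨c, -, hc⟩ := h.cone β hβ
        exact ⟨c, hc⟩
      · obtain ⟨c, -, hc⟩ := h.cone _ hβ
        refine ⟨-c, ?_⟩
        rw [UnitNormal.neg_vec] at hc
        rw [← neg_neg β.vec, hc, ← Finset.sum_neg_distrib]
        simp only [Pi.neg_apply, neg_smul]
    obtain ⟨c, hc⟩ := h0
    refine ⟨α i, c j, fun x y _ hy hxy => ?_⟩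
    have h1 := hxy ⟨i, rfl⟩
    have h2 : (e ⟨i, rfl⟩ : ι) = j := (e ⟨i, rfl⟩).2
    rw [h2, one_mul, one_mul] at h1
    rw [inner_eq_sum hc, ← h1]
    exact Finset.sum_eq_single j (fun k _ hk => by rw [hy k hk, mul_zero])
      fun hj => absurd (Finset.mem_univ j) hj
  let e : ({i} : Set ι) ≃ ({j} : Set ι) := Equiv.ofUnique _ _
  exact h.rayFactorizations_face_eq hC hW (fun _ => one_pos) e (key e) (key e.symm)

/-- Faces of codimension one in a chamber have equally many ray factorizations in rank three if
the corresponding simple reflections are conjugate. -/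
theorem rayFactorizations_face_compl (h : IsSimpleSystem C α) (hC : C.IsChamber)
    (hW : IsEssentialReflectionGroup W) (h3 : Fintype.card ι = 3) {k l : ι}
    (hkl : IsConj (α k).s (α l).s) :
    rayFactorizations (h.face hC hW {k}ᶜ) = rayFactorizations (h.face hC hW {l}ᶜ) := by
  classical
  have hpair : ∀ k : ι, ∃ i j, i ≠ j ∧ ({k}ᶜ : Set ι) = {i, j} := by
    intro k
    rw [← Set.ncard_eq_two, Set.ncard_compl, Set.ncard_singleton, Nat.card_eq_fintype_card, h3]
  have hN : ∀ k : ι, rayFactorizations (h.face hC hW {k}ᶜ) =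
      (facesWithSupport (h.face hC hW {k}ᶜ).flat).card := by
    intro k
    obtain ⟨i, j, hij, hk⟩ := hpair k
    rw [hk, h.rayFactorizations_face_pair hC hW hij]
  have hsupp : ∀ (k : ι) (x : V), x ∈ (h.face hC hW {k}ᶜ).support ↔
      (inner ℝ (α k).vec x : ℝ) = 0 := by
    intro k x
    rw [h.mem_face_support hC hW]
    simp
  obtain ⟨w, hw⟩ := isConj_iff.1 hkl
  have hs : (w • α k).s = (α l).s := by rw [UnitNormal.s_smul, hw]
  have h1 : (w • h.face hC hW {k}ᶜ).support = (h.face hC hW {l}ᶜ).support := by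
    ext x
    rw [hsupp, Face.map_support, Submodule.mem_map_equiv, hsupp]
    change (inner ℝ (α k).vec (w⁻¹.1 x) : ℝ) = 0 ↔ _
    rw [← UnitNormal.inner_smul_left]
    rcases UnitNormal.eq_or_eq_neg_of_s_eq hs with h2 | h2
    · rw [h2]
    · rw [h2, UnitNormal.neg_vec, inner_neg_left, neg_eq_zero]
  rw [hN, hN]
  refine Finset.card_nbij' (fun F => w • F) (fun F => w⁻¹ • F) ?_ ?_ ?_ ?_
  · intro F hF
    rw [Finset.mem_coe, mem_facesWithSupport, Face.flat_space] at hF ⊢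
    rw [← h1]
    exact (Face.smul_support_eq_iff w).2 hF
  · intro F hF
    rw [Finset.mem_coe, mem_facesWithSupport, Face.flat_space] at hF ⊢
    rw [← h1] at hF
    rw [← Face.smul_support_eq_iff w, smul_inv_smul, hF]
  · exact fun F _ => inv_smul_smul w F
  · exact fun F _ => smul_inv_smul w F

/-- In dimension 0 and in full dimension the chamber has a single face, and dimension one needs no
hypothesis. What remains is dimension two in rank three, where conjugacy of the simple reflections
is used. -/
theorem hasUniformRays_of_card_le_three (h : IsSimpleSystem C α) (hC : C.IsChamber)
    (hW : IsEssentialReflectionGroup W) (h3 : Fintype.card ι ≤ 3)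
    (hconj : Fintype.card ι = 3 → ∀ i j, IsConj (α i).s (α j).s) : HasUniformRays W := by
  refine h.hasUniformRays hC hW fun I J hIJ => ?_
  have hle := Set.ncard_le_card I
  rw [Nat.card_eq_fintype_card] at hle
  have huniv : ∀ {I : Set ι}, I.ncard = Fintype.card ι → I = Set.univ := by
    intro I hI
    refine Set.eq_of_subset_of_ncard_le (Set.subset_univ I) ?_
    rw [Set.ncard_univ, Nat.card_eq_fintype_card, hI]
  by_cases hI0 : I.ncard = 0
  · rw [(Set.ncard_eq_zero (Set.toFinite I)).1 hI0,
      (Set.ncard_eq_zero (Set.toFinite J)).1 (hIJ.symm.trans hI0)]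
  by_cases hIn : I.ncard = Fintype.card ι
  · rw [huniv (I := I) hIn, huniv (I := J) (hIJ.symm.trans hIn)]
  by_cases hI1 : I.ncard = 1
  · obtain ⟨i, rfl⟩ := Set.ncard_eq_one.1 hI1
    obtain ⟨j, rfl⟩ := Set.ncard_eq_one.1 (hIJ ▸ hI1)
    exact h.rayFactorizations_face_singleton hC hW i j
  have hcard : Fintype.card ι = 3 := by omega
  have hcompl : ∀ {I : Set ι}, I.ncard = 2 → ∃ k, I = {k}ᶜ := by
    intro I hI
    obtain ⟨k, hk⟩ := Set.ncard_eq_one.1 (show Iᶜ.ncard = 1 by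
      rw [Set.ncard_compl, hI, Nat.card_eq_fintype_card, hcard])
    exact ⟨k, by rw [← hk, compl_compl]⟩
  obtain ⟨k, rfl⟩ := hcompl (show I.ncard = 2 by omega)
  obtain ⟨l, rfl⟩ := hcompl (show J.ncard = 2 by omega)
  exact h.rayFactorizations_face_compl hC hW hcard (hconj hcard k l)

/-- A labelling of the simple reflections labels the simple normals. -/
theorem exists_reindex (h : IsSimpleSystem C α) (hC : C.IsChamber)
    (hW : IsEssentialReflectionGroup W) {B : Type*} (e : B ≃ simpleReflections C) :
    ∃ κ : B ≃ ι, ∀ b, (α (κ b)).s = (e b : W) := by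
  have hb : Function.Bijective fun i =>
      (⟨(α i).s, by rw [h.simpleReflections_eq hC hW]; exact ⟨i, rfl⟩⟩ : simpleReflections C) := by
    constructor
    · exact fun i j hij => h.s_injective (congrArg Subtype.val hij)
    · rintro ⟨s, hs⟩
      have hs' := hs
      rw [h.simpleReflections_eq hC hW] at hs'
      obtain ⟨i, hi⟩ := hs'
      exact ⟨i, Subtype.ext hi⟩
  refine ⟨e.trans (Equiv.ofBijective _ hb).symm, fun b => ?_⟩
  exact congrArg Subtype.val ((Equiv.ofBijective _ hb).apply_symm_apply (e b))

end IsSimpleSystem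

/-- Two involutions whose product has odd order are conjugate. -/
theorem isConj_of_odd_orderOf {G : Type*} [Group G] {s t : G} (hs : s * s = 1) (ht : t * t = 1)
    (h : Odd (orderOf (s * t))) : IsConj t s := by
  obtain ⟨k, hk⟩ := h
  have hr : (s * t) ^ (2 * k + 1) = 1 := by rw [← hk, pow_orderOf_eq_one]
  have hs' : s⁻¹ = s := inv_eq_of_mul_eq_one_right hs
  have ht' : t⁻¹ = t := inv_eq_of_mul_eq_one_right ht
  have h1 : SemiconjBy t (s * t)⁻¹ (s * t) := by
    unfold SemiconjBy
    rw [mul_inv_rev, hs', ht', ← mul_assoc, ht, one_mul, mul_assoc, ht, mul_one]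
  have h2 := h1.pow_right (k + 1)
  rw [inv_pow] at h2
  -- With r = st of order 2k + 1, t inverts r, so conjugating t by r^(k+1) gives r^(2k+2) t = r t =
  -- s.
  refine isConj_iff.2 ⟨(s * t) ^ (k + 1), ?_⟩
  rw [mul_assoc, h2.eq, ← mul_assoc, ← pow_add, show k + 1 + (k + 1) = 2 * k + 1 + 1 by ring,
    pow_succ, hr, one_mul, mul_assoc, ht, mul_one]

/-! ### Inner products from the Coxeter matrix -/

namespace IsSimpleSystem

variable {C : Face W} {ι : Type*} [Fintype ι] {α : ι → UnitNormal W}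

theorem pair_linInd (h : IsSimpleSystem C α) {i j : ι} (hij : i ≠ j) {a b : ℝ}
    (hab : a • (α i).vec + b • (α j).vec = 0) : a = 0 ∧ b = 0 := by
  have h1 : LinearIndependent ℝ ![(α i).vec, (α j).vec] := by
    have h2 := h.linInd.comp ![i, j] (by
      intro a b hab
      fin_cases a <;> fin_cases b <;> simp_all)
    convert h2 using 1
    funext a
    fin_cases a <;> rfl
  exact LinearIndependent.pair_iff.1 h1 a b hab

/-- The reflected normal has the reflection of `α j`, so it is `α j` up to sign; the negative sign
would be a linear relation between two simple normals. -/
theorem inner_eq_zero_of_s_smul_eq (h : IsSimpleSystem C α) {i j : ι} (hij : i ≠ j)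
    (hs : (α i).s * (α j).s * (α i).s = (α j).s) :
    (inner ℝ (α i).vec (α j).vec : ℝ) = 0 := by
  have h1 : ((α i).s • α j).s = (α j).s := by rw [UnitNormal.s_smul, UnitNormal.s_inv, hs]
  set c : ℝ := inner ℝ (α i).vec (α j).vec with hc
  have h2 : ((α i).s • α j).vec = (α j).vec - (2 * c) • (α i).vec := UnitNormal.s_apply _ _
  rcases UnitNormal.eq_or_eq_neg_of_s_eq h1 with h3 | h3
  · have h4 := congrArg UnitNormal.vec h3
    rw [h2, sub_eq_self] at h4
    have := (smul_eq_zero.1 h4).resolve_right (α i).vec_ne_zero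
    linarith
  · have h4 := congrArg UnitNormal.vec h3
    rw [h2, UnitNormal.neg_vec] at h4
    have h5 := h.pair_linInd hij (a := -(2 * c)) (b := 2) (by
      rw [two_smul, neg_smul]
      rw [sub_eq_iff_eq_add] at h4
      nth_rewrite 2 [h4]
      abel)
    exact absurd h5.2 two_ne_zero

theorem inner_eq_zero_of_sq (h : IsSimpleSystem C α) {i j : ι} (hij : i ≠ j)
    (ho : ((α i).s * (α j).s) ^ 2 = 1) : (inner ℝ (α i).vec (α j).vec : ℝ) = 0 := by
  apply h.inner_eq_zero_of_s_smul_eq hij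
  have h1 : (α i).s * (α j).s * (α i).s * (α j).s = 1 := by
    rw [← ho, pow_two]; group
  rw [eq_inv_of_mul_eq_one_left h1, UnitNormal.s_inv]

/-- The braid relation says that s_i α_j and s_j α_i have the same reflection. Comparing
coefficients gives 2c = ±1 for the inner product c, and obtuseness selects the sign. -/
theorem inner_of_orderOf_eq_three (h : IsSimpleSystem C α) {i j : ι} (hij : i ≠ j)
    (ho : orderOf ((α i).s * (α j).s) = 3) :
    2 * (inner ℝ (α i).vec (α j).vec : ℝ) = -1 := by
  have ho' : ((α i).s * (α j).s) ^ 3 = 1 := by rw [← ho, pow_orderOf_eq_one]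
  have h0 : (α i).s * (α j).s * (α i).s = (α j).s * (α i).s * (α j).s := by
    have h1 : (α i).s * (α j).s * (α i).s * ((α j).s * (α i).s * (α j).s) = 1 := by
      rw [← ho', pow_succ, pow_two]; simp only [mul_assoc]
    rw [eq_inv_of_mul_eq_one_left h1]
    simp only [mul_inv_rev, UnitNormal.s_inv, mul_assoc]
  have h1 : ((α i).s • α j).s = ((α j).s • α i).s := by
    rw [UnitNormal.s_smul, UnitNormal.s_smul, UnitNormal.s_inv, UnitNormal.s_inv, h0]
  have hle := h.inner_nonpos i j hij
  set c : ℝ := inner ℝ (α i).vec (α j).vec with hc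
  have h2 : ((α i).s • α j).vec = (α j).vec - (2 * c) • (α i).vec := UnitNormal.s_apply _ _
  have h3 : ((α j).s • α i).vec = (α i).vec - (2 * c) • (α j).vec := by
    rw [hc, real_inner_comm]; exact UnitNormal.s_apply _ _
  rcases UnitNormal.eq_or_eq_neg_of_s_eq h1 with h4 | h4
  · have h5 := congrArg UnitNormal.vec h4
    rw [h2, h3] at h5
    have h6 := h.pair_linInd hij (a := -(2 * c) - 1) (b := 1 + 2 * c) (by
      rw [← sub_eq_zero] at h5
      rw [← h5, sub_smul, add_smul, neg_smul, one_smul, one_smul]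
      abel)
    linarith [h6.2]
  · have h5 := congrArg UnitNormal.vec h4
    rw [UnitNormal.neg_vec, h2, h3] at h5
    have h6 := h.pair_linInd hij (a := -(2 * c) + 1) (b := 1 - 2 * c) (by
      rw [← sub_eq_zero] at h5
      rw [← h5, sub_smul, add_smul, neg_smul, one_smul, one_smul]
      abel)
    linarith [h6.2]

/-- The reflection of γ = s_i α_j commutes with s_j, so γ is orthogonal to α_j, that is 1 - 2c² = 0
for the inner product c. The alternative γ = ±α_j is excluded since c = 0 would make the order
divide 2. -/
theorem inner_of_orderOf_eq_four (h : IsSimpleSystem C α) {i j : ι} (hij : i ≠ j)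
    (ho : orderOf ((α i).s * (α j).s) = 4) :
    √2 * (inner ℝ (α i).vec (α j).vec : ℝ) = -1 := by
  have ho' : ((α i).s * (α j).s) ^ 4 = 1 := by rw [← ho, pow_orderOf_eq_one]
  have hle := h.inner_nonpos i j hij
  set c : ℝ := inner ℝ (α i).vec (α j).vec with hc
  have hc0 : c ≠ 0 := by
    intro h0
    have h1 : (α i).s • α j = α j := by
      apply UnitNormal.ext
      rw [UnitNormal.smul_vec, UnitNormal.s_apply, ← hc, h0, mul_zero, zero_smul, sub_zero]
    have h2 := UnitNormal.s_smul (α i).s (α j)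
    rw [h1, UnitNormal.s_inv] at h2
    have h3 : ((α i).s * (α j).s) ^ 2 = 1 := by
      rw [pow_two, ← mul_assoc, ← h2, UnitNormal.s_mul_self]
    have h4 := orderOf_dvd_of_pow_eq_one h3
    rw [ho] at h4
    exact absurd h4 (by decide)
  set γ := (α i).s • α j with hγ
  have hγs : γ.s = (α i).s * (α j).s * (α i).s := by
    rw [hγ, UnitNormal.s_smul, UnitNormal.s_inv]
  have h1 : (γ.s • α j).s = (α j).s := by
    rw [UnitNormal.s_smul, UnitNormal.s_inv, hγs]
    have h2 : (α i).s * (α j).s * (α i).s * (α j).s * ((α i).s * (α j).s * (α i).s) * (α j).s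
        = 1 := by
      rw [← ho', pow_succ, pow_succ, pow_two]; simp only [mul_assoc]
    rw [eq_inv_of_mul_eq_one_left h2, UnitNormal.s_inv]
  have h2 : γ.vec = (α j).vec - (2 * c) • (α i).vec := UnitNormal.s_apply _ _
  set d : ℝ := inner ℝ γ.vec (α j).vec with hd
  have hd' : d = 1 - 2 * c * c := by
    rw [hd, h2, inner_sub_left, real_inner_smul_left, (α j).inner_self]
  have h3 : (γ.s • α j).vec = (α j).vec - (2 * d) • γ.vec := UnitNormal.s_apply _ _
  have hd0 : d = 0 := by
    rcases UnitNormal.eq_or_eq_neg_of_s_eq h1 with h4 | h4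
    · have h5 := congrArg UnitNormal.vec h4
      rw [h3, sub_eq_self] at h5
      have := (smul_eq_zero.1 h5).resolve_right γ.vec_ne_zero
      linarith
    · have h5 := congrArg UnitNormal.vec h4
      rw [h3, UnitNormal.neg_vec, h2] at h5
      have h6 := h.pair_linInd hij (a := 2 * d * (2 * c)) (b := 2 - 2 * d) (by
        rw [← sub_eq_zero] at h5
        rw [← h5, smul_sub, smul_smul, sub_smul, two_smul]
        abel)
      have h7 : d = 1 := by linarith [h6.2]
      have h8 := h6.1
      rw [h7] at h8
      exact absurd (by linarith) hc0
  have hsq : √2 * √2 = (2 : ℝ) := Real.mul_self_sqrt (by norm_num)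
  have h9 : (√2 * c - 1) * (√2 * c + 1) = 0 := by
    have : (√2 * c - 1) * (√2 * c + 1) = √2 * √2 * (c * c) - 1 := by ring
    rw [this, hsq]
    linarith
  rcases mul_eq_zero.1 h9 with h10 | h10
  · have : √2 * c ≤ 0 := mul_nonpos_of_nonneg_of_nonpos (Real.sqrt_nonneg 2) hle
    linarith
  · linarith

/-- A property of vectors that holds for the simple normals and is preserved by the simple
reflections holds for all unit normals. -/
theorem forall_unitNormal [Finite W] (h : IsSimpleSystem C α) (hC : C.IsChamber)
    (hW : IsEssentialReflectionGroup W) {Q : V → Prop} (h0 : ∀ i, Q (α i).vec)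
    (hs : ∀ i v, Q v → Q ((α i).s.1 v)) (β : UnitNormal W) : Q β.vec := by
  obtain ⟨w, -, i, hw⟩ := h.exists_smul_eq hC β
  obtain ⟨l, hl⟩ := h.exists_word hC hW w⁻¹
  have hβ : β.vec = ((l.map fun i => (α i).s).prod).1 (α i).vec := by
    rw [hl, ← UnitNormal.smul_vec, ← hw, inv_smul_smul]
  rw [hβ]
  clear hl hβ
  induction l with
  | nil => exact h0 i
  | cons j t ih =>
    rw [List.map_cons, List.prod_cons]
    exact hs j _ ih

end IsSimpleSystem

/-! ### Types `A` and `B` -/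

/-- The vector `v` is a multiple of a unit normal. -/
def IsNormalMultiple (W : Subgroup (V ≃ₗᵢ[ℝ] V)) (v : V) : Prop :=
  ∃ (γ : UnitNormal W) (t : ℝ), v = t • γ.vec

namespace IsNormalMultiple

theorem smul {v : V} (h : IsNormalMultiple W v) (c : ℝ) : IsNormalMultiple W (c • v) := by
  obtain ⟨γ, t, rfl⟩ := h
  exact ⟨γ, c * t, smul_smul _ _ _⟩

theorem neg {v : V} (h : IsNormalMultiple W v) : IsNormalMultiple W (-v) := by
  rw [← neg_one_smul ℝ v]
  exact h.smul _

theorem map {v : V} (h : IsNormalMultiple W v) (w : W) : IsNormalMultiple W (w.1 v) := by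
  obtain ⟨γ, t, rfl⟩ := h
  exact ⟨w • γ, t, map_smul w.1 t γ.vec⟩

end IsNormalMultiple

/-- The sum of the simple normals from the `i`-th on, rescaled by `μ`. In types `A` and `B` these
are the coordinate vectors (in type `A` up to a common translation). -/
def tail {n : ℕ} (μ : Fin n → ℝ) (α : Fin n → UnitNormal W) (i : ℕ) : V :=
  ∑ l : Fin n, if i ≤ l.1 then μ l • (α l).vec else 0

section Tail

variable {n : ℕ} {μ : Fin n → ℝ} {α : Fin n → UnitNormal W}

theorem tail_of_le {i : ℕ} (hi : n ≤ i) : tail μ α i = 0 :=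
  Finset.sum_eq_zero fun l _ => if_neg (by have := l.2; omega)

theorem tail_min (i : ℕ) : tail μ α (min i n) = tail μ α i := by
  rcases le_total i n with h | h
  · rw [min_eq_left h]
  · rw [min_eq_right h, tail_of_le le_rfl, tail_of_le h]

theorem tail_eq_add (m : Fin n) : tail μ α m = μ m • (α m).vec + tail μ α (m + 1) := by
  have h1 : ∀ l : Fin n, (if m.1 ≤ l.1 then μ l • (α l).vec else 0) =
      (if l = m then μ l • (α l).vec else 0) +
        if m.1 + 1 ≤ l.1 then μ l • (α l).vec else 0 := by
    intro l
    by_cases h : l = m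
    · subst h
      simp
    · have h' : l.1 ≠ m.1 := fun h' => h (Fin.ext h')
      rw [if_neg h, zero_add]
      congr 1
      simp only [eq_iff_iff]
      omega
  unfold tail
  rw [Finset.sum_congr rfl fun l _ => h1 l, Finset.sum_add_distrib, Finset.sum_ite_eq',
    if_pos (Finset.mem_univ m)]

theorem inner_tail_eq_sum {I : Set (Fin n)} {x : V}
    (hx : ∀ i ∉ I, (inner ℝ (α i).vec x : ℝ) = 0) (i : ℕ) :
    (inner ℝ (tail μ α i) x : ℝ) =
      ∑ l ∈ (Set.toFinite I).toFinset.attach,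
        if i ≤ l.1.1 then μ l.1 * (inner ℝ (α l.1).vec x : ℝ) else 0 := by
  rw [Finset.sum_attach (Set.toFinite I).toFinset
    (fun l => if i ≤ l.1 then μ l * (inner ℝ (α l).vec x : ℝ) else 0), tail, sum_inner]
  symm
  rw [Finset.sum_subset (Finset.subset_univ _)]
  · refine Finset.sum_congr rfl fun l _ => ?_
    split_ifs
    · rw [real_inner_smul_left]
    · rw [inner_zero_left]
  · intro l _ hl
    rw [Set.Finite.mem_toFinset] at hl
    rw [hx l hl, mul_zero, ite_self]

/-- If the unit normals are the combinations `tail i + s tail j`, with signs `s` in a fixed set,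
then monotone transport of coordinates is compatible with the arrangement. -/
theorem isTransport_of_tail (S : Set ℝ)
    (h1 : ∀ β : UnitNormal W, ∃ (c : ℝ) (i j : ℕ), ∃ s ∈ S,
      β.vec = c • (tail μ α i + s • tail μ α j))
    (h2 : ∀ i j : ℕ, ∀ s ∈ S, IsNormalMultiple W (tail μ α i + s • tail μ α j))
    {I J : Set (Fin n)} (e : I ≃o J) : IsSimpleSystem.IsTransport α μ e.toEquiv := by
  classical
  -- Monotonicity of `e` enters here: the preimage of a final segment of `J` is a final segment of
  -- `I`, so tails restrict to tails.
  have hτ : ∀ i : ℕ, ∃ k : ℕ, ∀ m : I, i ≤ (e m).1.1 ↔ k ≤ m.1.1 := by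
    intro i
    by_cases hex : ∃ k : ℕ, ∃ m : I, m.1.1 = k ∧ i ≤ (e m).1.1
    · refine ⟨Nat.find hex, fun m => ⟨fun hm => Nat.find_min' hex ⟨m, rfl, hm⟩, fun hm => ?_⟩⟩
      obtain ⟨m₀, hm₀, hi⟩ := Nat.find_spec hex
      rw [← hm₀] at hm
      have : e m₀ ≤ e m := e.monotone hm
      exact hi.trans this
    · push Not at hex
      -- The threshold `n` is reached by no index and encodes the empty segment, whose tail is zero.
      refine ⟨n, fun m => ⟨fun hm => ?_, fun hm => ?_⟩⟩
      · have := hex m.1.1 m rfl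
        omega
      · have := m.1.2
        omega
  choose τ hτ using hτ
  intro β
  obtain ⟨c, i, j, s, hs, hβ⟩ := h1 β
  obtain ⟨γ, t, hγ⟩ := h2 (τ i) (τ j) s hs
  refine ⟨γ, c * t, fun x y hx hy hxy => ?_⟩
  have key : ∀ i : ℕ, (inner ℝ (tail μ α i) y : ℝ) = inner ℝ (tail μ α (τ i)) x := by
    intro i
    rw [inner_tail_eq_sum hx, inner_tail_eq_sum hy]
    symm
    refine Finset.sum_bij (fun l _ => ⟨(e ⟨l.1, (Set.Finite.mem_toFinset _).1 l.2⟩).1,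
      (Set.Finite.mem_toFinset _).2 (e ⟨l.1, (Set.Finite.mem_toFinset _).1 l.2⟩).2⟩) ?_ ?_ ?_ ?_
    · exact fun _ _ => Finset.mem_attach _ _
    · intro a _ b _ hab
      have h3 := e.injective (Subtype.ext (Subtype.mk.inj hab))
      exact Subtype.ext (Subtype.mk.inj h3)
    · intro b _
      have hb := (Set.Finite.mem_toFinset _).1 b.2
      refine ⟨⟨(e.symm ⟨b.1, hb⟩).1, (Set.Finite.mem_toFinset _).2 (e.symm ⟨b.1, hb⟩).2⟩,
        Finset.mem_attach _ _, Subtype.ext ?_⟩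
      dsimp only
      rw [Subtype.coe_eta, OrderIso.apply_symm_apply]
    · intro a _
      have ha := (Set.Finite.mem_toFinset _).1 a.2
      have h3 := hxy ⟨a.1, ha⟩
      have h4 := hτ i ⟨a.1, ha⟩
      dsimp only at h3 h4 ⊢
      simp only [h4]
      split_ifs
      · exact h3.symm
      · rfl
  have hγ' : t * (inner ℝ γ.vec x : ℝ) =
      inner ℝ (tail μ α (τ i)) x + s * inner ℝ (tail μ α (τ j)) x := by
    rw [← real_inner_smul_left, ← hγ, inner_add_left, real_inner_smul_left]
  rw [hβ, real_inner_smul_left, inner_add_left, real_inner_smul_left, key, key, mul_assoc, hγ']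

/-- The Gram matrix of types `A` and `B` after rescaling, with diagonal `D`. -/
def HasGram (μ : Fin n → ℝ) (α : Fin n → UnitNormal W) (D : Fin n → ℝ) : Prop :=
  ∀ m l : Fin n, μ m * μ l * (inner ℝ (α m).vec (α l).vec : ℝ) =
    if m = l then D m else if l.1 + 1 = m.1 ∨ m.1 + 1 = l.1 then -1 else 0

/-- Only the terms m, m - 1 and m + 1 of the tail contribute; the three conditions say when each of
them is present, the last one also that m + 1 is still an index. -/
theorem HasGram.inner_tail {D : Fin n → ℝ} (hG : HasGram μ α D) (m : Fin n) {i : ℕ} (hi : i ≤ n) :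
    μ m * (inner ℝ (α m).vec (tail μ α i) : ℝ) =
      (if i ≤ m.1 then D m else 0) - (if i + 1 ≤ m.1 then 1 else 0) -
        if i ≤ m.1 + 1 ∧ m.1 + 1 < n then 1 else 0 := by
  obtain ⟨d, hd⟩ := Nat.exists_eq_add_of_le hi
  induction d generalizing i with
  | zero =>
    have := m.2
    rw [tail_of_le (by omega), inner_zero_right, if_neg (by omega), if_neg (by omega),
      if_neg (by omega)]
    ring
  | succ d ih =>
    have h1 := tail_eq_add (μ := μ) (α := α) ⟨i, by omega⟩
    dsimp only at h1
    have h2 := hG m ⟨i, by omega⟩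
    have h3 : μ m * (inner ℝ (α m).vec (tail μ α i) : ℝ) =
        μ m * μ ⟨i, by omega⟩ * (inner ℝ (α m).vec (α ⟨i, by omega⟩).vec : ℝ) +
          μ m * inner ℝ (α m).vec (tail μ α (i + 1)) := by
      rw [h1, inner_add_right, real_inner_smul_right]
      ring
    rw [h3, h2, ih (by omega) (by omega)]
    simp only [Fin.ext_iff]
    have := m.2
    split_ifs <;> first | (exfalso; omega) | ring

/-- The rescaled simple normal is the difference of consecutive tails and has squared norm `D m`;
this is the reflection formula for that vector. -/
theorem HasGram.s_tail {D : Fin n → ℝ} (hG : HasGram μ α D) (m : Fin n)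
    (hD : D m ≠ 0) (v : V) : (α m).s.1 v = v -
      (2 / D m * (μ m * inner ℝ (α m).vec v)) • (tail μ α m - tail μ α (m + 1)) := by
  have h1 := hG m m
  rw [if_pos rfl, (α m).inner_self, mul_one] at h1
  have hμ : μ m ≠ 0 := fun h0 => hD (by rw [← h1, h0, zero_mul])
  rw [tail_eq_add m, add_sub_cancel_right, UnitNormal.s_apply, smul_smul, ← h1]
  congr 2
  field_simp

theorem tail_swap (m i : ℕ) : tail μ α (Equiv.swap m (m + 1) i) = tail μ α i -
    ((if i = m then 1 else 0) - (if i = m + 1 then 1 else 0) : ℝ) •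
      (tail μ α m - tail μ α (m + 1)) := by
  by_cases h1 : i = m
  · subst h1
    rw [Equiv.swap_apply_left, if_pos rfl, if_neg (by omega), sub_zero, one_smul, sub_sub_cancel]
  · by_cases h2 : i = m + 1
    · subst h2
      rw [Equiv.swap_apply_right, if_neg (by omega), if_pos rfl, zero_sub, neg_one_smul]
      abel
    · rw [Equiv.swap_apply_of_ne_of_ne h1 h2, if_neg h1, if_neg h2, sub_zero, zero_smul, sub_zero]

theorem swap_le {m i n : ℕ} (hm : m < n) (hi : i ≤ n) : Equiv.swap m (m + 1) i ≤ n := by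
  by_cases h1 : i = m
  · subst h1
    rw [Equiv.swap_apply_left]
    exact hm
  · by_cases h2 : i = m + 1
    · subst h2
      rw [Equiv.swap_apply_right]
      exact hm.le
    · rwa [Equiv.swap_apply_of_ne_of_ne h1 h2]

end Tail

/-! ### Uniform rays in types A and B. -/

namespace IsSimpleSystem

variable {C : Face W} {n : ℕ} {α : Fin n → UnitNormal W}

theorem hasUniformRays_of_tail [FiniteDimensional ℝ V] [Finite W] (h : IsSimpleSystem C α)
    (hC : C.IsChamber) (hW : IsEssentialReflectionGroup W) {μ : Fin n → ℝ} (hμ : ∀ i, 0 < μ i)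
    (S : Set ℝ) (h1 : ∀ β : UnitNormal W, ∃ (c : ℝ) (i j : ℕ), ∃ s ∈ S,
      β.vec = c • (tail μ α i + s • tail μ α j))
    (h2 : ∀ i j : ℕ, ∀ s ∈ S, IsNormalMultiple W (tail μ α i + s • tail μ α j)) :
    HasUniformRays W := by
  refine h.hasUniformRays hC hW fun I J hIJ => ?_
  obtain ⟨e⟩ : Nonempty (I ≃o J) := by
    classical
    have hI : (Set.toFinite I).toFinset.card = J.ncard := by
      rw [← hIJ, Set.ncard_eq_toFinset_card I]
    have hJ : (Set.toFinite J).toFinset.card = J.ncard := by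
      rw [Set.ncard_eq_toFinset_card J]
    have eI := ((Set.toFinite I).toFinset.orderIsoOfFin hI)
    have eJ := ((Set.toFinite J).toFinset.orderIsoOfFin hJ)
    have e := eI.symm.trans eJ
    have cI : I = ((Set.toFinite I).toFinset : Set (Fin n)) := (Set.Finite.coe_toFinset _).symm
    have cJ : J = ((Set.toFinite J).toFinset : Set (Fin n)) := (Set.Finite.coe_toFinset _).symm
    exact ⟨(OrderIso.setCongr _ _ cI).trans (e.trans (OrderIso.setCongr _ _ cJ.symm))⟩
  exact h.rayFactorizations_face_eq hC hW hμ e.toEquiv (isTransport_of_tail S h1 h2 e)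
    (isTransport_of_tail S h1 h2 e.symm)

variable [Finite W]

/-- Here tail i is e_i - e_n. The last simple reflection moves e_n and thus translates all tails by
a common vector, so only differences of tails are permuted. -/
theorem typeA_s_sub {μ : Fin n → ℝ} (hG : HasGram μ α fun _ => 2) (m : Fin n) {i j : ℕ}
    (hi : i ≤ n) (hj : j ≤ n) : (α m).s.1 (tail μ α i + (-1 : ℝ) • tail μ α j) =
      tail μ α (Equiv.swap m.1 (m + 1) i) + (-1 : ℝ) • tail μ α (Equiv.swap m.1 (m + 1) j) := by
  rw [hG.s_tail m two_ne_zero, inner_add_right, real_inner_smul_right, tail_swap, tail_swap]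
  have h1 : ∀ i ≤ n, μ m * (inner ℝ (α m).vec (tail μ α i) : ℝ) =
      (if i = m.1 then 1 else 0) - (if i = m.1 + 1 then 1 else 0) +
        if m.1 + 1 = n then 1 else 0 := by
    intro i hi
    rw [hG.inner_tail m hi]
    have := m.2
    split_ifs <;> first | (exfalso; omega) | norm_num
  have h2 : 2 / 2 * (μ m * ((inner ℝ (α m).vec (tail μ α i) : ℝ) +
      -1 * inner ℝ (α m).vec (tail μ α j))) =
      ((if i = m.1 then 1 else 0) - (if i = m.1 + 1 then 1 else 0)) -
        ((if j = m.1 then 1 else 0) - (if j = m.1 + 1 then 1 else 0)) := by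
    have e1 := h1 i hi
    have e2 := h1 j hj
    linarith
  rw [h2, sub_smul]
  simp only [neg_smul, one_smul, smul_sub]
  abel

theorem hasUniformRays_typeA [FiniteDimensional ℝ V] (h : IsSimpleSystem C α)
    (hC : C.IsChamber) (hW : IsEssentialReflectionGroup W) (hn : 1 ≤ n) {μ : Fin n → ℝ}
    (hμ : ∀ i, 0 < μ i) (hG : HasGram μ α fun _ => 2) : HasUniformRays W := by
  refine h.hasUniformRays_of_tail hC hW hμ {-1} (fun β => ?_) ?_
  -- The bounds by `n` are part of the induction, because swaps describe the reflections only for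
  -- such indices.
  · have := h.forall_unitNormal hC hW
      (Q := fun v => ∃ (c : ℝ) (i j : ℕ), i ≤ n ∧ j ≤ n ∧
        v = c • (tail μ α i + (-1 : ℝ) • tail μ α j)) ?_ ?_ β
    · obtain ⟨c, i, j, -, -, hv⟩ := this
      exact ⟨c, i, j, -1, rfl, hv⟩
    · intro i
      refine ⟨(μ i)⁻¹, i, i + 1, i.2.le, i.2, ?_⟩
      rw [tail_eq_add, neg_one_smul, add_neg_cancel_right, smul_smul, inv_mul_cancel₀ (hμ i).ne',
        one_smul]
    · rintro m v ⟨c, i, j, hi, hj, rfl⟩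
      refine ⟨c, _, _, swap_le m.2 hi, swap_le m.2 hj, ?_⟩
      rw [map_smul, typeA_s_sub hG m hi hj]
  -- Start from the simple normal e_i - e_{i+1} and raise the second index by swaps.
  · have hlt : ∀ i j : ℕ, i < j → j ≤ n →
        IsNormalMultiple W (tail μ α i + (-1 : ℝ) • tail μ α j) := by
      intro i j hij
      induction j, hij using Nat.le_induction with
      | base =>
        intro hi
        have h1 := tail_eq_add (μ := μ) (α := α) ⟨i, hi⟩
        dsimp only at h1
        rw [neg_one_smul, h1, add_neg_cancel_right]
        exact ⟨_, _, rfl⟩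
      | succ j hij ih =>
        intro hj
        have h1 := (ih (by omega)).map (α ⟨j, hj⟩).s
        rw [typeA_s_sub hG _ (by omega) (by omega)] at h1
        dsimp only at h1
        rwa [Equiv.swap_apply_left, Equiv.swap_apply_of_ne_of_ne (by omega) (by omega)] at h1
    rintro i j s rfl
    rw [← tail_min i, ← tail_min j]
    rcases lt_trichotomy (min i n) (min j n) with hij | hij | hij
    · exact hlt _ _ hij (min_le_right _ _)
    · rw [hij, neg_one_smul, add_neg_cancel]
      exact ⟨α ⟨0, hn⟩, 0, (zero_smul ℝ _).symm⟩
    · have h1 := (hlt _ _ hij (min_le_right _ _)).neg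
      rw [neg_one_smul] at h1 ⊢
      rwa [neg_add, neg_neg, add_comm] at h1

/-- In type B tail i is e_i itself. A reflection other than the last leaves the index n alone, where
the tail is zero, so no translation appears. -/
theorem typeB_s_tail {μ : Fin n → ℝ} (hG : HasGram μ α fun m => if m.1 + 1 = n then 1 else 2)
    (m : Fin n) (hm : m.1 + 1 < n) {i : ℕ} (hi : i ≤ n) :
    (α m).s.1 (tail μ α i) = tail μ α (Equiv.swap m.1 (m + 1) i) := by
  have hm' : ¬ m.1 + 1 = n := by omega
  rw [hG.s_tail m (by rw [if_neg hm']; exact two_ne_zero), tail_swap, hG.inner_tail m hi,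
    if_neg hm']
  congr 2
  split_ifs <;> first | (exfalso; omega) | norm_num

theorem typeB_s_tail_last {μ : Fin n → ℝ}
    (hG : HasGram μ α fun m => if m.1 + 1 = n then 1 else 2)
    (m : Fin n) (hm : m.1 + 1 = n) {i : ℕ} (hi : i ≤ n) :
    (α m).s.1 (tail μ α i) = (if i = m.1 then -1 else 1 : ℝ) • tail μ α i := by
  rw [hG.s_tail m (by rw [if_pos hm]; exact one_ne_zero), hG.inner_tail m hi, if_pos hm,
    tail_of_le (i := m.1 + 1) hm.ge, sub_zero]
  by_cases h1 : i = m.1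
  · subst h1
    rw [if_pos le_rfl, if_neg (by omega), if_neg (by omega), if_pos rfl]
    rw [neg_one_smul, sub_zero, sub_zero, mul_one, div_one, two_smul]
    abel
  · rw [if_neg h1, one_smul]
    have : (2 / 1 * ((if i ≤ m.1 then (1 : ℝ) else 0) - (if i + 1 ≤ m.1 then 1 else 0) -
        if i ≤ m.1 + 1 ∧ m.1 + 1 < n then 1 else 0)) = 0 := by
      split_ifs <;> first | (exfalso; omega) | norm_num
    rw [this, zero_smul, sub_zero]

theorem hasUniformRays_typeB [FiniteDimensional ℝ V] (h : IsSimpleSystem C α)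
    (hC : C.IsChamber) (hW : IsEssentialReflectionGroup W) (hn : 1 ≤ n) {μ : Fin n → ℝ}
    (hμ : ∀ i, 0 < μ i) (hG : HasGram μ α fun m => if m.1 + 1 = n then 1 else 2) :
    HasUniformRays W := by
  refine h.hasUniformRays_of_tail hC hW hμ {1, -1} (fun β => ?_) ?_
  · have := h.forall_unitNormal hC hW
      (Q := fun v => ∃ (c : ℝ) (i j : ℕ), i ≤ n ∧ j ≤ n ∧ ∃ s ∈ ({1, -1} : Set ℝ),
        v = c • (tail μ α i + s • tail μ α j)) ?_ ?_ β
    · obtain ⟨c, i, j, -, -, s, hs, hv⟩ := this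
      exact ⟨c, i, j, s, hs, hv⟩
    · intro i
      refine ⟨(μ i)⁻¹, i, i + 1, i.2.le, i.2, -1, by simp, ?_⟩
      rw [tail_eq_add, neg_one_smul, add_neg_cancel_right, smul_smul, inv_mul_cancel₀ (hμ i).ne',
        one_smul]
    · rintro m v ⟨c, i, j, hi, hj, s, hs, rfl⟩
      rcases Nat.lt_or_eq_of_le (Nat.succ_le_of_lt m.2) with hm | hm
      · refine ⟨c, _, _, swap_le m.2 hi, swap_le m.2 hj, s, hs, ?_⟩
        rw [map_smul, map_add, map_smul, typeB_s_tail hG m hm hi, typeB_s_tail hG m hm hj]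
      · have hs' : -s ∈ ({1, -1} : Set ℝ) := by
          rcases hs with rfl | rfl <;> simp
        rw [map_smul, map_add, map_smul, typeB_s_tail_last hG m hm hi,
          typeB_s_tail_last hG m hm hj]
        split_ifs
        · exact ⟨-c, i, j, hi, hj, s, hs, by module⟩
        · exact ⟨-c, i, j, hi, hj, -s, hs', by module⟩
        · exact ⟨c, i, j, hi, hj, -s, hs', by module⟩
        · exact ⟨c, i, j, hi, hj, s, hs, by module⟩
  -- The vector e_{n-1} is the last simple normal, and swaps lower the index; the index n gives the
  -- zero vector.
  · have hsingle : ∀ i : ℕ, i ≤ n → IsNormalMultiple W (tail μ α i) := by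
      intro i hi
      obtain ⟨d, hd⟩ := Nat.exists_eq_add_of_le hi
      induction d generalizing i with
      | zero =>
        rw [tail_of_le (by omega)]
        exact ⟨α ⟨0, hn⟩, 0, (zero_smul ℝ _).symm⟩
      | succ d ih =>
        rcases Nat.eq_zero_or_pos d with rfl | hd0
        · have h1 := tail_eq_add (μ := μ) (α := α) ⟨i, by omega⟩
          dsimp only at h1
          rw [h1, tail_of_le (by omega), add_zero]
          exact ⟨_, _, rfl⟩
        · have h1 := (ih (i + 1) (by omega) (by omega)).map (α ⟨i, by omega⟩).s
          rw [typeB_s_tail hG _ (by dsimp only; omega) (by omega)] at h1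
          dsimp only at h1
          rwa [Equiv.swap_apply_right] at h1
    have hsub : ∀ i j : ℕ, i < j → j < n → IsNormalMultiple W (tail μ α i - tail μ α j) := by
      intro i j hij
      induction j, hij using Nat.le_induction with
      | base =>
        intro hi
        have h1 := tail_eq_add (μ := μ) (α := α) ⟨i, by omega⟩
        dsimp only at h1
        rw [h1, add_sub_cancel_right]
        exact ⟨_, _, rfl⟩
      | succ j hij ih =>
        intro hj
        have h1 := (ih (by omega)).map (α ⟨j, by omega⟩).s
        rw [map_sub, typeB_s_tail hG _ hj (by omega), typeB_s_tail hG _ hj (by omega)] at h1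
        dsimp only at h1
        rwa [Equiv.swap_apply_left, Equiv.swap_apply_of_ne_of_ne (by omega) (by omega)] at h1
    -- The last reflection turns e_i - e_{n-1} into e_i + e_{n-1}; swaps then lower the second
    -- index.
    have hadd : ∀ i j : ℕ, i < j → j < n → IsNormalMultiple W (tail μ α i + tail μ α j) := by
      intro i j hij hj
      obtain ⟨d, hd⟩ := Nat.exists_eq_add_of_lt hj
      induction d generalizing j with
      | zero =>
        have h1 := (hsub i j hij hj).map (α ⟨j, hj⟩).s
        rw [map_sub, typeB_s_tail_last hG _ (by dsimp only; omega) (by omega),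
          typeB_s_tail_last hG _ (by dsimp only; omega) (by omega), if_neg (by dsimp only; omega),
          if_pos rfl, one_smul, neg_one_smul, sub_neg_eq_add] at h1
        exact h1
      | succ d ih =>
        have h1 := (ih (j + 1) (by omega) (by omega) (by omega)).map (α ⟨j, hj⟩).s
        rw [map_add, typeB_s_tail hG _ (by dsimp only; omega) (by omega),
          typeB_s_tail hG _ (by dsimp only; omega) (by omega)] at h1
        dsimp only at h1
        rwa [Equiv.swap_apply_right, Equiv.swap_apply_of_ne_of_ne (by omega) (by omega)] at h1
    have hlt : ∀ i j : ℕ, i < j → j ≤ n → ∀ s ∈ ({1, -1} : Set ℝ),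
        IsNormalMultiple W (tail μ α i + s • tail μ α j) := by
      intro i j hij hj s hs
      rcases Nat.lt_or_eq_of_le hj with hj' | rfl
      · rcases hs with rfl | rfl
        · rw [one_smul]; exact hadd i j hij hj'
        · rw [neg_one_smul, ← sub_eq_add_neg]; exact hsub i j hij hj'
      · rw [tail_of_le le_rfl, smul_zero, add_zero]
        exact hsingle i hij.le
    intro i j s hs
    rw [← tail_min i, ← tail_min j]
    rcases lt_trichotomy (min i n) (min j n) with hij | hij | hij
    · exact hlt _ _ hij (min_le_right _ _) s hs
    · rw [hij]
      have h1 := (hsingle _ (min_le_right j n)).smul (1 + s)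
      rwa [add_smul, one_smul] at h1
    · have h1 := (hlt _ _ hij (min_le_right _ _) s hs).smul s
      have hss : s * s = 1 := by rcases hs with rfl | rfl <;> norm_num
      rwa [smul_add, smul_smul, hss, one_smul, add_comm] at h1

end IsSimpleSystem

/-- Reflection groups of coincidental type have uniform rays. -/
theorem IsCoincidental.hasUniformRays [FiniteDimensional ℝ V] [Finite W]
    (hW : IsEssentialReflectionGroup W) (hc : IsCoincidental W) : HasUniformRays W := by
  obtain ⟨C, hC, hc⟩ := hc
  obtain ⟨Δ, hΔ⟩ := exists_isSimpleSystem hC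
  have hsq : √2 * √2 = (2 : ℝ) := Real.mul_self_sqrt (by norm_num)
  have h20 : (0 : ℝ) < √2 := Real.sqrt_pos.2 (by norm_num)
  have hlabel : ∀ {n : ℕ} {M : CoxeterMatrix (Fin n)}, HasCoxeterMatrix C M →
      ∃ α : Fin n → UnitNormal W, IsSimpleSystem C α ∧
        ∀ i j, orderOf ((α i).s * (α j).s) = M i j := by
    rintro n M ⟨e, he⟩
    obtain ⟨κ, hκ⟩ := hΔ.exists_reindex hC hW e
    exact ⟨_, hΔ.reindex κ, fun i j => by rw [hκ, hκ, he]⟩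
  rcases hc with ⟨n, hn, hM⟩ | ⟨n, hn, hM⟩ | hM | ⟨m, hm, hM⟩
  · obtain ⟨α, h, ho⟩ := hlabel hM
    -- The factor √2 turns unit normals into roots e_i - e_{i+1} of squared norm 2, with
    -- neighbouring inner products -1.
    refine h.hasUniformRays_typeA hC hW hn (μ := fun _ => √2) (fun _ => h20) fun m l => ?_
    rw [hsq]
    split_ifs with h1 h2
    · rw [h1, UnitNormal.inner_self, mul_one]
    · exact h.inner_of_orderOf_eq_three h1 (by rw [ho]; simp [CoxeterMatrix.A, h1, h2])
    · have h3 : orderOf ((α m).s * (α l).s) = 2 := by rw [ho]; simp [CoxeterMatrix.A, h1, h2]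
      rw [h.inner_eq_zero_of_sq h1 (by rw [← h3, pow_orderOf_eq_one]), mul_zero]
  · obtain ⟨α, h, ho⟩ := hlabel hM
    -- The last normal is the short root e_{n-1} and stays a unit vector; across the edge labelled 4
    -- the product of scales is √2, again giving -1.
    refine h.hasUniformRays_typeB hC hW (by omega)
      (μ := fun m => if m.1 + 1 = n then 1 else √2)
      (fun m => by split_ifs <;> first | exact one_pos | exact h20) fun m l => ?_
    beta_reduce
    by_cases h1 : m = l
    · subst h1
      rw [if_pos rfl, UnitNormal.inner_self]
      split_ifs
      · norm_num
      · rw [hsq, mul_one]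
    rw [if_neg h1]
    have h1' : m.1 ≠ l.1 := fun h' => h1 (Fin.ext h')
    by_cases h2 : l.1 + 1 = m.1 ∨ m.1 + 1 = l.1
    · rw [if_pos h2]
      by_cases h3 : m.1 = n - 1 ∧ l.1 = n - 2 ∨ l.1 = n - 1 ∧ m.1 = n - 2
      · have h4 := h.inner_of_orderOf_eq_four h1 (by rw [ho]; simp [CoxeterMatrix.B, h1, h3])
        rw [← h4]
        congr 1
        split_ifs <;> first | (exfalso; omega) | simp
      · have h4 := h.inner_of_orderOf_eq_three h1 (by rw [ho]; simp [CoxeterMatrix.B, h1, h2, h3])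
        rw [if_neg (by omega), if_neg (by omega), hsq, h4]
    · rw [if_neg h2]
      have h3 : ¬ (m.1 = n - 1 ∧ l.1 = n - 2 ∨ l.1 = n - 1 ∧ m.1 = n - 2) := by omega
      have h4 : orderOf ((α m).s * (α l).s) = 2 := by rw [ho]; simp [CoxeterMatrix.B, h1, h2, h3]
      rw [h.inner_eq_zero_of_sq h1 (by rw [← h4, pow_orderOf_eq_one]), mul_zero]
  · obtain ⟨α, h, ho⟩ := hlabel hM
    refine h.hasUniformRays_of_card_le_three hC hW (by simp) fun _ => ?_
    have hodd : ∀ i j, Odd (CoxeterMatrix.H₃ i j) → IsConj (α j).s (α i).s := fun i j hij =>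
      isConj_of_odd_orderOf (UnitNormal.s_mul_self _) (UnitNormal.s_mul_self _)
        (by rw [ho]; exact hij)
    -- The edge labels of H_3 are 3 and 5, both odd, so conjugacy spreads along the connected
    -- diagram.
    have h10 : IsConj (α 1).s (α 0).s := hodd 0 1 (by simp [CoxeterMatrix.H₃]; decide)
    have h21 : IsConj (α 2).s (α 1).s := hodd 1 2 (by simp [CoxeterMatrix.H₃]; decide)
    have h0 : ∀ i, IsConj (α i).s (α 0).s := by
      intro i
      fin_cases i
      · exact IsConj.refl _
      · exact h10
      · exact h21.trans h10
    exact fun i j => (h0 i).trans (h0 j).symm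
  · obtain ⟨α, h, ho⟩ := hlabel hM
    -- Dihedral groups have rank two, so the conjugacy condition for rank three is vacuous.
    exact h.hasUniformRays_of_card_le_three hC hW (by simp) fun h3 => by simp at h3

end ReflArr

end

theorem proposition4p3 {V : Type*} [NormedAddCommGroup V] [InnerProductSpace ℝ V]
    [FiniteDimensional ℝ V] (W : Subgroup (V ≃ₗᵢ[ℝ] V)) [Finite W]
    (hW : ReflArr.IsEssentialReflectionGroup W) (hc : ReflArr.IsCoincidental W)
    (C : ReflArr.Face W) (hC : C.IsChamber) :
    (∀ X : ReflArr.Flat W, ReflArr.rayCount X = ReflArr.sigma W (Module.finrank ℝ X.space)) ∧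
    StrictMonoOn (ReflArr.sigma W) (Set.Iic (Module.finrank ℝ V)) ∧
    ∀ k : ℕ, k ≤ Module.finrank ℝ V →
      LinearMap.range (LinearMap.mulRight ℝ (ReflArr.barrProjector C k)) =
        Module.End.eigenspace (LinearMap.mulRight ℝ (ReflArr.barrElement C))
          (ReflArr.sigma W k : ℝ) ∧
      ∃ hk : ReflArr.eulerianIdempotent W k ∈ ReflArr.invariants W,
        ReflArr.barrProjector C k =
          ReflArr.bidigare C ⟨ReflArr.eulerianIdempotent W k, hk⟩ :=
  (ReflArr.IsCoincidental.hasUniformRays hW hc).barrProjector_spec hW C hC
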